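/- All graphs are finite and simple. For a graph $G$, let $\Delta(G)$ be its maximum degree, $\omega(G)$ the size of its largest clique, and $\alpha(G)$ the size of its largest independent set. A \emph{diamond graph} is $K_4$ minus one edge; its two non-adjacent vertices are called its \emph{tips}. The \emph{diamond necklaces} are the three graphs, on $6$, $9$ and $12$ vertices, obtained from a triangle by replacing one, two or three of its vertices, respectively, by a diamond graph, where the two edges of the triangle incident with a replaced vertex are attached to the two distinct tips of the diamond replacing it. The \emph{Havel necklaces} are the following two graphs: the graph on the $9$ vertices $a,b,c,x,y,z,k,l,q$ with edges $ab,ac,bc$, $xy,xz,yz$, $ax$, $bk,ky$, $cl,lz$, $kq,ql$; and the graph on $12$ vertices obtained from it by replacing $q$ by a diamond graph, with one tip adjacent to $k$ and the other tip adjacent to $l$. The \emph{triangle-dominated $6$-cycle} is the graph on $12$ vertices consisting of a $6$-cycle $c_1c_2c_3c_4c_5c_6$, two disjoint triangles $t_1t_3t_5$ and $t_2t_4t_6$, and the edges $c_it_i$ for $1\le i\le 6$. A \emph{necklace} is a diamond necklace or a Havel necklace. A graph is \emph{$3$-tight} if it is isomorphic to a triangle, to a necklace, or to the triangle-dominated $6$-cycle.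 A vertex of $G$ is \emph{$3$-free} if it is not contained in any $3$-tight induced subgraph of $G$. A \emph{diamond} of $G$ is an induced subgraph of $G$ isomorphic to the diamond graph; it is \emph{free} if it is not contained in an induced subgraph of $G$ isomorphic to a necklace. Let $m(G)$ be the number of $3$-free vertices of $G$ plus the number of free diamonds of $G$. \textbf{Lemma.} If $G$ is an $n$-vertex graph with $\max(\Delta(G),\omega(G))\le 3$, then $$\alpha(G)\ge \frac{n}{3}+\frac{1}{42}\,m(G).$$ -/

import Mathlib

namespace ThreeTight

/-- The graph on `Fin n` whose edges are the pairs in the list `l`. -/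
def graphOfEdges (n : ℕ) (l : List (Fin n × Fin n)) : SimpleGraph (Fin n) :=
  SimpleGraph.fromRel fun a b => (a, b) ∈ l

/-- `K₄` minus one edge; the missing edge is `{2, 3}`. -/
def diamondGraph : SimpleGraph (Fin 4) :=
  graphOfEdges 4 [(0, 1), (0, 2), (0, 3), (1, 2), (1, 3)]

/-- The 6-vertex diamond necklace: a diamond on `0, 1, 2, 3` (with non-adjacent vertices `2, 3`)
whose non-adjacent vertices are joined by the path `3, 4, 5, 2`. -/
def diamondNecklace6 : SimpleGraph (Fin 6) :=
  graphOfEdges 6 [(0, 1), (0, 2), (0, 3), (1, 2), (1, 3), (3, 4), (4, 5), (5, 2)]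

/-- The 9-vertex diamond necklace: diamonds on `0, 1, 2, 3` and `4, 5, 6, 7` and the vertex `8`,
joined cyclically by the edges `{3, 6}`, `{7, 8}`, `{8, 2}`. -/
def diamondNecklace9 : SimpleGraph (Fin 9) :=
  graphOfEdges 9 [(0, 1), (0, 2), (0, 3), (1, 2), (1, 3),
    (4, 5), (4, 6), (4, 7), (5, 6), (5, 7),
    (3, 6), (7, 8), (8, 2)]

/-- The 12-vertex diamond necklace: diamonds on `0, 1, 2, 3`, on `4, 5, 6, 7` and on
`8, 9, 10, 11`, joined cyclically by the edges `{3, 6}`, `{7, 10}`, `{11, 2}`. -/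
def diamondNecklace12 : SimpleGraph (Fin 12) :=
  graphOfEdges 12 [(0, 1), (0, 2), (0, 3), (1, 2), (1, 3),
    (4, 5), (4, 6), (4, 7), (5, 6), (5, 7),
    (8, 9), (8, 10), (8, 11), (9, 10), (9, 11),
    (3, 6), (7, 10), (11, 2)]

/-- The 9-vertex (diamond-free) Havel necklace: triangles `0, 1, 2` and `3, 4, 5`, the edge
`{0, 3}`, the paths `1, 6, 4` and `2, 7, 5`, and the path `6, 8, 7`. -/
def havelNecklace9 : SimpleGraph (Fin 9) :=
  graphOfEdges 9 [(0, 1), (0, 2), (1, 2), (3, 4), (3, 5), (4, 5), (0, 3),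
    (1, 6), (6, 4), (2, 7), (7, 5), (6, 8), (8, 7)]

/-- The 12-vertex Havel necklace: as the 9-vertex one, but with the vertex `8` replaced by a
diamond on `8, 9, 10, 11` whose non-adjacent vertices `10`, `11` are joined to `6`, `7`. -/
def havelNecklace12 : SimpleGraph (Fin 12) :=
  graphOfEdges 12 [(0, 1), (0, 2), (1, 2), (3, 4), (3, 5), (4, 5), (0, 3),
    (1, 6), (6, 4), (2, 7), (7, 5),
    (8, 9), (8, 10), (8, 11), (9, 10), (9, 11), (6, 10), (7, 11)]

/-- The triangle-dominated 6-cycle: the 6-cycle `0, 1, 2, 3, 4, 5`, a triangle `6, 7, 8` matched to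
the even vertices of the cycle and a triangle `9, 10, 11` matched to its odd vertices. -/
def triangleDominatedSixCycle : SimpleGraph (Fin 12) :=
  graphOfEdges 12 [(0, 1), (1, 2), (2, 3), (3, 4), (4, 5), (5, 0),
    (6, 7), (7, 8), (8, 6), (0, 6), (2, 7), (4, 8),
    (9, 10), (10, 11), (11, 9), (1, 9), (3, 10), (5, 11)]

/-- `H` is (isomorphic to) a diamond necklace. -/
def IsDiamondNecklace {W : Type*} (H : SimpleGraph W) : Prop :=
  Nonempty (H ≃g diamondNecklace6) ∨ Nonempty (H ≃g diamondNecklace9) ∨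
    Nonempty (H ≃g diamondNecklace12)

/-- `H` is (isomorphic to) a Havel necklace. -/
def IsHavelNecklace {W : Type*} (H : SimpleGraph W) : Prop :=
  Nonempty (H ≃g havelNecklace9) ∨ Nonempty (H ≃g havelNecklace12)

/-- A necklace is a diamond necklace or a Havel necklace. -/
def IsNecklace {W : Type*} (H : SimpleGraph W) : Prop :=
  IsDiamondNecklace H ∨ IsHavelNecklace H

/-- `H` is 3-tight: a triangle, a necklace, or a triangle-dominated 6-cycle. -/
def IsThreeTight {W : Type*} (H : SimpleGraph W) : Prop :=
  Nonempty (H ≃g (⊤ : SimpleGraph (Fin 3))) ∨ IsNecklace H ∨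
    Nonempty (H ≃g triangleDominatedSixCycle)

/-- The vertex `v` is 3-free: it lies in no 3-tight induced subgraph of `G`. -/
def IsThreeFree {V : Type*} (G : SimpleGraph V) (v : V) : Prop :=
  ∀ s : Set V, v ∈ s → ¬ IsThreeTight (G.induce s)

/-- The vertex set `D` induces a diamond of `G`. -/
def IsDiamond {V : Type*} (G : SimpleGraph V) (D : Set V) : Prop :=
  Nonempty (G.induce D ≃g diamondGraph)

/-- The vertex set `D` induces a free diamond of `G`: a diamond contained in no induced necklace. -/
def IsFreeDiamond {V : Type*} (G : SimpleGraph V) (D : Set V) : Prop :=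
  IsDiamond G D ∧ ∀ s : Set V, D ⊆ s → ¬ IsNecklace (G.induce s)

/-- `m(G)`: the number of 3-free vertices plus the number of free diamonds of a finite graph. -/
noncomputable def freeCount {V : Type*} (G : SimpleGraph V) : ℕ :=
  {v : V | IsThreeFree G v}.ncard + {D : Set V | IsFreeDiamond G D}.ncard

end ThreeTight

/-! Everything is done relative to a finite vertex set `S`, with denominators cleared. The target
`Good` reads `14 n + f + d ≤ 42 α`, where `f` and `d` count the 3-free vertices and free diamonds of
`G[S]`. Note that 1/42 = 5/14 - 1/3, so on triangle-free graphs the target follows from Staton's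
bound `α ≥ 5n/14`.

Consider a minimal counterexample (`MinG`). A reduction deletes a set `X`, possibly adds edges, and
extends every independent set of the smaller graph by `k` vertices. It gives a contradiction as soon
as `42 k` covers `14 |X|` plus the loss in `f + d`. A free diamond is contracted to a single vertex:
one independent vertex is gained for three deleted ones, and the surviving vertex becomes 3-free and
pays for the diamond (`MinG.no_fdiam`). Necklaces are the graphs that obstruct this. A necklace or
triangle-dominated 6-cycle contains no 3-free vertex and has an independent third with no outside
neighbours, so it can be deleted (`MinG.no_big`). Hence no diamond is left. The outside neighbours
of a triangle are then distinct, pairwise non-adjacent, and pairwise have common neighbours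
(`TriX.common`); both resulting configurations are reducible (`TriX.no_claw`, `TriX.no_hex`). So the
graph is triangle-free and Staton's bound finishes.

Staton's bound comes from the sharper inequality `7 α ≥ 4 n - e - λ` for triangle-free subcubic
graphs, where `λ` is the number of difficult components. `Claim` is this inequality doubled, because
`E G S S` counts every edge twice. A minimal counterexample has no bridge (`MinCl.bridge`), so
difficult sets inside it send out many edges (`MinCl.diff_bd`). Deleting small sets then leaves too
few edges to create the difficult components that a failure would need. This excludes vertices of
degree two, and finally the cubic case. -/

namespace ThreeTight
open scoped Classical

/-! ### Counting edges between vertex sets -/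

variable {V : Type*}

/-- The neighbours of `v` inside `S`. -/
noncomputable def nb (G : SimpleGraph V) (S : Finset V) (v : V) : Finset V := S.filter (G.Adj v)

/-- The finite vertex set `I` is independent in `G`. -/
def Indep (G : SimpleGraph V) (I : Finset V) : Prop := ∀ u ∈ I, ∀ v ∈ I, ¬ G.Adj u v

/-- The number of pairs in `A × B` that are adjacent in `G`. -/
noncomputable def E (G : SimpleGraph V) (A B : Finset V) : ℕ := ∑ v ∈ A, (nb G B v).card

variable {G : SimpleGraph V} {A B C S T X I J : Finset V} {u v w : V}

@[simp] lemma mem_nb : w ∈ nb G S v ↔ w ∈ S ∧ G.Adj v w := by simp [nb]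

lemma nb_subset : nb G S v ⊆ S := Finset.filter_subset _ _

lemma nb_mono (h : A ⊆ B) : nb G A v ⊆ nb G B v := Finset.filter_subset_filter _ h

lemma nb_card_mono (h : A ⊆ B) : (nb G A v).card ≤ (nb G B v).card :=
  Finset.card_le_card (nb_mono h)

lemma nb_union_card (h : Disjoint A B) :
    (nb G (A ∪ B) v).card = (nb G A v).card + (nb G B v).card := by
  rw [nb, Finset.filter_union, Finset.card_union_of_disjoint]; · rfl
  exact Finset.disjoint_filter_filter h

lemma E_comm : E G A B = E G B A := by
  have := Finset.sum_card_bipartiteAbove_eq_sum_card_bipartiteBelow (s := A) (t := B) G.Adj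
  simpa [E, nb, Finset.bipartiteAbove, Finset.bipartiteBelow, G.adj_comm] using this

lemma E_union_left (h : Disjoint A B) : E G (A ∪ B) C = E G A C + E G B C :=
  Finset.sum_union h

lemma E_union_right (h : Disjoint A B) : E G C (A ∪ B) = E G C A + E G C B := by
  rw [E_comm, E_union_left h, E_comm, E_comm (A := B)]

@[simp] lemma E_empty_left : E G ∅ B = 0 := by simp [E]
@[simp] lemma E_empty_right : E G B ∅ = 0 := by rw [E_comm]; simp

lemma E_insert_left (h : v ∉ A) : E G (insert v A) B = (nb G B v).card + E G A B :=
  Finset.sum_insert h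

lemma E_singleton_left : E G {v} B = (nb G B v).card := Finset.sum_singleton _ _

lemma E_mono_left (h : A ⊆ B) : E G A C ≤ E G B C :=
  Finset.sum_le_sum_of_subset h

lemma E_eq_zero : E G A B = 0 ↔ ∀ u ∈ A, ∀ v ∈ B, ¬ G.Adj u v := by
  simp [E, Finset.sum_eq_zero_iff, nb, Finset.filter_eq_empty_iff]

lemma E_pos (hu : u ∈ A) (hv : v ∈ B) (h : G.Adj u v) : 1 ≤ E G A B := by
  rw [Nat.one_le_iff_ne_zero, Ne, E_eq_zero]
  exact fun k => k u hu v hv h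

lemma E_split (h : A ⊆ S) : E G B S = E G B A + E G B (S \ A) := by
  rw [← E_union_right Finset.disjoint_sdiff, Finset.union_sdiff_of_subset h]

lemma E_split_left (h : A ⊆ S) : E G S B = E G A B + E G (S \ A) B := by
  rw [E_comm, E_split h, E_comm, E_comm (A := B)]

lemma E_self_split (h : A ⊆ S) :
    E G S S = E G A A + 2 * E G A (S \ A) + E G (S \ A) (S \ A) := by
  rw [E_split h, E_split_left (B := A) h, E_split_left (B := S \ A) h, E_comm (A := S \ A) (B := A)]
  ring

lemma E_le_mul (k : ℕ) (h : ∀ v ∈ A, (nb G B v).card ≤ k) : E G A B ≤ k * A.card := by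
  rw [mul_comm]; exact Finset.sum_le_card_nsmul _ _ _ h

lemma E_eq_mul (k : ℕ) (h : ∀ v ∈ A, (nb G B v).card = k) : E G A B = k * A.card := by
  rw [E, Finset.sum_congr rfl h]; simp [mul_comm]

lemma Indep.mono (h : Indep G B) (hs : A ⊆ B) : Indep G A :=
  fun u hu v hv => h u (hs hu) v (hs hv)

lemma Indep.union (hA : Indep G A) (hB : Indep G B) (h : ∀ u ∈ A, ∀ v ∈ B, ¬ G.Adj u v) :
    Indep G (A ∪ B) := by
  intro u hu v hv huv
  rcases Finset.mem_union.1 hu with h1 | h1 <;> rcases Finset.mem_union.1 hv with h2 | h2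
  · exact hA u h1 v h2 huv
  · exact h u h1 v h2 huv
  · exact h v h2 u h1 huv.symm
  · exact hB u h1 v h2 huv

lemma eq_of_card_nb_le {k : ℕ} (h : (nb G S v).card ≤ k) {t : Finset V} (ht : t ⊆ nb G S v)
    (hc : k ≤ t.card) : nb G S v = t :=
  (Finset.eq_of_subset_of_card_le ht (h.trans hc)).symm

/-! ### Copies of pattern graphs, recognised by degrees -/

instance graphOfEdgesDec (n : ℕ) (l : List (Fin n × Fin n)) :
    DecidableRel (graphOfEdges n l).Adj := fun a b =>
  decidable_of_iff (a ≠ b ∧ ((a, b) ∈ l ∨ (b, a) ∈ l)) (by simp [graphOfEdges])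

instance : DecidableRel diamondGraph.Adj := graphOfEdgesDec _ _
instance : DecidableRel diamondNecklace6.Adj := graphOfEdgesDec _ _
instance : DecidableRel diamondNecklace9.Adj := graphOfEdgesDec _ _
instance : DecidableRel diamondNecklace12.Adj := graphOfEdgesDec _ _
instance : DecidableRel havelNecklace9.Adj := graphOfEdgesDec _ _
instance : DecidableRel havelNecklace12.Adj := graphOfEdgesDec _ _
instance : DecidableRel triangleDominatedSixCycle.Adj := graphOfEdgesDec _ _

lemma hom_of_edges {n : ℕ} {l : List (Fin n × Fin n)} {f : Fin n → V}
    (h : ∀ e ∈ l, G.Adj (f e.1) (f e.2)) (i j : Fin n) (hij : (graphOfEdges n l).Adj i j) :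
    G.Adj (f i) (f j) := by
  simp only [graphOfEdges, SimpleGraph.fromRel_adj] at hij
  rcases hij.2 with h1 | h1
  · exact h _ h1
  · exact (h _ h1).symm

/-- The number of neighbours of `i` in the pattern `P`. -/
def pdeg {n : ℕ} (P : SimpleGraph (Fin n)) [DecidableRel P.Adj] (i : Fin n) : ℕ :=
  (Finset.univ.filter (P.Adj i)).card

/-- The image of a pattern. -/
noncomputable def img {n : ℕ} (f : Fin n → V) : Finset V := Finset.univ.image f

@[simp] lemma mem_img {n : ℕ} {f : Fin n → V} : v ∈ img f ↔ ∃ i, f i = v := by simp [img]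

lemma img_card {n : ℕ} {f : Fin n → V} (h : Function.Injective f) : (img f).card = n := by
  simp [img, Finset.card_image_of_injective _ h]

/-- Inducedness comes for free: for each non-edge of the pattern, one end already has as many
neighbours in the copy as its degree in `S` allows. -/
lemma emb_of_hom {n : ℕ} (P : SimpleGraph (Fin n)) [DecidableRel P.Adj] (f : Fin n → V)
    (inj : Function.Injective f) (mem : ∀ i, f i ∈ S) (hom : ∀ i j, P.Adj i j → G.Adj (f i) (f j))
    (hd : ∀ i j, i ≠ j → ¬ P.Adj i j →
      (nb G S (f i)).card ≤ pdeg P i ∨ (nb G S (f j)).card ≤ pdeg P j) :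
    ∃ g : P ↪g G, ∀ i, g i = f i := by
  have key : ∀ i j, i ≠ j → ¬ P.Adj i j → (nb G S (f i)).card ≤ pdeg P i →
      ¬ G.Adj (f i) (f j) := by
    intro i j hij hP hc hG
    have hsub : insert (f j) ((Finset.univ.filter (P.Adj i)).image f) ⊆ nb G S (f i) := by
      intro x hx
      rcases Finset.mem_insert.1 hx with rfl | hx
      · exact mem_nb.2 ⟨mem j, hG⟩
      · obtain ⟨k, hk, rfl⟩ := Finset.mem_image.1 hx
        exact mem_nb.2 ⟨mem k, hom _ _ (Finset.mem_filter.1 hk).2⟩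
    have h2 := Finset.card_le_card hsub
    rw [Finset.card_insert_of_notMem, Finset.card_image_of_injective _ inj] at h2
    · unfold pdeg at hc; omega
    · intro hx
      obtain ⟨k, hk, hkj⟩ := Finset.mem_image.1 hx
      exact hP (inj hkj ▸ (Finset.mem_filter.1 hk).2)
  refine ⟨⟨⟨f, inj⟩, ?_⟩, fun i => rfl⟩
  intro i j
  refine ⟨fun h => ?_, hom i j⟩
  by_contra hP
  have hij : i ≠ j := fun e => by subst e; exact G.irrefl h
  rcases hd i j hij hP with h1 | h1
  · exact key i j hij hP h1 h
  · exact key j i hij.symm (fun h => hP h.symm) h1 h.symm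

lemma card_nb_img {n : ℕ} (P : SimpleGraph (Fin n)) [DecidableRel P.Adj] (f : P ↪g G) (i : Fin n) :
    (nb G (img f) (f i)).card = pdeg P i := by
  rw [pdeg, ← Finset.card_image_of_injective _ f.injective]
  congr 1
  ext x
  simp only [mem_nb, mem_img, Finset.mem_image, Finset.mem_filter, Finset.mem_univ, true_and]
  constructor
  · rintro ⟨⟨j, rfl⟩, h⟩; exact ⟨j, f.map_rel_iff.1 h, rfl⟩
  · rintro ⟨j, h, rfl⟩; exact ⟨⟨j, rfl⟩, f.map_rel_iff.2 h⟩

lemma nb_img_of_full {n : ℕ} (P : SimpleGraph (Fin n)) [DecidableRel P.Adj] (f : P ↪g G)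
    (hS : ∀ i, f i ∈ S) (i : Fin n) (h : (nb G S (f i)).card ≤ pdeg P i) :
    nb G S (f i) = nb G (img f) (f i) :=
  eq_of_card_nb_le h (nb_mono (by intro x; simp; rintro j rfl; exact hS j)) (card_nb_img P f i).ge

lemma E_img {n : ℕ} (P : SimpleGraph (Fin n)) [DecidableRel P.Adj] (f : P ↪g G) :
    E G (img f) (img f) = ∑ i, pdeg P i := by
  rw [E, img, Finset.sum_image (fun a _ b _ h => f.injective h)]
  exact Finset.sum_congr rfl fun i _ => card_nb_img P f i

end ThreeTight

/-! ### Triangle-free subcubic graphs: difficult sets and the stronger inequality -/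

namespace ThreeTight
open scoped Classical

variable {V : Type*} {G : SimpleGraph V} {A B C S T X I J R : Finset V} {u v w : V}

/-- The 5-cycle. -/
def c5 : SimpleGraph (Fin 5) := graphOfEdges 5 [(0, 1), (1, 2), (2, 3), (3, 4), (4, 0)]

/-- The graph obtained from `K₄` by subdividing twice each edge of a perfect matching. -/
def k4s : SimpleGraph (Fin 8) :=
  graphOfEdges 8 [(0, 2), (0, 3), (1, 2), (1, 3), (0, 4), (4, 5), (5, 1), (2, 6), (6, 7), (7, 3)]

instance : DecidableRel c5.Adj := graphOfEdgesDec _ _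
instance : DecidableRel k4s.Adj := graphOfEdgesDec _ _

/-- The difficult vertex sets: they induce trees of 5-cycles and copies of `k4s`. -/
inductive Diff (G : SimpleGraph V) : Finset V → Prop
  | c5 (f : c5 ↪g G) : Diff G (img f)
  | k4s (f : k4s ↪g G) : Diff G (img f)
  | join (B C : Finset V) (hB : Diff G B) (hC : Diff G C) (hd : Disjoint B C)
      (hE : E G B C = 1) : Diff G (B ∪ C)

/-- A family of pairwise disjoint difficult sets, each a union of components of `G[S]`. -/
structure Fam (G : SimpleGraph V) (S : Finset V) (F : Finset (Finset V)) : Prop where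
  diff : ∀ B ∈ F, Diff G B
  sub : ∀ B ∈ F, B ⊆ S
  closed : ∀ B ∈ F, E G B (S \ B) = 0
  disj : ∀ B ∈ F, ∀ C ∈ F, B ≠ C → Disjoint B C

/-- The lower bound on the independence number of a triangle-free subcubic graph. -/
def Claim (G : SimpleGraph V) (S : Finset V) : Prop :=
  ∃ I F, I ⊆ S ∧ Indep G I ∧ Fam G S F ∧ 8 * S.card ≤ 14 * I.card + E G S S + 2 * F.card

/-- `G[S]` is subcubic and triangle-free. -/
structure Subcubic (G : SimpleGraph V) (S : Finset V) : Prop where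
  deg : ∀ v ∈ S, (nb G S v).card ≤ 3
  tf : ∀ u ∈ S, ∀ v ∈ S, ∀ w ∈ S, G.Adj u v → G.Adj v w → ¬ G.Adj u w

/-- `G[S]` is a minimal counterexample to `Claim`. -/
structure MinCl (G : SimpleGraph V) (S : Finset V) : Prop where
  ok : Subcubic G S
  fail : ¬ Claim G S
  ih : ∀ (G' : SimpleGraph V) (S' : Finset V), S'.card < S.card → Subcubic G' S' → Claim G' S'

lemma Subcubic.mono (h : Subcubic G S) (hs : T ⊆ S) : Subcubic G T :=
  ⟨fun v hv => (nb_card_mono hs).trans (h.deg v (hs hv)),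
    fun u hu v hv w hw => h.tf u (hs hu) v (hs hv) w (hs hw)⟩

lemma Diff.nonempty (h : Diff G B) : B.Nonempty := by
  induction h with
  | c5 f => exact ⟨f 0, by simp⟩
  | k4s f => exact ⟨f 0, by simp⟩
  | join B C hB hC hd hE h1 h2 => exact h1.mono Finset.subset_union_left

lemma Fam.empty : Fam G S ∅ := ⟨by simp, by simp, by simp, by simp⟩

lemma Fam.sum_le {F : Finset (Finset V)} (h : Fam G R F) {c : ℕ}
    (hc : ∀ B ∈ F, c ≤ E G B X) : c * F.card ≤ E G R X := by
  have h1 : E G (F.biUnion id) X = ∑ B ∈ F, E G B X := by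
    unfold E
    rw [Finset.sum_biUnion]; · rfl
    intro B hB C hC hne
    exact h.disj B hB C hC hne
  calc c * F.card ≤ ∑ B ∈ F, E G B X := by
        rw [mul_comm]; exact Finset.card_nsmul_le_sum _ _ _ hc
    _ = E G (F.biUnion id) X := h1.symm
    _ ≤ E G R X := E_mono_left (Finset.biUnion_subset.2 h.sub)

lemma Fam.union {F F' : Finset (Finset V)} (hB : B ⊆ S) (h : Fam G B F) (h' : Fam G (S \ B) F')
    (h0 : E G B (S \ B) = 0) : Fam G S (F ∪ F') ∧ (F ∪ F').card = F.card + F'.card := by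
  have hd : ∀ C ∈ F, ∀ D ∈ F', Disjoint C D := fun C hC D hD =>
    Finset.disjoint_of_subset_left (h.sub C hC)
      (Finset.disjoint_of_subset_right (h'.sub D hD) Finset.disjoint_sdiff)
  refine ⟨⟨?_, ?_, ?_, ?_⟩, Finset.card_union_of_disjoint ?_⟩
  · intro C hC
    rcases Finset.mem_union.1 hC with hC | hC
    exacts [h.diff C hC, h'.diff C hC]
  · intro C hC
    rcases Finset.mem_union.1 hC with hC | hC
    exacts [(h.sub C hC).trans hB, (h'.sub C hC).trans Finset.sdiff_subset]
  · intro C hC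
    rw [E_eq_zero] at *
    intro a ha b hb hab
    rw [Finset.mem_sdiff] at hb
    rcases Finset.mem_union.1 hC with hC | hC
    · have := E_eq_zero.1 (h.closed C hC) a ha b
      have h3 := h0 a (h.sub C hC ha) b
      simp only [Finset.mem_sdiff] at this h3
      tauto
    · have := E_eq_zero.1 (h'.closed C hC) a ha b
      have h3 := h0 b
      have h4 := h'.sub C hC ha
      by_cases hbB : b ∈ B
      · exact h3 hbB a h4 hab.symm
      · simp only [Finset.mem_sdiff] at this
        tauto
  · intro C hC D hD hne
    rcases Finset.mem_union.1 hC with hC | hC <;> rcases Finset.mem_union.1 hD with hD | hD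
    · exact h.disj C hC D hD hne
    · exact hd C hC D hD
    · exact (hd D hD C hC).symm
    · exact h'.disj C hC D hD hne
  · rw [Finset.disjoint_left]
    intro C hC hC'
    obtain ⟨x, hx⟩ := (h.diff C hC).nonempty
    exact Finset.disjoint_left.1 (hd C hC C hC') hx hx

/-! ### Minimal counterexamples to the stronger inequality have no bridge -/

namespace MinCl

lemma not_diff (h : MinCl G S) : ¬ (Diff G S ∧ ∃ I ⊆ S, Indep G I ∧
    8 * S.card ≤ 14 * I.card + E G S S + 2) := by
  rintro ⟨hd, I, hI, hi, hc⟩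
  refine h.fail ⟨I, {S}, hI, hi, ⟨by simpa, by simp, by simp, by simp⟩, by simpa using hc⟩

lemma not_zero (h : MinCl G S) : ¬ (∃ I ⊆ S, Indep G I ∧ 8 * S.card ≤ 14 * I.card + E G S S) := by
  rintro ⟨I, hI, hi, hc⟩
  exact h.fail ⟨I, ∅, hI, hi, Fam.empty, by simpa using hc⟩

lemma conn (h : MinCl G S) (hB : B ⊆ S) (hne : B.Nonempty) (hS : B ≠ S) :
    1 ≤ E G B (S \ B) := by
  by_contra h0
  replace h0 : E G B (S \ B) = 0 := by omega
  have c1 : (S \ B).card + B.card = S.card := Finset.card_sdiff_add_card_eq_card hB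
  have hlt : B.card < S.card := Finset.card_lt_card (Finset.ssubset_iff_subset_ne.2 ⟨hB, hS⟩)
  have hpos := hne.card_pos
  obtain ⟨I, F, hI, hi, hF, hc⟩ := h.ih G B hlt (h.ok.mono hB)
  obtain ⟨I', F', hI', hi', hF', hc'⟩ := h.ih G (S \ B) (by omega) (h.ok.mono Finset.sdiff_subset)
  obtain ⟨hU, hUc⟩ := hF.union hB hF' h0
  refine h.fail ⟨I ∪ I', F ∪ F', Finset.union_subset (hI.trans hB) (hI'.trans Finset.sdiff_subset),
    hi.union hi' fun a ha b hb => E_eq_zero.1 h0 a (hI ha) b (hI' hb), hU, ?_⟩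
  have hd : Disjoint I I' := Finset.disjoint_of_subset_left hI
      (Finset.disjoint_of_subset_right hI' Finset.disjoint_sdiff)
  rw [Finset.card_union_of_disjoint hd, hUc, E_self_split hB]
  omega

lemma deletion (h : MinCl G S) (hX : X ⊆ S) (hne : X.Nonempty) (hI : I ⊆ X) (hi : Indep G I)
    (hn : ∀ u ∈ I, nb G S u ⊆ X) : ∃ F, Fam G (S \ X) F ∧
      (∀ B ∈ F, E G B (S \ B) = E G B X) ∧
      14 * I.card + E G X X + 2 * E G X (S \ X) < 8 * X.card + 2 * F.card ∧
      ∀ c, (∀ B ∈ F, c ≤ E G B (S \ B)) → c * F.card ≤ E G X (S \ X) := by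
  have c1 : (S \ X).card + X.card = S.card := Finset.card_sdiff_add_card_eq_card hX
  have hpos := hne.card_pos
  obtain ⟨I', F', hI', hi', hF', hc'⟩ := h.ih G (S \ X) (by omega) (h.ok.mono Finset.sdiff_subset)
  have hE : ∀ B ∈ F', E G B (S \ B) = E G B X := by
    intro B hB
    have hs := hF'.sub B hB
    have : S \ B = X ∪ ((S \ X) \ B) := by
      ext x
      have h1 := @hX x
      have h2 := @hs x
      simp only [Finset.mem_sdiff, Finset.mem_union] at *
      tauto
    rw [this, E_union_right, hF'.closed B hB, add_zero]
    exact Finset.disjoint_of_subset_right Finset.sdiff_subset Finset.disjoint_sdiff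
  refine ⟨F', hF', hE, ?_, ?_⟩
  · by_contra hlt
    refine h.not_zero ⟨I ∪ I', Finset.union_subset (hI.trans hX) (hI'.trans Finset.sdiff_subset),
      hi.union hi' fun a ha b hb hab => ?_, ?_⟩
    · have := Finset.mem_sdiff.1 (hI' hb)
      exact this.2 (hn a ha (mem_nb.2 ⟨this.1, hab⟩))
    · have hd : Disjoint I I' := Finset.disjoint_of_subset_left hI
        (Finset.disjoint_of_subset_right hI' Finset.disjoint_sdiff)
      rw [Finset.card_union_of_disjoint hd, E_self_split hX]
      omega
  · intro c hc
    rw [E_comm]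
    exact hF'.sum_le fun B hB => hE B hB ▸ hc B hB

/-- What one side of a bridge at `u` can offer. Compare a solution `I` for `B` with a solution `J`
for `B - u`, which avoids `u`. If `J` is at least as large, it replaces `I`; otherwise `I` is larger
by at least one, which leaves a surplus of 6. -/
lemma side (h : MinCl G S) (hB : B ⊆ S) (hS : B ≠ S) (hu : u ∈ B)
    (h1 : E G B (S \ B) = 1) (h0 : E G (B.erase u) (S \ B) = 0) :
    ∃ I ⊆ B, Indep G I ∧ ((u ∉ I ∧ 8 * B.card ≤ 14 * I.card + E G B B) ∨
      (u ∉ I ∧ Diff G B ∧ 8 * B.card ≤ 14 * I.card + E G B B + 2) ∨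
      (8 * B.card + 6 ≤ 14 * I.card + E G B B)) := by
  have hlt : B.card < S.card := Finset.card_lt_card (Finset.ssubset_iff_subset_ne.2 ⟨hB, hS⟩)
  have hBe : B.erase u ⊆ B := Finset.erase_subset _ _
  have hce := Finset.card_erase_add_one hu
  obtain ⟨J, FJ, hJ, hj, hFJ, hcJ⟩ := h.ih G (B.erase u) (by omega) (h.ok.mono (hBe.trans hB))
  have hsplit := E_self_split (G := G) (Finset.singleton_subset_iff.2 hu)
  rw [← Finset.erase_eq] at hsplit
  -- By connectivity every difficult component of `B - u` is joined to `u`, so these components are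
  -- paid for by the edges at `u`.
  have hFJc : 1 * FJ.card ≤ E G (B.erase u) {u} := by
    apply hFJ.sum_le
    intro C hC
    have hCs := hFJ.sub C hC
    have h2 := h.conn (hCs.trans (hBe.trans hB)) (hFJ.diff C hC).nonempty (by
      rintro rfl; simpa using hCs (hB hu))
    have huC : u ∉ C := fun k => by simpa using hCs k
    have e : S \ C = {u} ∪ ((B.erase u) \ C) ∪ (S \ B) := by
      ext x
      have h3 := @hCs x
      have h4 := @hB x
      simp only [Finset.mem_sdiff, Finset.mem_union, Finset.mem_erase, Finset.mem_singleton] at *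
      by_cases hx : x = u
      · subst hx; tauto
      · tauto
    have h5 := E_mono_left (G := G) (C := S \ B) hCs
    rw [e, E_union_right, E_union_right, hFJ.closed C hC] at h2
    · omega
    · simp
    · rw [Finset.disjoint_left]
      intro x hx
      simp only [Finset.mem_sdiff, Finset.mem_union, Finset.mem_erase, Finset.mem_singleton] at *
      rintro ⟨-, h7⟩
      rcases hx with rfl | hx <;> tauto
  have hJb : 8 * B.card ≤ 14 * J.card + E G B B + 8 := by
    rw [E_comm (A := B.erase u)] at hFJc
    omega
  obtain ⟨I, F, hI, hi, hF, hc⟩ := h.ih G B hlt (h.ok.mono hB)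
  -- A member `C` of the family other than `B` would split `B` into two parts with no edge between
  -- them, and the single edge leaving `B` cannot connect both to the rest.
  have hF1 : F.card = 0 ∨ (Diff G B ∧ F.card = 1) := by
    have : ∀ C ∈ F, C = B := by
      intro C hC
      by_contra hne
      have hs := hF.sub C hC
      have e1 := h.conn (hs.trans hB) (hF.diff C hC).nonempty (by
        rintro rfl; exact hne (Finset.Subset.antisymm hs hB))
      have e2 := h.conn (B := B \ C) (Finset.sdiff_subset.trans hB)
        (Finset.sdiff_nonempty.2 fun k => hne (Finset.Subset.antisymm hs k)) (by
          rintro e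
          obtain ⟨x, hx⟩ := (hF.diff C hC).nonempty
          have := hB (hs hx)
          rw [← e] at this
          exact (Finset.mem_sdiff.1 this).2 hx)
      have h0 := hF.closed C hC
      have s1 : S \ C = (B \ C) ∪ (S \ B) := by
        ext x
        have h3 := @hs x
        have h4 := @hB x
        simp only [Finset.mem_sdiff, Finset.mem_union] at *
        tauto
      have s2 : S \ (B \ C) = C ∪ (S \ B) := by
        ext x
        have h3 := @hs x
        have h4 := @hB x
        simp only [Finset.mem_sdiff, Finset.mem_union] at *
        tauto
      rw [s1, E_union_right, h0] at e1
      · rw [s2, E_union_right, E_comm, h0] at e2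
        · have := E_split_left (G := G) (B := S \ B) hs
          omega
        · exact Finset.disjoint_of_subset_left hs Finset.disjoint_sdiff
      · exact Finset.disjoint_of_subset_left Finset.sdiff_subset Finset.disjoint_sdiff
    rcases F.eq_empty_or_nonempty with rfl | ⟨C, hC⟩
    · simp
    · right
      have e := this C hC
      subst e
      exact ⟨hF.diff C hC, Finset.card_eq_one.2 ⟨C, Finset.eq_singleton_iff_unique_mem.2 ⟨hC, this⟩⟩⟩
  -- In the second case `|I| ≥ |J| + 1`, and the surplus is 14 minus the deficit 8 of `hJb`.
  by_cases hJI : I.card ≤ J.card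
  · refine ⟨J, hJ.trans hBe, hj, ?_⟩
    have huJ : u ∉ J := fun k => by simpa using hJ k
    rcases hF1 with h2 | ⟨hd, h2⟩
    · left; exact ⟨huJ, by omega⟩
    · right; left; exact ⟨huJ, hd, by omega⟩
  · refine ⟨I, hI, hi, ?_⟩
    right; right; omega

/-- Combine the two sides of a bridge. The bridge itself contributes 2 to `E G S S`, which pays for
one difficult side; if both sides are difficult, then so is `S`, and it is allowed one more term. -/
lemma bridge (h : MinCl G S) (hB : B ⊆ S) (hne : B.Nonempty) (hS : B ≠ S) :
    2 ≤ E G B (S \ B) := by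
  have hc := h.conn hB hne hS
  by_contra hlt
  have h1 : E G B (S \ B) = 1 := by omega
  obtain ⟨u, hu, v, hv, huv⟩ : ∃ u ∈ B, ∃ v ∈ S \ B, G.Adj u v := by
    by_contra hh
    push Not at hh
    have := E_eq_zero.2 hh
    omega
  have hu0 : E G (B.erase u) (S \ B) = 0 := by
    have e := E_split_left (G := G) (B := S \ B) (Finset.singleton_subset_iff.2 hu)
    have := E_pos (A := {u}) (by simp) hv huv
    rw [Finset.erase_eq]; omega
  have hv0 : E G ((S \ B).erase v) B = 0 := by
    rw [E_comm] at h1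
    have e := E_split_left (G := G) (B := B) (Finset.singleton_subset_iff.2 hv)
    have := E_pos (A := {v}) (by simp) hu huv.symm
    rw [Finset.erase_eq]; omega
  have hsd : S \ (S \ B) = B := Finset.sdiff_sdiff_eq_self hB
  have hS' : S \ B ≠ S := by
    intro e
    obtain ⟨x, hx⟩ := hne
    have := hB hx
    rw [← e] at this
    exact (Finset.mem_sdiff.1 this).2 hx
  obtain ⟨I, hI, hi, hIc⟩ := h.side hB hS hu h1 hu0
  obtain ⟨J, hJ, hj, hJc⟩ := h.side (B := S \ B) Finset.sdiff_subset hS' hv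
    (by rw [hsd, E_comm, h1]) (by rw [hsd, hv0])
  have c1 : (S \ B).card + B.card = S.card := Finset.card_sdiff_add_card_eq_card hB
  have hd : Disjoint I J := Finset.disjoint_of_subset_left hI
      (Finset.disjoint_of_subset_right hJ Finset.disjoint_sdiff)
  have hsub : I ∪ J ⊆ S := Finset.union_subset (hI.trans hB) (hJ.trans Finset.sdiff_subset)
  have hsp := E_self_split (G := G) hB
  have hIJ : u ∉ I ∨ v ∉ J → Indep G (I ∪ J) := by
    intro hor
    refine hi.union hj fun a ha b hb hab => ?_
    by_cases hau : a = u
    · by_cases hbv : b = v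
      · subst hau hbv; tauto
      · exact E_eq_zero.1 hv0 b (Finset.mem_erase.2 ⟨hbv, hJ hb⟩) a (hI ha) hab.symm
    · exact E_eq_zero.1 hu0 a (Finset.mem_erase.2 ⟨hau, hI ha⟩) b (hJ hb) hab
  by_cases hor : u ∉ I ∨ v ∉ J
  · have hcU := Finset.card_union_of_disjoint hd
    by_cases hz : 8 * S.card ≤ 14 * (I ∪ J).card + E G S S
    · exact h.not_zero ⟨_, hsub, hIJ hor, hz⟩
    · rcases hIc with ⟨a1, a2⟩ | ⟨a1, a3, a2⟩ | a2 <;>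
        rcases hJc with ⟨b1, b2⟩ | ⟨b1, b3, b2⟩ | b2 <;> try omega
      refine h.not_diff ⟨?_, _, hsub, hIJ hor, by omega⟩
      have := Diff.join B (S \ B) a3 b3 Finset.disjoint_sdiff h1
      rwa [Finset.union_sdiff_of_subset hB] at this
  -- Both ends of the bridge are chosen, so both sides have surplus 6. With the 2 from the bridge
  -- this is 14, the price of dropping `u`.
  · push Not at hor
    have hce := Finset.card_erase_add_one hor.1
    refine h.not_zero ⟨I.erase u ∪ J, Finset.union_subset
      (((Finset.erase_subset _ _).trans hI).trans hB) (hJ.trans Finset.sdiff_subset), ?_, ?_⟩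
    · refine (hi.mono (Finset.erase_subset _ _)).union hj fun a ha b hb hab => ?_
      rw [Finset.mem_erase] at ha
      exact E_eq_zero.1 hu0 a (Finset.mem_erase.2 ⟨ha.1, hI ha.2⟩) b (hJ hb) hab
    · rw [Finset.card_union_of_disjoint
        (Finset.disjoint_of_subset_left (Finset.erase_subset _ _) hd)]
      rcases hIc with ⟨a1, a2⟩ | ⟨a1, a3, a2⟩ | a2
      · tauto
      · tauto
      rcases hJc with ⟨b1, b2⟩ | ⟨b1, b3, b2⟩ | b2
      · tauto
      · tauto
      omega

end MinCl
end ThreeTight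

/-! ### Edges leaving difficult sets -/

namespace ThreeTight
open scoped Classical

variable {V : Type*} {G : SimpleGraph V} {A B C S T X I J R : Finset V} {u v w x y : V}

lemma img_subset {n : ℕ} {f : Fin n → V} : img f ⊆ S ↔ ∀ i, f i ∈ S := by
  simp [Finset.subset_iff]

lemma E_join (hB : B ⊆ S) (hC : C ⊆ S) (hd : Disjoint B C) :
    E G B (S \ B) + E G C (S \ C) = E G (B ∪ C) (S \ (B ∪ C)) + 2 * E G B C := by
  have s1 : S \ B = C ∪ S \ (B ∪ C) := by
    ext x
    have h1 := @hC x
    have h2 : x ∈ C → x ∉ B := fun k => Finset.disjoint_right.1 hd k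
    simp only [Finset.mem_sdiff, Finset.mem_union] at *
    tauto
  have s2 : S \ C = B ∪ S \ (B ∪ C) := by
    ext x
    have h1 := @hB x
    have h2 : x ∈ C → x ∉ B := fun k => Finset.disjoint_right.1 hd k
    simp only [Finset.mem_sdiff, Finset.mem_union] at *
    tauto
  have d1 : Disjoint C (S \ (B ∪ C)) :=
    Finset.disjoint_of_subset_left Finset.subset_union_right Finset.disjoint_sdiff
  have d2 : Disjoint B (S \ (B ∪ C)) :=
    Finset.disjoint_of_subset_left Finset.subset_union_left Finset.disjoint_sdiff
  rw [s1, s2, E_union_right d1, E_union_right d2, E_union_left hd, E_comm (A := C) (B := B)]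
  ring

lemma E_img_out {n : ℕ} {f : Fin n → V} (hf : Function.Injective f) :
    E G (img f) T = ∑ i, (nb G T (f i)).card := by
  rw [E, img, Finset.sum_image (fun a _ b _ h => hf h)]

lemma out_le {n : ℕ} (P : SimpleGraph (Fin n)) [DecidableRel P.Adj] (f : P ↪g G)
    (hf : img f ⊆ S) (i : Fin n) :
    (nb G (S \ img f) (f i)).card + pdeg P i = (nb G S (f i)).card := by
  rw [← card_nb_img P f, ← nb_union_card Finset.sdiff_disjoint,
    Finset.sdiff_union_of_subset hf]

namespace MinCl

/-- Deletion of a copy of `P`. Without bridges, each new difficult component uses at least two of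
the edges leaving the copy; hence the halved term. -/
lemma pattern_deletion (h : MinCl G S) {n : ℕ} (P : SimpleGraph (Fin n)) [DecidableRel P.Adj]
    (f : P ↪g G) (hf : img f ⊆ S) (hn : 0 < n) (J : Finset (Fin n))
    (hJ : ∀ i ∈ J, ∀ j ∈ J, ¬ P.Adj i j) (hJ' : ∀ i ∈ J, (nb G (S \ img f) (f i)).card = 0) :
    14 * J.card + ∑ i, pdeg P i + 2 * E G (img f) (S \ img f) <
      8 * n + 2 * (E G (img f) (S \ img f) / 2) := by
  obtain ⟨F, hF, hE, hc, hcc⟩ := h.deletion (X := img f) (I := J.image f) hf ⟨f ⟨0, hn⟩, by simp⟩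
    (by
      intro x hx
      obtain ⟨i, -, rfl⟩ := Finset.mem_image.1 hx
      simp)
    (by
      intro a ha b hb
      obtain ⟨i, hi, rfl⟩ := Finset.mem_image.1 ha
      obtain ⟨j, hj, rfl⟩ := Finset.mem_image.1 hb
      rw [f.map_adj_iff]; exact hJ i hi j hj)
    (by
      intro a ha y hy
      obtain ⟨i, hi, rfl⟩ := Finset.mem_image.1 ha
      by_contra hy'
      have h1 := Finset.card_eq_zero.1 (hJ' i hi)
      have : y ∈ nb G (S \ img f) (f i) := by
        simp only [mem_nb, Finset.mem_sdiff] at *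
        tauto
      rw [h1] at this
      simp at this)
  have h2 := hcc 2 (fun B hB => by
    refine h.bridge ((hF.sub B hB).trans Finset.sdiff_subset) (hF.diff B hB).nonempty ?_
    rintro rfl
    have := hF.sub _ hB (img_subset.1 hf ⟨0, hn⟩)
    simp at this)
  rw [Finset.card_image_of_injective _ f.injective, img_card f.injective, E_img] at hc
  omega

/-- Only the four subdividing vertices can have outside neighbours. If at most three edges leave,
one of these vertices has none, and with two vertices of degree three it forms an independent triple
that can be deleted with the copy. -/
lemma k4s_bd (h : MinCl G S) (f : k4s ↪g G) (hf : img f ⊆ S) : 4 ≤ E G (img f) (S \ img f) := by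
  have hd : ∑ i, pdeg k4s i = 20 := by decide
  by_cases hS : img f = S
  · exfalso
    refine h.not_diff ⟨hS ▸ Diff.k4s f, ({0, 1, 6} : Finset (Fin 8)).image f, ?_, ?_, ?_⟩
    · rw [← hS]; exact Finset.image_subset_image (Finset.subset_univ _)
    · intro a ha b hb
      obtain ⟨i, hi, rfl⟩ := Finset.mem_image.1 ha
      obtain ⟨j, hj, rfl⟩ := Finset.mem_image.1 hb
      rw [f.map_adj_iff]
      clear ha hb; revert i j; decide
    · rw [Finset.card_image_of_injective _ f.injective, ← hS, img_card f.injective, E_img, hd]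
      decide
  have h2 := h.bridge hf ⟨f 0, by simp⟩ hS
  by_contra hlt
  have hle : ∀ i, (nb G (S \ img f) (f i)).card ≤ 3 - pdeg k4s i := fun i => by
    have := out_le k4s f hf i
    have := h.ok.deg _ (img_subset.1 hf i)
    omega
  have e0 := hle 0
  have e1 := hle 1
  have e2 := hle 2
  have e3 := hle 3
  rw [show pdeg k4s 0 = 3 by decide] at e0
  rw [show pdeg k4s 1 = 3 by decide] at e1
  rw [show pdeg k4s 2 = 3 by decide] at e2
  rw [show pdeg k4s 3 = 3 by decide] at e3
  have hs := E_img_out (G := G) (T := S \ img f) f.injective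
  simp only [Fin.sum_univ_eight] at hs
  have key : ∀ J : Finset (Fin 8), J.card = 3 → (∀ i ∈ J, ∀ j ∈ J, ¬ k4s.Adj i j) →
      ¬ ∀ i ∈ J, (nb G (S \ img f) (f i)).card = 0 := by
    intro J hJ hJi hJ0
    have := h.pattern_deletion k4s f hf (by norm_num) J hJi hJ0
    omega
  have k1 := key {4, 2, 3} (by decide) (by decide)
  have k2 := key {5, 2, 3} (by decide) (by decide)
  have k3 := key {6, 0, 1} (by decide) (by decide)
  have k4 := key {7, 0, 1} (by decide) (by decide)
  simp only [Finset.mem_insert, Finset.mem_singleton, forall_eq_or_imp, forall_eq] at k1 k2 k3 k4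
  omega

/-- The five vertices of `g` span a 5-cycle, with exactly one edge leaving each of the first three
vertices and none leaving the last two. -/
def Consec (G : SimpleGraph V) (S B : Finset V) : Prop :=
  ∃ g : c5 ↪g G, img g = B ∧ (nb G (S \ B) (g 0)).card = 1 ∧ (nb G (S \ B) (g 1)).card = 1 ∧
    (nb G (S \ B) (g 2)).card = 1 ∧ (nb G (S \ B) (g 3)).card = 0 ∧ (nb G (S \ B) (g 4)).card = 0

/-- The rotations of the 5-cycle. -/
def rot (k : Fin 5) : c5 ↪g c5 where
  toFun i := i + k
  inj' := add_left_injective k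
  map_rel_iff' := by revert k; decide

lemma img_rot (f : c5 ↪g G) (k : Fin 5) : img (f.comp (rot k)) = img f := by
  ext x
  simp only [mem_img]
  constructor
  · rintro ⟨i, rfl⟩; exact ⟨_, rfl⟩
  · rintro ⟨i, rfl⟩
    exact ⟨i - k, by simp [rot]⟩

/-- If at most three edges leave, two non-adjacent vertices of the cycle cannot both lack outside
neighbours, since they could be chosen and the cycle deleted. So the vertices without outside
neighbours are at most two, and adjacent. -/
lemma c5_bd (h : MinCl G S) (f : c5 ↪g G) (hf : img f ⊆ S) : 3 ≤ E G (img f) (S \ img f) ∧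
    (E G (img f) (S \ img f) = 3 → Consec G S (img f)) := by
  have hd : ∑ i, pdeg c5 i = 10 := by decide
  have h2 : 2 ≤ E G (img f) (S \ img f) := by
    by_cases hS : img f = S
    · exfalso
      refine h.not_diff ⟨hS ▸ Diff.c5 f, ({0, 2} : Finset (Fin 5)).image f, ?_, ?_, ?_⟩
      · rw [← hS]; exact Finset.image_subset_image (Finset.subset_univ _)
      · intro a ha b hb
        obtain ⟨i, hi, rfl⟩ := Finset.mem_image.1 ha
        obtain ⟨j, hj, rfl⟩ := Finset.mem_image.1 hb
        rw [f.map_adj_iff]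
        clear ha hb; revert i j; decide
      · rw [Finset.card_image_of_injective _ f.injective, ← hS, img_card f.injective, E_img, hd]
        decide
    exact h.bridge hf ⟨f 0, by simp⟩ hS
  have hle : ∀ i, (nb G (S \ img f) (f i)).card ≤ 1 := fun i => by
    have h3 := out_le c5 f hf i
    have h4 := h.ok.deg _ (img_subset.1 hf i)
    rw [show pdeg c5 i = 2 by clear h3 h4; revert i; decide] at h3
    omega
  have hs := E_img_out (G := G) (T := S \ img f) f.injective
  simp only [Fin.sum_univ_five] at hs
  have key : ∀ i j : Fin 5, i ≠ j → ¬ c5.Adj i j → E G (img f) (S \ img f) ≤ 3 →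
      ¬ ((nb G (S \ img f) (f i)).card = 0 ∧ (nb G (S \ img f) (f j)).card = 0) := by
    intro i j hij hJi hE hJ0
    have := h.pattern_deletion c5 f hf (by norm_num) {i, j} (by
      intro a ha b hb
      simp only [Finset.mem_insert, Finset.mem_singleton] at ha hb
      rcases ha with rfl | rfl <;> rcases hb with rfl | rfl <;> simp_all [SimpleGraph.adj_comm])
      (by simpa using hJ0)
    rw [Finset.card_pair hij] at this
    omega
  have k1 := key 0 2 (by decide) (by decide)
  have k2 := key 1 3 (by decide) (by decide)
  have k3 := key 2 4 (by decide) (by decide)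
  have k4 := key 3 0 (by decide) (by decide)
  have k5 := key 4 1 (by decide) (by decide)
  have l0 := hle 0
  have l1 := hle 1
  have l2 := hle 2
  have l3 := hle 3
  have l4 := hle 4
  refine ⟨by omega, fun hE => ?_⟩
  have con : ∀ k : Fin 5, (nb G (S \ img f) (f (0 + k))).card = 1 →
      (nb G (S \ img f) (f (1 + k))).card = 1 → (nb G (S \ img f) (f (2 + k))).card = 1 →
      (nb G (S \ img f) (f (3 + k))).card = 0 → (nb G (S \ img f) (f (4 + k))).card = 0 →
      Consec G S (img f) := fun k a b c d e => ⟨f.comp (rot k), img_rot f k, a, b, c, d, e⟩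
  by_cases z0 : (nb G (S \ img f) (f 0)).card = 0
  · by_cases z1 : (nb G (S \ img f) (f 1)).card = 0
    · exact con 2 (by change (nb G _ (f 2)).card = 1; omega)
        (by change (nb G _ (f 3)).card = 1; omega) (by change (nb G _ (f 4)).card = 1; omega)
        (by change (nb G _ (f 0)).card = 0; omega) (by change (nb G _ (f 1)).card = 0; omega)
    · exact con 1 (by change (nb G _ (f 1)).card = 1; omega)
        (by change (nb G _ (f 2)).card = 1; omega) (by change (nb G _ (f 3)).card = 1; omega)
        (by change (nb G _ (f 4)).card = 0; omega) (by change (nb G _ (f 0)).card = 0; omega)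
  · by_cases z1 : (nb G (S \ img f) (f 1)).card = 0
    · exact con 3 (by change (nb G _ (f 3)).card = 1; omega)
        (by change (nb G _ (f 4)).card = 1; omega) (by change (nb G _ (f 0)).card = 1; omega)
        (by change (nb G _ (f 1)).card = 0; omega) (by change (nb G _ (f 2)).card = 0; omega)
    · by_cases z2 : (nb G (S \ img f) (f 2)).card = 0
      · exact con 4 (by change (nb G _ (f 4)).card = 1; omega)
          (by change (nb G _ (f 0)).card = 1; omega) (by change (nb G _ (f 1)).card = 1; omega)
          (by change (nb G _ (f 2)).card = 0; omega) (by change (nb G _ (f 3)).card = 0; omega)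
      · exact con 0 (by change (nb G _ (f 0)).card = 1; omega)
          (by change (nb G _ (f 1)).card = 1; omega) (by change (nb G _ (f 2)).card = 1; omega)
          (by change (nb G _ (f 3)).card = 0; omega) (by change (nb G _ (f 4)).card = 0; omega)

/-- Joining two sets by one edge removes 2 from the sum of the two boundaries, and 3 + 3 - 2 = 4, so
equality is possible only for a 5-cycle. -/
lemma diff_bd (h : MinCl G S) (hB : Diff G B) : B ⊆ S →
    3 ≤ E G B (S \ B) ∧ (E G B (S \ B) = 3 → Consec G S B) := by
  induction hB with
  | c5 f => exact h.c5_bd f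
  | k4s f => intro hf; have := h.k4s_bd f hf; exact ⟨by omega, by omega⟩
  | join B C hB hC hd hE h1 h2 =>
    intro hs
    have b1 := (h1 (Finset.union_subset_left hs)).1
    have b2 := (h2 (Finset.union_subset_right hs)).1
    have := E_join (G := G) (Finset.union_subset_left hs) (Finset.union_subset_right hs) hd
    exact ⟨by omega, by omega⟩

lemma path3 (h : MinCl G S) (hv : v ∈ S) (hnv : nb G S v = {u, w}) (huw : u ≠ w) :
    ({v, u, w} : Finset V) ⊆ S ∧ ({v, u, w} : Finset V).card = 3 ∧
    E G {v, u, w} {v, u, w} = 4 ∧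
    E G {v, u, w} (S \ {v, u, w}) + 2 = (nb G S u).card + (nb G S w).card := by
  have hu' : u ∈ S ∧ G.Adj v u := mem_nb.1 (hnv ▸ by simp)
  have hw' : w ∈ S ∧ G.Adj v w := mem_nb.1 (hnv ▸ by simp)
  have huw' : ¬ G.Adj u w := h.ok.tf u hu'.1 v hv w hw'.1 hu'.2.symm hw'.2
  have hX : ({v, u, w} : Finset V) ⊆ S := by
    intro x; simp only [Finset.mem_insert, Finset.mem_singleton]; rintro (rfl | rfl | rfl)
    exacts [hv, hu'.1, hw'.1]
  set X : Finset V := {v, u, w} with hXdef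
  have hvX : nb G X v = {u, w} := by
    ext x; simp only [mem_nb, hXdef, Finset.mem_insert, Finset.mem_singleton]
    constructor
    · rintro ⟨rfl | rfl | rfl, h⟩ <;> simp_all
    · rintro (rfl | rfl) <;> simp_all
  have huX : nb G X u = {v} := by
    ext x; simp only [mem_nb, hXdef, Finset.mem_insert, Finset.mem_singleton]
    constructor
    · rintro ⟨rfl | rfl | rfl, h⟩ <;> simp_all
    · rintro rfl; simp [hu'.2.symm]
  have hwX : nb G X w = {v} := by
    ext x; simp only [mem_nb, hXdef, Finset.mem_insert, Finset.mem_singleton]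
    constructor
    · rintro ⟨rfl | rfl | rfl, h⟩ <;> simp_all [SimpleGraph.adj_comm]
    · rintro rfl; simp [hw'.2.symm]
  have hvu := hu'.2.ne
  have hvw := hw'.2.ne
  have cX : X.card = 3 := by
    rw [hXdef, Finset.card_insert_of_notMem (by simp [hvu, hvw]), Finset.card_pair huw]
  have hE : ∀ T, E G X T = (nb G T v).card + ((nb G T u).card + (nb G T w).card) := by
    intro T
    rw [hXdef, E_insert_left (by simp [hvu, hvw]), E_insert_left (by simp [huw]), E_singleton_left]
  have hXX : E G X X = 4 := by
    rw [hE, hvX, huX, hwX, Finset.card_pair huw]; simp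
  have hXS : E G X S = 2 + ((nb G S u).card + (nb G S w).card) := by
    rw [hE, hnv, Finset.card_pair huw]
  have hXo := E_split (G := G) (B := X) hX
  exact ⟨hX, cX, hXX, by omega⟩

/-- Deleting `u, v, w` just breaks even, so it must create a difficult component `B`. Only three
edges are available, hence all of them go to `B`, `S` is `B` with the path, and `B` is a 5-cycle
with three consecutive attachments. Triangle-freeness then determines the graph. -/
lemma no_deg_two_three (h : MinCl G S) (hv : v ∈ S) (hnv : nb G S v = {u, w}) (huw : u ≠ w)
    (hu : (nb G S u).card = 2) (hw : (nb G S w).card = 3) : False := by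
  have hu' : u ∈ S ∧ G.Adj v u := mem_nb.1 (hnv ▸ by simp)
  have hw' : w ∈ S ∧ G.Adj v w := mem_nb.1 (hnv ▸ by simp)
  have hvu := hu'.2.ne
  have hvw := hw'.2.ne
  obtain ⟨hX, cX, hXX, hXo⟩ := h.path3 hv hnv huw
  set X : Finset V := {v, u, w} with hXdef
  obtain ⟨F, hF, hFE, hc, hcc⟩ := h.deletion (X := X) (I := {v}) hX ⟨v, by simp [hXdef]⟩
    (by simp [hXdef]) (by intro a ha b hb; simp_all) (by
      intro a ha; simp only [Finset.mem_singleton] at ha; subst ha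
      rw [hnv]; simp [hXdef])
  rw [hXX, cX, Finset.card_singleton] at hc
  have hF0 : 0 < F.card := by omega
  obtain ⟨B, hB⟩ := Finset.card_pos.1 hF0
  have hBS := (hF.sub B hB).trans Finset.sdiff_subset
  obtain ⟨b1, b2⟩ := h.diff_bd (hF.diff B hB) hBS
  have hBX := hFE B hB
  have hBX' : E G B X ≤ E G (S \ X) X := E_mono_left (hF.sub B hB)
  rw [E_comm (A := S \ X)] at hBX'
  have hdisj : Disjoint B X := Finset.disjoint_of_subset_left (hF.sub B hB) Finset.sdiff_disjoint
  have hSB : S = B ∪ X := by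
    by_contra hne
    have k1 := h.conn (B := B ∪ X) (Finset.union_subset hBS hX)
      ((hF.diff B hB).nonempty.mono Finset.subset_union_left) (Ne.symm hne)
    have k2 := E_join (G := G) hBS hX hdisj
    omega
  have hSX : S \ B = X := by
    rw [hSB, Finset.union_sdiff_cancel_left hdisj]
  obtain ⟨g, hg, g0, g1, g2, g3, g4⟩ := b2 (by omega)
  rw [hSX] at g0 g1 g2 g3 g4
  have hgB : ∀ i, g i ∈ B := fun i => hg ▸ by simp
  have hgX : ∀ i, g i ∉ X := fun i k => Finset.disjoint_left.1 hdisj (hgB i) k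
  have hgS : ∀ i, g i ∈ S := fun i => hBS (hgB i)
  have gX : ∀ i x, x ∈ X → G.Adj (g i) x → x = u ∨ x = w := by
    intro i x hx hax
    simp only [hXdef, Finset.mem_insert, Finset.mem_singleton] at hx
    rcases hx with rfl | hx
    · have : g i ∈ nb G S x := mem_nb.2 ⟨hgS i, hax.symm⟩
      rw [hnv] at this
      refine absurd ?_ (hgX i)
      simp only [hXdef, Finset.mem_insert, Finset.mem_singleton] at *
      tauto
    · exact hx
  have ex : ∀ i, (nb G X (g i)).card = 1 → G.Adj (g i) u ∨ G.Adj (g i) w := by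
    intro i hi
    obtain ⟨x, hx⟩ := Finset.card_eq_one.1 hi
    have hx' : x ∈ X ∧ G.Adj (g i) x := mem_nb.1 (hx ▸ by simp)
    rcases gX i x hx'.1 hx'.2 with rfl | rfl
    · exact Or.inl hx'.2
    · exact Or.inr hx'.2
  have huB : ∀ i j, G.Adj (g i) u → G.Adj (g j) u → i = j := by
    intro i j hi hj
    by_contra hij
    have hs : ({v, g i, g j} : Finset V) ⊆ nb G S u := by
      intro x; simp only [Finset.mem_insert, Finset.mem_singleton]
      rintro (rfl | rfl | rfl)
      exacts [mem_nb.2 ⟨hv, hu'.2.symm⟩, mem_nb.2 ⟨hgS _, hi.symm⟩, mem_nb.2 ⟨hgS _, hj.symm⟩]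
    have := Finset.card_le_card hs
    have n1 : ∀ k, v ≠ g k := fun k e => hgX k (by rw [← e]; simp [hXdef])
    rw [Finset.card_insert_of_notMem (by simp [n1]), Finset.card_pair (fun e => hij (g.injective e))]
      at this
    omega
  have a01 : G.Adj (g 0) (g 1) := g.map_adj_iff.2 (by decide)
  have a12 : G.Adj (g 1) (g 2) := g.map_adj_iff.2 (by decide)
  have a23 : G.Adj (g 2) (g 3) := g.map_adj_iff.2 (by decide)
  have a34 : G.Adj (g 3) (g 4) := g.map_adj_iff.2 (by decide)
  have a40 : G.Adj (g 4) (g 0) := g.map_adj_iff.2 (by decide)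
  have t01 : ¬ (G.Adj (g 0) w ∧ G.Adj (g 1) w) := fun k =>
    h.ok.tf _ (hgS 0) _ (hgS 1) _ hw'.1 a01 k.2 k.1
  have t12 : ¬ (G.Adj (g 1) w ∧ G.Adj (g 2) w) := fun k =>
    h.ok.tf _ (hgS 1) _ (hgS 2) _ hw'.1 a12 k.2 k.1
  have q01 : ¬ (G.Adj (g 0) u ∧ G.Adj (g 1) u) := fun k => by have := huB _ _ k.1 k.2; simp at this
  have q02 : ¬ (G.Adj (g 0) u ∧ G.Adj (g 2) u) := fun k => by have := huB _ _ k.1 k.2; simp at this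
  have q12 : ¬ (G.Adj (g 1) u ∧ G.Adj (g 2) u) := fun k => by have := huB _ _ k.1 k.2; simp at this
  have x0 := ex 0 g0
  have x1 := ex 1 g1
  have x2 := ex 2 g2
  -- `u` takes one of the three attachments and `w` the other two. As `w` lies in no triangle, its
  -- two are the non-consecutive ones.
  have y1 : G.Adj (g 1) u := by
    refine x1.resolve_right fun k => q02 ⟨?_, ?_⟩
    · exact x0.resolve_right fun k' => t01 ⟨k', k⟩
    · exact x2.resolve_right fun k' => t12 ⟨k, k'⟩
  have y0 : G.Adj (g 0) w := x0.resolve_left fun k => q01 ⟨k, y1⟩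
  have y2 : G.Adj (g 2) w := x2.resolve_left fun k => q12 ⟨y1, k⟩
  have hdeg : ∀ i, (nb G X (g i)).card = 0 → (nb G S (g i)).card ≤ 2 := by
    intro i hi
    have h1 := out_le c5 g (hg ▸ hBS) i
    rw [hg, hSX, hi, show pdeg c5 i = 2 by clear hi h1; revert i; decide] at h1
    omega
  -- All eight vertices form a copy of `k4s` with no edge leaving it, against `k4s_bd`.
  let f : Fin 8 → V := ![g 0, g 2, w, g 1, g 4, g 3, v, u]
  have hfi : Function.Injective f := by
    have e : ∀ i, g i ≠ v ∧ g i ≠ u ∧ g i ≠ w := fun i =>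
      ⟨fun e => hgX i (by rw [e]; simp [hXdef]), fun e => hgX i (by rw [e]; simp [hXdef]),
        fun e => hgX i (by rw [e]; simp [hXdef])⟩
    rw [← List.nodup_ofFn]
    have e' : ∀ i j, g i = g j ↔ i = j := fun i j => g.injective.eq_iff
    simp [f, e', e, fun i => (e i).2.2.symm, hvu, hvw.symm, huw.symm]
  obtain ⟨f', hf'⟩ := emb_of_hom (G := G) (S := S) k4s f hfi
    (by
      intro i; fin_cases i
      exacts [hgS 0, hgS 2, hw'.1, hgS 1, hgS 4, hgS 3, hv, hu'.1])
    (hom_of_edges (by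
      simp only [List.mem_cons, List.not_mem_nil, or_false, forall_eq_or_imp, forall_eq]
      exact ⟨y0, a01, y2.symm.symm, a12.symm, a40.symm, a34.symm, a23.symm, hw'.2.symm, hu'.2,
        y1.symm⟩))
    (by
      intro i j _ _
      left
      fin_cases i
      · exact h.ok.deg _ (hgS 0)
      · exact h.ok.deg _ (hgS 2)
      · exact h.ok.deg _ hw'.1
      · exact h.ok.deg _ (hgS 1)
      · exact hdeg 4 g4
      · exact hdeg 3 g3
      · exact (congrArg Finset.card hnv).le.trans Finset.card_le_two
      · exact hu.le)
  have hfS : img f' ⊆ S := by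
    rw [img_subset]
    intro i; rw [hf']
    fin_cases i
    exacts [hgS 0, hgS 2, hw'.1, hgS 1, hgS 4, hgS 3, hv, hu'.1]
  have hb := h.k4s_bd f' hfS
  have hcard : S.card = 8 := by
    rw [hSB, Finset.card_union_of_disjoint hdisj, cX, ← hg, img_card g.injective]
  have heq : img f' = S := Finset.eq_of_subset_of_card_le hfS (by rw [hcard, img_card f'.injective])
  rw [heq] at hb
  simp at hb

end MinCl
end ThreeTight

/-! ### Excluding vertices of degree two -/

namespace ThreeTight
open scoped Classical

variable {V : Type*} {G : SimpleGraph V} {A B C S T X I J R Q : Finset V} {u v w x y p : V}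

/-- `G` with all edges from `p` to `Q` added. -/
def addStar (G : SimpleGraph V) (p : V) (Q : Finset V) : SimpleGraph V :=
  G ⊔ SimpleGraph.fromRel fun a b => a = p ∧ b ∈ Q

lemma addStar_adj : (addStar G p Q).Adj u v ↔
    G.Adj u v ∨ u ≠ v ∧ (u = p ∧ v ∈ Q ∨ v = p ∧ u ∈ Q) := by
  simp [addStar]

lemma le_addStar (h : G.Adj u v) : (addStar G p Q).Adj u v := addStar_adj.2 (Or.inl h)

lemma addStar_adj_off (hu : u ≠ p) (hv : v ≠ p) : (addStar G p Q).Adj u v ↔ G.Adj u v := by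
  simp [addStar_adj, hu, hv]

lemma nb_addStar_other (hu : u ≠ p) : nb (addStar G p Q) S u ⊆ insert p (nb G S u) := by
  intro x hx
  rw [mem_nb, addStar_adj] at hx
  simp only [Finset.mem_insert, mem_nb]
  tauto

lemma nb_addStar_notMem (hu : u ≠ p) (hu' : u ∉ Q) : nb (addStar G p Q) S u = nb G S u := by
  ext x
  simp only [mem_nb, addStar_adj]
  tauto

lemma nb_addStar_self : nb (addStar G p Q) S p ⊆ nb G S p ∪ (Q ∩ S) := by
  intro x hx
  rw [mem_nb, addStar_adj] at hx
  simp only [Finset.mem_union, mem_nb, Finset.mem_inter]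
  rcases hx with ⟨h1, h2 | ⟨h2, h3 | h3⟩⟩
  · exact Or.inl ⟨h1, h2⟩
  · exact Or.inr ⟨h3.2, h1⟩
  · exact absurd h3.1.symm h2

lemma addStar_triangle {a b c : V} (hab : (addStar G p Q).Adj a b)
    (hbc : (addStar G p Q).Adj b c) (hac : (addStar G p Q).Adj a c) :
    (G.Adj a b ∧ G.Adj b c ∧ G.Adj a c) ∨ (a = p ∧ G.Adj b c) ∨ (b = p ∧ G.Adj a c) ∨
      (c = p ∧ G.Adj a b) := by
  by_cases ha : a = p
  · subst ha
    exact Or.inr (Or.inl ⟨rfl, (addStar_adj_off hab.ne.symm hac.ne.symm).1 hbc⟩)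
  by_cases hb : b = p
  · subst hb
    exact Or.inr (Or.inr (Or.inl ⟨rfl, (addStar_adj_off ha hbc.ne.symm).1 hac⟩))
  by_cases hc : c = p
  · subst hc
    exact Or.inr (Or.inr (Or.inr ⟨rfl, (addStar_adj_off ha hb).1 hab⟩))
  exact Or.inl ⟨(addStar_adj_off ha hb).1 hab, (addStar_adj_off hb hc).1 hbc,
    (addStar_adj_off ha hc).1 hac⟩

lemma exists_pair (h : (nb G S u).card = 2) (hv : v ∈ nb G S u) :
    ∃ x, x ≠ v ∧ nb G S u = {v, x} := by
  have := Finset.card_erase_of_mem hv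
  rw [h] at this
  obtain ⟨x, hx⟩ := Finset.card_eq_one.1 this
  refine ⟨x, ?_, ?_⟩
  · have : x ∈ (nb G S u).erase v := hx ▸ by simp
    exact (Finset.mem_erase.1 this).1
  · rw [← Finset.insert_erase hv, hx]

namespace MinCl

/-- In the extremal 5-cycle, the vertex `g 4` has degree two, with neighbours `g 3` of degree two
and `g 0` of degree three. -/
lemma diff_bd4 (h : MinCl G S) (hB : Diff G B) (hs : B ⊆ S) : 4 ≤ E G B (S \ B) := by
  obtain ⟨h1, h2⟩ := h.diff_bd hB hs
  by_contra hlt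
  obtain ⟨g, rfl, g0, g1, g2, g3, g4⟩ := h2 (by omega)
  have o0 := out_le c5 g hs 0
  have o3 := out_le c5 g hs 3
  have o4 := out_le c5 g hs 4
  rw [show pdeg c5 0 = 2 by decide] at o0
  rw [show pdeg c5 3 = 2 by decide] at o3
  rw [show pdeg c5 4 = 2 by decide] at o4
  have hgS := img_subset.1 hs
  have ne : g 3 ≠ g 0 := fun e => by simpa using g.injective e
  refine h.no_deg_two_three (hgS 4) (u := g 3) (w := g 0) (eq_of_card_nb_le (k := 2) (by omega) ?_
    (by rw [Finset.card_pair ne])) ne (by omega) (by omega)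
  intro x
  simp only [Finset.mem_insert, Finset.mem_singleton, mem_nb]
  rintro (rfl | rfl)
  · exact ⟨hgS 3, g.map_adj_iff.2 (by decide)⟩
  · exact ⟨hgS 0, g.map_adj_iff.2 (by decide)⟩

lemma two_le_deg (h : MinCl G S) (hv : v ∈ S) : 2 ≤ (nb G S v).card := by
  by_cases hS : {v} = S
  · refine absurd ?_ h.not_zero
    refine ⟨{v}, by simpa, ?_, by rw [← hS]; simp only [Finset.card_singleton]; omega⟩
    intro a ha b hb
    rw [Finset.mem_singleton] at ha hb
    subst ha hb
    exact G.irrefl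
  · have := h.bridge (B := {v}) (by simpa) (by simp) hS
    rw [E_singleton_left] at this
    exact this.trans (nb_card_mono Finset.sdiff_subset)

/-- Deleting the path `u, v, w` would have to create two difficult components, needing six edges
where only four leave the path. -/
lemma no_deg_three_three (h : MinCl G S) (hv : v ∈ S) (hnv : nb G S v = {u, w}) (huw : u ≠ w)
    (hu : (nb G S u).card = 3) (hw : (nb G S w).card = 3) : False := by
  obtain ⟨hX, cX, hXX, hXo⟩ := h.path3 hv hnv huw
  obtain ⟨F, hF, hFE, hc, hcc⟩ := h.deletion (I := {v}) hX ⟨v, by simp⟩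
    (by simp) (by intro a ha b hb; simp_all) (by
      intro a ha; simp only [Finset.mem_singleton] at ha; subst ha
      rw [hnv]; simp)
  rw [hXX, cX, Finset.card_singleton] at hc
  have := hcc 3 fun B hB => (h.diff_bd (hF.diff B hB) ((hF.sub B hB).trans Finset.sdiff_subset)).1
  omega

/-- Contraction of a path through two adjacent vertices of degree two. -/
lemma contract (h : MinCl G S) (hv : v ∈ S) (hu : u ∈ S) (hx : x ∈ S) (hw : w ∈ S)
    (hnv : nb G S v = {u, w}) (hnu : nb G S u = {v, x}) (huv : u ≠ v) (hxw : x ≠ w)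
    (huw : u ≠ w) (hvx : v ≠ x)
    (hadj : ¬ G.Adj x w) (hcom : ∀ t ∈ S, t ≠ v → t ≠ u → G.Adj x t → ¬ G.Adj w t) : False := by
  have huv' : G.Adj u v := (mem_nb.1 (hnu ▸ by simp : v ∈ nb G S u)).2
  have hux' : G.Adj u x := (mem_nb.1 (hnu ▸ by simp : x ∈ nb G S u)).2
  have hvw' : G.Adj v w := (mem_nb.1 (hnv ▸ by simp : w ∈ nb G S v)).2
  have hX : ({u, v} : Finset V) ⊆ S := by
    intro z; simp only [Finset.mem_insert, Finset.mem_singleton]; rintro (rfl | rfl) <;> assumption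
  have hxS : x ∈ S \ {u, v} := by simp [hx, hux'.ne.symm, hvx.symm]
  have hwS : w ∈ S \ {u, v} := by simp [hw, hvw'.ne.symm, huw.symm]
  have c1 : (S \ {u, v}).card + ({u, v} : Finset V).card = S.card :=
    Finset.card_sdiff_add_card_eq_card hX
  rw [Finset.card_pair huv] at c1
  have hsub : S \ {u, v} ⊆ S := Finset.sdiff_subset
  have hnx : (nb G (S \ {u, v}) x).card + 1 ≤ 3 := by
    refine le_trans ?_ (h.ok.deg x hx)
    rw [← Finset.card_insert_of_notMem (a := u) (by simp)]
    refine Finset.card_le_card (Finset.insert_subset (mem_nb.2 ⟨hu, hux'.symm⟩) (nb_mono hsub))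
  have hnw : (nb G (S \ {u, v}) w).card + 1 ≤ 3 := by
    refine le_trans ?_ (h.ok.deg w hw)
    rw [← Finset.card_insert_of_notMem (a := v) (by simp)]
    refine Finset.card_le_card (Finset.insert_subset (mem_nb.2 ⟨hv, hvw'.symm⟩) (nb_mono hsub))
  have bx : (nb (addStar G x {w}) (S \ {u, v}) x).card ≤ (nb G (S \ {u, v}) x).card + 1 := by
    refine (Finset.card_le_card nb_addStar_self).trans ((Finset.card_union_le _ _).trans ?_)
    have := Finset.card_le_card (Finset.inter_subset_left (s₁ := {w}) (s₂ := S \ {u, v}))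
    simp only [Finset.card_singleton] at this
    omega
  have bo : ∀ a, a ≠ x →
      (nb (addStar G x {w}) (S \ {u, v}) a).card ≤ (nb G (S \ {u, v}) a).card +
        if a = w then 1 else 0 := by
    intro a hax
    split_ifs with haw
    · exact (Finset.card_le_card (nb_addStar_other hax)).trans (Finset.card_insert_le _ _)
    · rw [nb_addStar_notMem hax (by simpa using haw), add_zero]
  have hok : Subcubic (addStar G x {w}) (S \ {u, v}) := by
    refine ⟨fun a ha => ?_, ?_⟩
    · by_cases hax : a = x
      · subst hax; omega
      · have h1 := bo a hax
        have h2 := nb_card_mono (G := G) (v := a) hsub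
        have h3 := h.ok.deg a (hsub ha)
        split_ifs at h1 with haw
        · subst haw; omega
        · omega
    · intro a ha b hb c hc hab hbc hac
      have tf := h.ok.tf
      have key : ∀ t ∈ S \ {u, v}, ¬ (G.Adj x t ∧ G.Adj w t) := by
        intro t ht ⟨k1, k2⟩
        simp only [Finset.mem_sdiff, Finset.mem_insert, Finset.mem_singleton, not_or] at ht
        exact hcom t ht.1 ht.2.2 ht.2.1 k1 k2
      have star : ∀ b ∈ S \ {u, v}, ∀ c ∈ S \ {u, v}, (addStar G x {w}).Adj x b →
          (addStar G x {w}).Adj x c → G.Adj b c → False := by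
        intro b hb c hc h1 h2 h3
        rw [addStar_adj] at h1 h2
        have e1 : G.Adj x b ∨ b = w := by
          rcases h1 with h1 | ⟨h4, h5 | h5⟩
          exacts [Or.inl h1, Or.inr (by simpa using h5.2), absurd h5.1.symm h4]
        have e2 : G.Adj x c ∨ c = w := by
          rcases h2 with h1 | ⟨h4, h5 | h5⟩
          exacts [Or.inl h1, Or.inr (by simpa using h5.2), absurd h5.1.symm h4]
        rcases e1 with e1 | rfl
        · rcases e2 with e2 | rfl
          · exact tf x hx b (hsub hb) c (hsub hc) e1 h3 e2
          · exact key b hb ⟨e1, h3.symm⟩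
        · rcases e2 with e2 | rfl
          · exact key c hc ⟨e2, h3⟩
          · exact G.irrefl h3
      rcases addStar_triangle hab hbc hac with ⟨k1, k2, k3⟩ | ⟨rfl, k⟩ | ⟨rfl, k⟩ | ⟨rfl, k⟩
      · exact tf a (hsub ha) b (hsub hb) c (hsub hc) k1 k2 k3
      · exact star b hb c hc hab hac k
      · exact star a ha c hc hab.symm hbc k
      · exact star a ha b hb hac.symm hbc.symm k
  obtain ⟨I', F, hI', hi', hF, hc⟩ := h.ih _ _ (by omega) hok
  have hE' : E (addStar G x {w}) (S \ {u, v}) (S \ {u, v}) ≤ E G (S \ {u, v}) (S \ {u, v}) + 2 := by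
    have e : ∀ a ∈ S \ {u, v}, (nb (addStar G x {w}) (S \ {u, v}) a).card ≤
        (nb G (S \ {u, v}) a).card + ((if a = x then 1 else 0) + if a = w then 1 else 0) := by
      intro a ha
      by_cases hax : a = x
      · subst hax; simp [hxw, bx]
      · simpa [hax] using bo a hax
    refine (Finset.sum_le_sum e).trans ?_
    rw [Finset.sum_add_distrib, Finset.sum_add_distrib, Finset.sum_ite_eq', Finset.sum_ite_eq',
      if_pos hxS, if_pos hwS]
    rfl
  have hES := E_self_split (G := G) hX
  have hXX : E G {u, v} {u, v} = 2 := by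
    have e1 : nb G {u, v} u = {v} := by
      ext z; simp only [mem_nb, Finset.mem_insert, Finset.mem_singleton]
      constructor
      · rintro ⟨rfl | rfl, k⟩
        · simp at k
        · rfl
      · rintro rfl; simp [huv']
    have e2 : nb G {u, v} v = {u} := by
      ext z; simp only [mem_nb, Finset.mem_insert, Finset.mem_singleton]
      constructor
      · rintro ⟨rfl | rfl, k⟩
        · rfl
        · simp at k
      · rintro rfl; simp [huv'.symm]
    rw [E_insert_left (by simpa), E_singleton_left, e1, e2]; simp
  have hXS : E G {u, v} S = 4 := by
    rw [E_insert_left (by simpa), E_singleton_left, hnv, hnu, Finset.card_pair huw,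
      Finset.card_pair hvx]
  have hXo := E_split (G := G) (B := {u, v}) hX
  -- A difficult component avoiding `x` also avoids `w`, because of the new edge, and would be a
  -- component of `G[S]` itself. So at most one difficult component arises.
  have hFx : ∀ B ∈ F, x ∈ B := by
    intro B hB
    by_contra hxB
    have h0 := E_eq_zero.1 (hF.closed B hB)
    have hBs := hF.sub B hB
    have hwB : w ∉ B := fun hwB => h0 w hwB x (Finset.mem_sdiff.2 ⟨hxS, hxB⟩)
      (addStar_adj.2 (Or.inr ⟨hxw.symm, Or.inr (by simp)⟩))
    have huB : u ∉ B := fun k => by simpa using hBs k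
    have hvB : v ∉ B := fun k => by simpa using hBs k
    have := h.conn (hBs.trans hsub) (hF.diff B hB).nonempty (by rintro rfl; exact huB hu)
    have h00 : E G B (S \ B) = 0 := by
      rw [E_eq_zero]
      intro a ha b hb hab
      have haS := hsub (hBs ha)
      by_cases hbu : b = u
      · subst hbu
        have : a ∈ nb G S b := mem_nb.2 ⟨haS, hab.symm⟩
        rw [hnu, Finset.mem_insert, Finset.mem_singleton] at this
        rcases this with rfl | rfl <;> contradiction
      by_cases hbv : b = v
      · subst hbv
        have : a ∈ nb G S b := mem_nb.2 ⟨haS, hab.symm⟩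
        rw [hnv, Finset.mem_insert, Finset.mem_singleton] at this
        rcases this with rfl | rfl <;> contradiction
      rw [Finset.mem_sdiff] at hb
      exact h0 a ha b (by simp [hb.1, hb.2, hbu, hbv]) (le_addStar hab)
    omega
  have hF1 : F.card ≤ 1 := by
    rw [Finset.card_le_one]
    intro B hB C hC
    by_contra hne
    exact Finset.disjoint_left.1 (hF.disj B hB C hC hne) (hFx B hB) (hFx C hC)
  have hiG : Indep G I' := fun a ha b hb hab => hi' a ha b hb (le_addStar hab)
  -- Two vertices cost 16 and the difficult component at most 2; the net loss of two edges returns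
  -- 4, so one additional independent vertex, worth 14, suffices.
  have fin : ∀ t ∈ S, t ∉ I' → (∀ a ∈ I', ¬ G.Adj t a) → False := by
    intro t ht htI hta
    refine h.not_zero ⟨insert t I', Finset.insert_subset ht (hI'.trans hsub), ?_, ?_⟩
    · intro a ha b hb hab
      rcases Finset.mem_insert.1 ha with rfl | h1 <;> rcases Finset.mem_insert.1 hb with h2 | h2
      · subst h2; exact G.irrefl hab
      · exact hta _ h2 hab
      · subst h2; exact hta _ h1 hab.symm
      · exact hiG a h1 b h2 hab
    · rw [Finset.card_insert_of_notMem htI]; omega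
  have huI : u ∉ I' := fun k => by simpa using hI' k
  have hvI : v ∉ I' := fun k => by simpa using hI' k
  -- The new edge prevents `x` and `w` from both being chosen, so `v` or `u` can be added.
  by_cases hxI : x ∈ I'
  · refine fin v hv hvI fun a ha hva => ?_
    have : a ∈ nb G S v := mem_nb.2 ⟨hsub (hI' ha), hva⟩
    rw [hnv, Finset.mem_insert, Finset.mem_singleton] at this
    rcases this with rfl | rfl
    · exact huI ha
    · exact hi' x hxI a ha (addStar_adj.2 (Or.inr ⟨hxw, Or.inl (by simp)⟩))
  · refine fin u hu huI fun a ha hva => ?_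
    have : a ∈ nb G S u := mem_nb.2 ⟨hsub (hI' ha), hva⟩
    rw [hnu, Finset.mem_insert, Finset.mem_singleton] at this
    rcases this with rfl | rfl
    · exact hvI ha
    · exact hxI ha

end MinCl
end ThreeTight

namespace ThreeTight
open scoped Classical

variable {V : Type*} {G : SimpleGraph V} {A B C S T X I J R Q : Finset V} {u v w x y p : V}

namespace MinCl

/-- Let `x` and `y` be the remaining neighbours of `u` and `w`. If `x = y`, a 4-cycle is attached by
at most one edge; if `x` and `y` are adjacent, a 5-cycle has at most two leaving edges. Otherwise
the path can be contracted without creating a triangle. -/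
lemma no_deg_two_two (h : MinCl G S) (hv : v ∈ S) (hnv : nb G S v = {u, w}) (huw : u ≠ w)
    (hu : (nb G S u).card = 2) (hw : (nb G S w).card = 2) : False := by
  have hu' : u ∈ S ∧ G.Adj v u := mem_nb.1 (hnv ▸ by simp)
  have hw' : w ∈ S ∧ G.Adj v w := mem_nb.1 (hnv ▸ by simp)
  obtain ⟨x, hxv, hnu⟩ := exists_pair hu (v := v) (mem_nb.2 ⟨hv, hu'.2.symm⟩)
  obtain ⟨y, hyv, hnw⟩ := exists_pair hw (v := v) (mem_nb.2 ⟨hv, hw'.2.symm⟩)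
  have hx' : x ∈ S ∧ G.Adj u x := mem_nb.1 (hnu ▸ by simp)
  have hy' : y ∈ S ∧ G.Adj w y := mem_nb.1 (hnw ▸ by simp)
  have tf := h.ok.tf
  have nuw : ¬ G.Adj u w := tf u hu'.1 v hv w hw'.1 hu'.2.symm hw'.2
  have hxw : x ≠ w := by rintro rfl; exact nuw hx'.2
  have hyu : y ≠ u := by rintro rfl; exact nuw hy'.2.symm
  have nvx : ¬ G.Adj v x := fun k => tf v hv u hu'.1 x hx'.1 hu'.2 hx'.2 k
  have nvy : ¬ G.Adj v y := fun k => tf v hv w hw'.1 y hy'.1 hw'.2 hy'.2 k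
  have dv : (nb G S v).card = 2 := by rw [hnv, Finset.card_pair huw]
  by_cases hxy : x = y
  · subst hxy
    have hBs : ({x, u, v, w} : Finset V) ⊆ S := by
      intro z; simp only [Finset.mem_insert, Finset.mem_singleton]
      rintro (rfl | rfl | rfl | rfl)
      exacts [hx'.1, hu'.1, hv, hw'.1]
    have cB : ({x, u, v, w} : Finset V).card ≤ 4 := Finset.card_le_four
    by_cases hS : ({x, u, v, w} : Finset V) = S
    · refine h.not_zero ⟨{u, w}, ?_, ?_, ?_⟩
      · rw [← hS]; intro z; simp only [Finset.mem_insert, Finset.mem_singleton]; tauto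
      · intro a ha b hb hab
        simp only [Finset.mem_insert, Finset.mem_singleton] at ha hb
        rcases ha with rfl | rfl <;> rcases hb with rfl | rfl
        exacts [G.irrefl hab, nuw hab, nuw hab.symm, G.irrefl hab]
      · have : E G {u, v} S ≤ E G S S := E_mono_left (by
          intro z; simp only [Finset.mem_insert, Finset.mem_singleton]
          rintro (rfl | rfl); exacts [hu'.1, hv])
        rw [E_insert_left (by simpa using hu'.2.ne.symm), E_singleton_left] at this
        have hcu := Finset.card_pair huw
        rw [hS] at cB
        rw [hu, dv] at this
        omega
    · have hb := h.bridge hBs ⟨x, by simp⟩ hS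
      have e0 : E G {u, v, w} (S \ {x, u, v, w}) = 0 := by
        rw [E_eq_zero]
        intro a ha b hb hab
        have hb' := Finset.mem_sdiff.1 hb
        have : b ∈ nb G S a := mem_nb.2 ⟨hb'.1, hab⟩
        simp only [Finset.mem_insert, Finset.mem_singleton] at ha hb'
        rcases ha with rfl | rfl | rfl
        · rw [hnu, Finset.mem_insert, Finset.mem_singleton] at this; tauto
        · rw [hnv, Finset.mem_insert, Finset.mem_singleton] at this; tauto
        · rw [hnw, Finset.mem_insert, Finset.mem_singleton] at this; tauto
      have hxm : x ∉ ({u, v, w} : Finset V) := by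
        simp [hx'.2.ne.symm, hxv, hxw]
      rw [E_insert_left hxm, e0] at hb
      have e1 : ({u, w} : Finset V) ⊆ nb G S x := by
        intro z; simp only [Finset.mem_insert, Finset.mem_singleton]
        rintro (rfl | rfl)
        exacts [mem_nb.2 ⟨hu'.1, hx'.2.symm⟩, mem_nb.2 ⟨hw'.1, hy'.2.symm⟩]
      have e2 : nb G (S \ {x, u, v, w}) x ⊆ nb G S x \ {u, w} := by
        intro z hz
        simp only [mem_nb, Finset.mem_sdiff, Finset.mem_insert, Finset.mem_singleton] at *
        tauto
      have e3 := Finset.card_le_card e2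
      have e4 := Finset.card_sdiff_add_card_eq_card e1
      have e5 := h.ok.deg x hx'.1
      rw [Finset.card_pair huw] at e4
      omega
  by_cases hadj : G.Adj x y
  · let f : Fin 5 → V := ![v, w, y, x, u]
    have hfi : Function.Injective f := by
      rw [← List.nodup_ofFn]
      simp [f, hw'.2.ne, hyv.symm, hxv.symm, hu'.2.ne, hy'.2.ne, hxw.symm, huw.symm,
        hadj.ne.symm, hyu, hx'.2.ne.symm]
    have hmem : ∀ i, f i ∈ S := by
      intro i; fin_cases i
      exacts [hv, hw'.1, hy'.1, hx'.1, hu'.1]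
    have hdeg : ∀ i : Fin 5, i = 0 ∨ i = 1 ∨ i = 4 → (nb G S (f i)).card ≤ pdeg c5 i := by
      rintro i (rfl | rfl | rfl)
      · exact dv.le
      · exact hw.le
      · exact hu.le
    obtain ⟨g, hg⟩ := emb_of_hom (G := G) (S := S) c5 f hfi hmem
      (hom_of_edges (by
        simp only [List.mem_cons, List.not_mem_nil, or_false, forall_eq_or_imp, forall_eq]
        exact ⟨hw'.2, hy'.2, hadj.symm, hx'.2.symm, hu'.2.symm⟩))
      (by
        intro i j hij hn
        have : (i = 0 ∨ i = 1 ∨ i = 4) ∨ (j = 0 ∨ j = 1 ∨ j = 4) := by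
          revert i j; decide
        exact this.imp (hdeg i) (hdeg j))
    have hgS : img g ⊆ S := img_subset.2 fun i => by rw [hg]; exact hmem i
    have hbd := (h.c5_bd g hgS).1
    rw [E_img_out g.injective, Fin.sum_univ_five] at hbd
    have o := out_le c5 g hgS
    have h0 := o 0
    have h1 := o 1
    have h2 := o 2
    have h3 := o 3
    have h4 := o 4
    rw [show pdeg c5 0 = 2 by decide, hg 0, show f 0 = v from rfl] at h0
    rw [show pdeg c5 1 = 2 by decide, hg 1, show f 1 = w from rfl] at h1
    rw [show pdeg c5 2 = 2 by decide, hg 2, show f 2 = y from rfl] at h2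
    rw [show pdeg c5 3 = 2 by decide, hg 3, show f 3 = x from rfl] at h3
    rw [show pdeg c5 4 = 2 by decide, hg 4, show f 4 = u from rfl] at h4
    rw [hg, hg, hg, hg, hg, show f 0 = v from rfl, show f 1 = w from rfl, show f 2 = y from rfl,
      show f 3 = x from rfl, show f 4 = u from rfl] at hbd
    have := h.ok.deg x hx'.1
    have := h.ok.deg y hy'.1
    omega
  · have hwx : ¬ G.Adj x w := by
      intro k
      have : x ∈ nb G S w := mem_nb.2 ⟨hx'.1, k.symm⟩
      rw [hnw, Finset.mem_insert, Finset.mem_singleton] at this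
      tauto
    refine h.contract hv hu'.1 hx'.1 hw'.1 hnv hnu hu'.2.ne.symm hxw huw hxv.symm hwx ?_
    intro t ht htv htu hxt hwt
    have : t ∈ nb G S w := mem_nb.2 ⟨ht, hwt⟩
    rw [hnw, Finset.mem_insert, Finset.mem_singleton] at this
    rcases this with rfl | rfl
    · exact htv rfl
    · exact hadj hxt

/-! ### The cubic case and Staton's bound -/

lemma cubic (h : MinCl G S) (hv : v ∈ S) : (nb G S v).card = 3 := by
  have h2 : ∀ v ∈ S, (nb G S v).card = 2 ∨ (nb G S v).card = 3 := by
    intro v hv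
    have := h.two_le_deg hv
    have := h.ok.deg v hv
    omega
  rcases h2 v hv with hv2 | hv3
  · exfalso
    obtain ⟨u, w, huw, hnv⟩ := Finset.card_eq_two.1 hv2
    have hu' : u ∈ S := nb_subset (hnv ▸ by simp : u ∈ nb G S v)
    have hw' : w ∈ S := nb_subset (hnv ▸ by simp : w ∈ nb G S v)
    rcases h2 u hu' with hu | hu <;> rcases h2 w hw' with hw | hw
    · exact h.no_deg_two_two hv hnv huw hu hw
    · exact h.no_deg_two_three hv hnv huw hu hw
    · exact h.no_deg_two_three hv (by rw [hnv, Finset.pair_comm]) huw.symm hw hu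
    · exact h.no_deg_three_three hv hnv huw hu hw
  · exact hv3

/-- Delete the copy together with the outside neighbour `q` of `f 4`, choosing `f 4`, `f 2`, `f 3`.
If `q` has `t` neighbours in the copy, then `7 - 2t` edges leave, with `t ≤ 2` as there is no
bridge. More than `2 - t` difficult components would be needed, each using at least four of these
edges. -/
lemma no_k4s (h : MinCl G S) (f : k4s ↪g G) (hf : img f ⊆ S) : False := by
  have hd : ∑ i, pdeg k4s i = 20 := by decide
  have hfS := img_subset.1 hf
  have o := out_le k4s f hf 4
  rw [h.cubic (hfS 4), show pdeg k4s 4 = 2 by decide] at o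
  obtain ⟨q, hq⟩ := Finset.card_eq_one.1 (show (nb G (S \ img f) (f 4)).card = 1 by omega)
  have hq' : q ∈ S \ img f ∧ G.Adj (f 4) q := mem_nb.1 (hq ▸ by simp)
  obtain ⟨hqS, hqf⟩ := Finset.mem_sdiff.1 hq'.1
  have hX : insert q (img f) ⊆ S := Finset.insert_subset hqS hf
  have full : ∀ i, pdeg k4s i = 3 → nb G S (f i) ⊆ insert q (img f) := by
    intro i hi
    rw [nb_img_of_full k4s f hfS i (by rw [hi]; exact (h.cubic (hfS i)).le)]
    exact nb_subset.trans (Finset.subset_insert _ _)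
  obtain ⟨F, hF, hFE, hc, hcc⟩ := h.deletion (X := insert q (img f))
    (I := ({4, 2, 3} : Finset (Fin 8)).image f) hX ⟨q, by simp⟩
    (by
      intro x hx
      obtain ⟨i, -, rfl⟩ := Finset.mem_image.1 hx
      simp)
    (by
      intro a ha b hb
      obtain ⟨i, hi, rfl⟩ := Finset.mem_image.1 ha
      obtain ⟨j, hj, rfl⟩ := Finset.mem_image.1 hb
      rw [f.map_adj_iff]
      clear ha hb; revert i j; decide)
    (by
      intro a ha
      obtain ⟨i, hi, rfl⟩ := Finset.mem_image.1 ha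
      simp only [Finset.mem_insert, Finset.mem_singleton] at hi
      rcases hi with rfl | rfl | rfl
      · intro z hz
        rw [Finset.mem_insert]
        by_contra hz'
        rw [not_or] at hz'
        have : z ∈ nb G (S \ img f) (f 4) := by
          rw [mem_nb] at hz ⊢
          exact ⟨Finset.mem_sdiff.2 ⟨hz.1, hz'.2⟩, hz.2⟩
        rw [hq, Finset.mem_singleton] at this
        exact hz'.1 this
      · exact full 2 (by decide)
      · exact full 3 (by decide))
  have h4 := hcc 4 fun B hB => h.diff_bd4 (hF.diff B hB) ((hF.sub B hB).trans Finset.sdiff_subset)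
  rw [Finset.card_image_of_injective _ f.injective, Finset.card_insert_of_notMem hqf,
    img_card f.injective] at hc
  have hXS : E G (insert q (img f)) S = 3 * 9 := by
    rw [E_eq_mul 3 fun v hv => h.cubic (hX hv), Finset.card_insert_of_notMem hqf,
      img_card f.injective]
  have hsp := E_split (G := G) (B := insert q (img f)) hX
  have hXX : E G (insert q (img f)) (insert q (img f)) = 20 + 2 * E G {q} (img f) := by
    have := E_self_split (G := G) (Finset.subset_insert q (img f))
    have e : insert q (img f) \ img f = {q} := by
      ext z
      simp only [Finset.mem_sdiff, Finset.mem_insert, Finset.mem_singleton]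
      exact ⟨fun k => k.1.resolve_right k.2, fun k => ⟨Or.inl k, k ▸ hqf⟩⟩
    rw [e, E_img, hd] at this
    have e0 : E G {q} {q} = 0 := by rw [E_eq_zero]; simp
    rw [this, e0, E_comm]
    ring
  have hbr : 2 ≤ E G (insert q (img f)) (S \ insert q (img f)) := by
    refine h.bridge hX ⟨q, by simp⟩ fun e => ?_
    rw [show S \ insert q (img f) = ∅ by rw [e, Finset.sdiff_self], E_empty_right] at hsp
    omega
  have : ({4, 2, 3} : Finset (Fin 8)).card = 3 := by decide
  omega

/-- In the cubic case a 5-cycle has exactly five leaving edges, `k4s` is excluded, and a join has at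
least 5 + 5 - 2 = 8. -/
lemma diff_bd_cubic (h : MinCl G S) (hB : Diff G B) : B ⊆ S →
    E G B (S \ B) = 5 ∨ 8 ≤ E G B (S \ B) := by
  induction hB with
  | c5 f =>
    intro hs
    left
    rw [E_img_out f.injective, Finset.sum_eq_card_nsmul (b := 1)]
    · simp
    · intro i _
      have := out_le c5 f hs i
      rw [h.cubic (img_subset.1 hs i), show pdeg c5 i = 2 by clear this; revert i; decide] at this
      omega
  | k4s f => exact fun hs => (h.no_k4s f hs).elim
  | join B C hB hC hd hE h1 h2 =>
    intro hs
    have b1 := h1 (Finset.union_subset_left hs)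
    have b2 := h2 (Finset.union_subset_right hs)
    have := E_join (G := G) (Finset.union_subset_left hs) (Finset.union_subset_right hs) hd
    omega

/-- Deleting a vertex with its three neighbours breaks even, so a difficult component must appear.
Six edges leave the deleted set; the component takes exactly five of them, and the sixth is a
bridge. -/
lemma false (h : MinCl G S) : False := by
  obtain ⟨v, hv⟩ : S.Nonempty := by
    rw [Finset.nonempty_iff_ne_empty]
    rintro rfl
    exact h.not_zero ⟨∅, by simp, by simp [Indep], by simp⟩
  have hX : insert v (nb G S v) ⊆ S := Finset.insert_subset hv nb_subset
  have hvn : v ∉ nb G S v := by simp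
  have cX : (insert v (nb G S v)).card = 4 := by
    rw [Finset.card_insert_of_notMem hvn, h.cubic hv]
  have hXX : E G (insert v (nb G S v)) (insert v (nb G S v)) = 6 := by
    have e1 : nb G (insert v (nb G S v)) v = nb G S v := by
      ext z; simp only [mem_nb, Finset.mem_insert]
      constructor
      · rintro ⟨rfl | k, k'⟩
        · simp at k'
        · exact k
      · exact fun k => ⟨Or.inr k, k.2⟩
    have e2 : ∀ a ∈ nb G S v, (nb G (insert v (nb G S v)) a).card = 1 := by
      intro a ha
      rw [Finset.card_eq_one]
      refine ⟨v, ?_⟩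
      rw [mem_nb] at ha
      ext z; simp only [mem_nb, Finset.mem_insert, Finset.mem_singleton]
      constructor
      · rintro ⟨rfl | k, k'⟩
        · rfl
        · exact absurd k.2 (h.ok.tf v hv a ha.1 z k.1 ha.2 k')
      · rintro rfl; exact ⟨Or.inl rfl, ha.2.symm⟩
    rw [E_insert_left hvn, e1, E_eq_mul 1 e2, h.cubic hv]
  have hXS : E G (insert v (nb G S v)) S = 3 * 4 := by
    rw [E_eq_mul 3 fun v hv => h.cubic (hX hv), cX]
  have hsp := E_split (G := G) (B := insert v (nb G S v)) hX
  obtain ⟨F, hF, hFE, hc, hcc⟩ := h.deletion (I := {v}) hX ⟨v, by simp⟩ (by simp)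
    (by
      intro a ha b hb
      rw [Finset.mem_singleton] at ha hb
      subst ha hb
      exact G.irrefl)
    (by
      intro a ha
      rw [Finset.mem_singleton] at ha
      subst ha
      exact Finset.subset_insert _ _)
  rw [cX, Finset.card_singleton] at hc
  obtain ⟨B, hB⟩ := Finset.card_pos.1 (show 0 < F.card by omega)
  have hBs := (hF.sub B hB).trans Finset.sdiff_subset
  have hbd := h.diff_bd_cubic (hF.diff B hB) hBs
  have hBX := hFE B hB
  have hBX' := E_mono_left (G := G) (C := insert v (nb G S v)) (hF.sub B hB)
  rw [E_comm (A := S \ _)] at hBX'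
  have hdisj : Disjoint B (insert v (nb G S v)) :=
    Finset.disjoint_of_subset_left (hF.sub B hB) Finset.sdiff_disjoint
  have hj := E_join (G := G) hBs hX hdisj
  have := h.bridge (B := B ∪ insert v (nb G S v)) (Finset.union_subset hBs hX) ⟨v, by simp⟩
    (fun e => by rw [e, Finset.sdiff_self, E_empty_right] at hj; omega)
  omega

end MinCl

theorem claim_of_subcubic : ∀ (n : ℕ) (G : SimpleGraph V) (S : Finset V), S.card = n →
    Subcubic G S → Claim G S := by
  intro n
  induction n using Nat.strong_induction_on with
  | _ n ih =>
    intro G S hn hS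
    by_contra hc
    exact MinCl.false ⟨hS, hc, fun G' S' hlt => ih _ (hn ▸ hlt) G' S' rfl⟩

lemma Diff.deficiency (h : Diff G B) : E G B B + 2 ≤ 3 * B.card := by
  induction h with
  | c5 f => rw [E_img, img_card f.injective]; decide
  | k4s f => rw [E_img, img_card f.injective]; decide
  | join B C hB hC hd hE h1 h2 =>
    rw [E_union_left hd, E_union_right hd, E_union_right hd, E_comm (A := C) (B := B),
      Finset.card_union_of_disjoint hd]
    omega

/-- Staton's theorem. -/
theorem staton (h : Subcubic G S) : ∃ I ⊆ S, Indep G I ∧ 15 * S.card ≤ 42 * I.card := by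
  obtain ⟨I, F, hI, hi, hF, hc⟩ := claim_of_subcubic _ G S rfl h
  refine ⟨I, hI, hi, ?_⟩
  have hsub : F.biUnion id ⊆ S := Finset.biUnion_subset.2 hF.sub
  have hpd : (F : Set (Finset V)).PairwiseDisjoint id := fun B hB C hC hne => hF.disj B hB C hC hne
  -- Each difficult component misses cubicity by at least 2 in its degree sum. This absorbs its
  -- extra term, so `E G S S + 2 * F.card ≤ 3 * S.card` and `15 n ≤ 42 α` follows.
  have h1 : E G (F.biUnion id) S + 2 * F.card ≤ 3 * (F.biUnion id).card := by
    rw [Finset.card_biUnion hpd, E, Finset.sum_biUnion hpd, Finset.mul_sum, mul_comm 2,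
      ← smul_eq_mul F.card, ← Finset.sum_const, ← Finset.sum_add_distrib]
    refine Finset.sum_le_sum fun B hB => ?_
    have := (hF.diff B hB).deficiency
    have h2 := E_split (G := G) (B := B) (hF.sub B hB)
    rw [hF.closed B hB] at h2
    change E G B S + 2 ≤ 3 * B.card
    omega
  have h2 : E G (S \ F.biUnion id) S ≤ 3 * (S \ F.biUnion id).card :=
    E_le_mul 3 fun v hv => h.deg v (Finset.sdiff_subset hv)
  have h3 := E_split_left (G := G) (B := S) hsub
  have h4 := Finset.card_sdiff_add_card_eq_card hsub
  omega

end ThreeTight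

/-! ### The main induction: minimal counterexamples and diamonds -/

namespace ThreeTight
open scoped Classical

variable {V : Type*} {G : SimpleGraph V} {A B C D S S' T X I J R Q : Finset V}
  {a b c d u v w x y z p q : V}

/-- The necklaces on their standard vertex sets. -/
inductive Neck : ∀ {n : ℕ}, SimpleGraph (Fin n) → Prop
  | d6 : Neck diamondNecklace6
  | d9 : Neck diamondNecklace9
  | d12 : Neck diamondNecklace12
  | h9 : Neck havelNecklace9
  | h12 : Neck havelNecklace12

/-- The 3-tight graphs other than the triangle on their standard vertex sets. -/
inductive Big : ∀ {n : ℕ}, SimpleGraph (Fin n) → Prop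
  | neck {n : ℕ} {P : SimpleGraph (Fin n)} (h : Neck P) : Big P
  | td : Big triangleDominatedSixCycle

/-- `v` lies in a triangle of `G` with all other vertices in `S`. -/
def InTri (G : SimpleGraph V) (S : Finset V) (v : V) : Prop :=
  ∃ a ∈ S, ∃ b ∈ S, G.Adj v a ∧ G.Adj v b ∧ G.Adj a b

/-- `v` lies in a necklace or a triangle-dominated 6-cycle of `G[S]`. -/
def InBig (G : SimpleGraph V) (S : Finset V) (v : V) : Prop :=
  ∃ (n : ℕ) (P : SimpleGraph (Fin n)), Big P ∧ ∃ f : P ↪g G, (∀ i, f i ∈ S) ∧ ∃ i, f i = v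

/-- The 3-free vertices of `G[S]`. -/
noncomputable def frees (G : SimpleGraph V) (S : Finset V) : Finset V :=
  S.filter fun v => ¬ InTri G S v ∧ ¬ InBig G S v

/-- The free diamonds of `G[S]`. -/
noncomputable def fdiams (G : SimpleGraph V) (S : Finset V) : Finset (Finset V) :=
  S.powerset.filter fun D => (∃ f : diamondGraph ↪g G, img f = D) ∧
    ∀ (n : ℕ) (P : SimpleGraph (Fin n)), Neck P → ∀ f : P ↪g G, (∀ i, f i ∈ S) → ¬ D ⊆ img f

/-- The lower bound on the independence number of `G[S]`. -/
def Good (G : SimpleGraph V) (S : Finset V) : Prop :=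
  ∃ I ⊆ S, Indep G I ∧ 14 * S.card + (frees G S).card + (fdiams G S).card ≤ 42 * I.card

/-- `G[S]` has maximum degree at most three and no `K₄`. -/
structure Brooks (G : SimpleGraph V) (S : Finset V) : Prop where
  deg : ∀ v ∈ S, (nb G S v).card ≤ 3
  k4 : ∀ a ∈ S, ∀ b ∈ S, ∀ c ∈ S, ∀ d ∈ S, G.Adj a b → G.Adj a c → G.Adj a d → G.Adj b c →
    G.Adj b d → ¬ G.Adj c d

/-- `G[S]` is a minimal counterexample to `Good`. -/
structure MinG (G : SimpleGraph V) (S : Finset V) : Prop where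
  ok : Brooks G S
  fail : ¬ Good G S
  ih : ∀ (G' : SimpleGraph V) (S' : Finset V), S'.card < S.card → Brooks G' S' → Good G' S'

lemma Brooks.mono (h : Brooks G S) (hs : T ⊆ S) : Brooks G T :=
  ⟨fun v hv => (nb_card_mono hs).trans (h.deg v (hs hv)),
    fun a ha b hb c hc d hd => h.k4 a (hs ha) b (hs hb) c (hs hc) d (hs hd)⟩

lemma mem_frees : v ∈ frees G S ↔ v ∈ S ∧ ¬ InTri G S v ∧ ¬ InBig G S v := by
  simp [frees]

lemma InTri.mono (h : InTri G T v) (hs : T ⊆ S) : InTri G S v := by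
  obtain ⟨a, ha, b, hb, k⟩ := h
  exact ⟨a, hs ha, b, hs hb, k⟩

lemma InBig.mono (h : InBig G T v) (hs : T ⊆ S) : InBig G S v := by
  obtain ⟨n, P, hP, f, hf, k⟩ := h
  exact ⟨n, P, hP, f, fun i => hs (hf i), k⟩

/-- A vertex of `Q` gains at most the edge to `p` and has lost an edge to a deleted vertex, so its
degree stays bounded. A new `K₄` would have to contain `p`. -/
lemma ok_addStar (h : Brooks G S) (hS' : S' ⊆ S) (hdeg : (nb (addStar G p Q) S' p).card ≤ 3)
    (hQ : ∀ q ∈ Q, q ∈ S' → ∃ x ∈ S \ S', G.Adj x q)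
    (hk : ∀ u ∈ S', ∀ v ∈ S', ∀ w ∈ S', (addStar G p Q).Adj p u → (addStar G p Q).Adj p v →
      (addStar G p Q).Adj p w → G.Adj u v → G.Adj v w → ¬ G.Adj u w) :
    Brooks (addStar G p Q) S' := by
  refine ⟨fun v hv => ?_, ?_⟩
  · by_cases hvp : v = p
    · rwa [hvp]
    · by_cases hvQ : v ∈ Q
      · obtain ⟨x, hx, hxv⟩ := hQ v hvQ hv
        rw [Finset.mem_sdiff] at hx
        have h1 := Finset.card_le_card (nb_addStar_other (G := G) (S := S') (Q := Q) hvp)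
        have h2 := Finset.card_insert_le p (nb G S' v)
        have h3 : insert x (nb G S' v) ⊆ nb G S v :=
          Finset.insert_subset (mem_nb.2 ⟨hx.1, hxv.symm⟩) (nb_mono hS')
        have h4 := Finset.card_le_card h3
        rw [Finset.card_insert_of_notMem (fun k => hx.2 (nb_subset k))] at h4
        have := h.deg v (hS' hv)
        omega
      · rw [nb_addStar_notMem hvp hvQ]
        exact (nb_card_mono hS').trans (h.deg v (hS' hv))
  · intro a ha b hb c hc d hd ab ac ad bc bd cd
    by_cases h1 : a = p
    · subst h1
      exact hk b hb c hc d hd ab ac ad ((addStar_adj_off ab.ne.symm ac.ne.symm).1 bc)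
        ((addStar_adj_off ac.ne.symm ad.ne.symm).1 cd) ((addStar_adj_off ab.ne.symm ad.ne.symm).1 bd)
    by_cases h2 : b = p
    · subst h2
      exact hk a ha c hc d hd ab.symm bc bd ((addStar_adj_off h1 bc.ne.symm).1 ac)
        ((addStar_adj_off bc.ne.symm bd.ne.symm).1 cd) ((addStar_adj_off h1 bd.ne.symm).1 ad)
    by_cases h3 : c = p
    · subst h3
      exact hk a ha b hb d hd ac.symm bc.symm cd ((addStar_adj_off h1 h2).1 ab)
        ((addStar_adj_off h2 cd.ne.symm).1 bd) ((addStar_adj_off h1 cd.ne.symm).1 ad)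
    by_cases h4 : d = p
    · subst h4
      exact hk a ha b hb c hc ad.symm bd.symm cd.symm ((addStar_adj_off h1 h2).1 ab)
        ((addStar_adj_off h2 h3).1 bc) ((addStar_adj_off h1 h3).1 ac)
    rw [addStar_adj_off (by assumption) (by assumption)] at *
    exact h.k4 a (hS' ha) b (hS' hb) c (hS' hc) d (hS' hd) ab ac ad bc bd cd

lemma emb_off {n : ℕ} {P : SimpleGraph (Fin n)} (f : P ↪g addStar G p Q) (h : ∀ i, f i ≠ p) :
    ∃ g : P ↪g G, ∀ i, g i = f i :=
  ⟨⟨f.toEmbedding, fun {i j} => by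
    rw [← f.map_adj_iff]; exact (addStar_adj_off (h i) (h j)).symm⟩, fun _ => rfl⟩

lemma emb_off' {n : ℕ} {P : SimpleGraph (Fin n)} (f : P ↪g G) (h : ∀ i, f i ≠ p) :
    ∃ g : P ↪g addStar G p Q, ∀ i, g i = f i :=
  ⟨⟨f.toEmbedding, fun {i j} => by
    rw [← f.map_adj_iff]; exact addStar_adj_off (h i) (h j)⟩, fun _ => rfl⟩

/-- `a, b, c, d` span a diamond with tips `c, d`. -/
structure Dia (G : SimpleGraph V) (S : Finset V) (a b c d : V) : Prop where
  ha : a ∈ S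
  hb : b ∈ S
  hc : c ∈ S
  hd : d ∈ S
  ab : G.Adj a b
  ac : G.Adj a c
  ad : G.Adj a d
  bc : G.Adj b c
  bd : G.Adj b d
  cd : ¬ G.Adj c d
  ne : c ≠ d

namespace Dia

lemma swap (h : Dia G S a b c d) : Dia G S a b d c :=
  ⟨h.ha, h.hb, h.hd, h.hc, h.ab, h.ad, h.ac, h.bd, h.bc, fun k => h.cd k.symm, h.ne.symm⟩

lemma swap' (h : Dia G S a b c d) : Dia G S b a c d :=
  ⟨h.hb, h.ha, h.hc, h.hd, h.ab.symm, h.bc, h.bd, h.ac, h.ad, h.cd, h.ne⟩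

lemma nba (h : Dia G S a b c d) (ok : Brooks G S) : nb G S a = {b, c, d} := by
  refine eq_of_card_nb_le (ok.deg a h.ha) ?_ ?_
  · intro x
    simp only [Finset.mem_insert, Finset.mem_singleton, mem_nb]
    rintro (rfl | rfl | rfl)
    exacts [⟨h.hb, h.ab⟩, ⟨h.hc, h.ac⟩, ⟨h.hd, h.ad⟩]
  · rw [Finset.card_insert_of_notMem (by simp [h.bc.ne, h.bd.ne]), Finset.card_pair h.ne]

lemma mem_a (h : Dia G S a b c d) (ok : Brooks G S) (hx : x ∈ S) (hax : G.Adj a x) :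
    x = b ∨ x = c ∨ x = d := by
  have : x ∈ nb G S a := mem_nb.2 ⟨hx, hax⟩
  rw [h.nba ok] at this
  simpa using this

/-- Two neighbours of a tip that are outside the diamond coincide. -/
lemma tip_unique (h : Dia G S a b c d) (ok : Brooks G S) (hx : x ∈ S) (hy : y ∈ S)
    (hcx : G.Adj c x) (hcy : G.Adj c y) (xa : x ≠ a) (xb : x ≠ b) (ya : y ≠ a) (yb : y ≠ b) :
    x = y := by
  by_contra hne
  have hs : ({a, b, x, y} : Finset V) ⊆ nb G S c := by
    intro z
    simp only [Finset.mem_insert, Finset.mem_singleton, mem_nb]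
    rintro (rfl | rfl | rfl | rfl)
    exacts [⟨h.ha, h.ac.symm⟩, ⟨h.hb, h.bc.symm⟩, ⟨hx, hcx⟩, ⟨hy, hcy⟩]
  have h1 := Finset.card_le_card hs
  rw [Finset.card_insert_of_notMem (by simp [h.ab.ne, xa.symm, ya.symm]),
    Finset.card_insert_of_notMem (by simp [xb.symm, yb.symm]), Finset.card_pair hne] at h1
  have := ok.deg c h.hc
  omega

/-- A triangle meeting a diamond lies inside it, since every tip has at most one outside neighbour.
Hence distinct diamonds are vertex-disjoint. -/
lemma tri_mem (h : Dia G S a b c d) (ok : Brooks G S) (hu : u = a ∨ u = b ∨ u = c ∨ u = d)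
    (hv : v ∈ S) (hw : w ∈ S) (huv : G.Adj u v) (huw : G.Adj u w) (hvw : G.Adj v w) :
    v = a ∨ v = b ∨ v = c ∨ v = d := by
  have key : ∀ {c d}, Dia G S a b c d → G.Adj c v → G.Adj c w →
      v = a ∨ v = b ∨ v = c ∨ v = d := by
    intro c d h hcv hcw
    by_contra hn
    simp only [not_or] at hn
    by_cases wa : w = a
    · subst wa
      have := h.mem_a ok hv hvw.symm
      tauto
    by_cases wb : w = b
    · subst wb
      have := h.swap'.mem_a ok hv hvw.symm
      tauto
    exact hvw.ne (h.tip_unique ok hv hw hcv hcw hn.1 hn.2.1 wa wb)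
  rcases hu with rfl | rfl | rfl | rfl
  · have := h.mem_a ok hv huv; tauto
  · have := h.swap'.mem_a ok hv huv; tauto
  · exact key h huv huw
  · have := key h.swap huv huw; tauto

lemma exists_emb (h : Dia G S a b c d) : ∃ f : diamondGraph ↪g G, img f = {a, b, c, d} := by
  have hi : Function.Injective ![a, b, c, d] := by
    rw [← List.nodup_ofFn]
    simp [h.ab.ne, h.ac.ne, h.ad.ne, h.bc.ne, h.bd.ne, h.ne]
  obtain ⟨g, hg⟩ := emb_of_hom (G := G) (S := {a, b, c, d}) diamondGraph ![a, b, c, d] hi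
    (by intro i; fin_cases i <;> simp)
    (hom_of_edges (by
      simp only [List.mem_cons, List.not_mem_nil, or_false, forall_eq_or_imp, forall_eq]
      exact ⟨h.ab, h.ac, h.ad, h.bc, h.bd⟩))
    (by
      intro i j hij hn
      have e : i = 2 ∨ i = 3 := by revert i j; decide
      left
      have key : ∀ {c d}, Dia G S a b c d → nb G {a, b, c, d} c ⊆ {a, b} := by
        intro c d h x hx
        simp only [mem_nb, Finset.mem_insert, Finset.mem_singleton] at *
        rcases hx with ⟨rfl | rfl | rfl | rfl, k⟩
        · simp
        · simp
        · simp at k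
        · exact absurd k h.cd
      have two : ∀ x, nb G {a, b, c, d} x ⊆ {a, b} → (nb G {a, b, c, d} x).card ≤ 2 :=
        fun x hx => (Finset.card_le_card hx).trans Finset.card_le_two
      rcases e with rfl | rfl
      · exact two c (key h)
      · refine two d ?_
        have := key h.swap
        rwa [Finset.pair_comm d c] at this)
  refine ⟨g, ?_⟩
  ext x
  simp only [mem_img, hg, Fin.exists_fin_succ, Finset.mem_insert, Finset.mem_singleton]
  simp [eq_comm]

end Dia

lemma dia_of_emb (f : diamondGraph ↪g G) (h : img f ⊆ S) : Dia G S (f 0) (f 1) (f 2) (f 3) := by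
  have hf := img_subset.1 h
  refine ⟨hf 0, hf 1, hf 2, hf 3, f.map_adj_iff.2 (by decide), f.map_adj_iff.2 (by decide),
    f.map_adj_iff.2 (by decide), f.map_adj_iff.2 (by decide), f.map_adj_iff.2 (by decide), ?_, ?_⟩
  · rw [f.map_adj_iff]; decide
  · exact fun e => by simpa using f.injective e

lemma emb_full {n : ℕ} (P : SimpleGraph (Fin n)) [DecidableRel P.Adj] (ok : Brooks G S)
    (hP : ∀ i j, i ≠ j → ¬ P.Adj i j → pdeg P i = 3 ∨ pdeg P j = 3) (f : Fin n → V)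
    (inj : Function.Injective f) (mem : ∀ i, f i ∈ S) (hom : ∀ i j, P.Adj i j → G.Adj (f i) (f j)) :
    ∃ g : P ↪g G, ∀ i, g i = f i :=
  emb_of_hom P f inj mem hom fun i j hij hn =>
    (hP i j hij hn).imp (fun e => (ok.deg _ (mem i)).trans (le_of_eq e.symm))
      fun e => (ok.deg _ (mem j)).trans (le_of_eq e.symm)

end ThreeTight

/-! ### Contracting a diamond and expanding it again -/

namespace ThreeTight
open scoped Classical

variable {V : Type*} {G : SimpleGraph V} {A B C D S S' T X I J R Q : Finset V}
  {a b c d u v w x y z p q : V}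

namespace Dia

/-- The graph obtained by contracting a diamond into its tip `d`. -/
noncomputable def ctr (G : SimpleGraph V) (S : Finset V) (a b c d : V) : SimpleGraph V :=
  addStar G d (nb G (S \ {a, b, c}) c)

lemma ctr_adj (hyd : y ≠ d) (h : (ctr G S a b c d).Adj d y) :
    G.Adj d y ∨ G.Adj c y := by
  rw [ctr, addStar_adj] at h
  rcases h with h | ⟨-, h | h⟩
  · exact Or.inl h
  · exact Or.inr (mem_nb.1 h.2).2
  · exact absurd h.1 hyd

lemma ctr_nb (h : Dia G S a b c d) (ok : Brooks G S) :
    (nb (ctr G S a b c d) (S \ {a, b, c}) d).card ≤ 2 := by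
  have key : ∀ {c d}, Dia G S a b c d → (nb G (S \ {a, b, c}) d).card ≤ 1 := by
    intro c d h
    rw [Finset.card_le_one]
    intro x hx y hy
    simp only [mem_nb, Finset.mem_sdiff, Finset.mem_insert, Finset.mem_singleton, not_or] at hx hy
    exact h.swap.tip_unique ok hx.1.1 hy.1.1 hx.2 hy.2 hx.1.2.1 hx.1.2.2.1 hy.1.2.1 hy.1.2.2.1
  have key2 : (nb G (S \ {a, b, c}) c).card ≤ 1 := by
    rw [Finset.card_le_one]
    intro x hx y hy
    simp only [mem_nb, Finset.mem_sdiff, Finset.mem_insert, Finset.mem_singleton, not_or] at hx hy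
    exact h.tip_unique ok hx.1.1 hy.1.1 hx.2 hy.2 hx.1.2.1 hx.1.2.2.1 hy.1.2.1 hy.1.2.2.1
  refine (Finset.card_le_card nb_addStar_self).trans ((Finset.card_union_le _ _).trans ?_)
  have := Finset.card_le_card (Finset.inter_subset_left (s₁ := nb G (S \ {a, b, c}) c)
    (s₂ := S \ {a, b, c}))
  have := key h
  omega

/-- Each tip has only one neighbour outside the diamond, so two distinct neighbours of the
contracted vertex belong to different tips. -/
lemma tips (h : Dia G S a b c d) (ok : Brooks G S) (hy : y ∈ S \ {a, b, c})
    (hz : z ∈ S \ {a, b, c}) (hyd : y ≠ d) (hzd : z ≠ d) (hyz : y ≠ z)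
    (ay : (ctr G S a b c d).Adj d y) (az : (ctr G S a b c d).Adj d z) :
    (G.Adj c y ∧ G.Adj d z) ∨ (G.Adj d y ∧ G.Adj c z) := by
  have hy' := ctr_adj hyd ay
  have hz' := ctr_adj hzd az
  simp only [Finset.mem_sdiff, Finset.mem_insert, Finset.mem_singleton, not_or] at hy hz
  have t1 : ¬ (G.Adj c y ∧ G.Adj c z) := fun k =>
    hyz (h.tip_unique ok hy.1 hz.1 k.1 k.2 hy.2.1 hy.2.2.1 hz.2.1 hz.2.2.1)
  have t2 : ¬ (G.Adj d y ∧ G.Adj d z) := fun k =>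
    hyz (h.swap.tip_unique ok hy.1 hz.1 k.1 k.2 hy.2.1 hy.2.2.1 hz.2.1 hz.2.2.1)
  tauto

/-- Expanding a vertex of degree two into a diamond turns a triangle or a necklace into a
necklace. -/
lemma expand {n : ℕ} {P : SimpleGraph (Fin n)} (ok : Brooks G S) (h : Dia G S a b c d)
    (f : Fin n → V) (hP : Big P) (i₀ : Fin n) (hi : Function.Injective f)
    (hS : ∀ i, i ≠ i₀ → f i ∈ S ∧ f i ≠ a ∧ f i ≠ b ∧ f i ≠ c ∧ f i ≠ d)
    (hadj : ∀ i j, i ≠ i₀ → j ≠ i₀ → P.Adj i j → G.Adj (f i) (f j))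
    (ht : ∀ i j, i ≠ j → P.Adj i₀ i → P.Adj i₀ j →
      (G.Adj c (f i) ∧ G.Adj d (f j)) ∨ (G.Adj d (f i) ∧ G.Adj c (f j)))
    (hd : ∀ [DecidableRel P.Adj], pdeg P i₀ ≤ 2) :
    ∃ (m : ℕ) (P' : SimpleGraph (Fin m)), Neck P' ∧ ∃ g : P' ↪g G, (∀ i, g i ∈ S) ∧
      {a, b, c, d} ⊆ img g := by
  have tipd : ∀ i j, i ≠ j → P.Adj i₀ i → P.Adj i₀ j → ∃ c' d', Dia G S a b c' d' ∧
      G.Adj c' (f i) ∧ G.Adj d' (f j) ∧ ({a, b, c', d'} : Finset V) = {a, b, c, d} ∧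
      ∀ i, i ≠ i₀ → f i ≠ c' ∧ f i ≠ d' := by
    intro i j hij h1 h2
    rcases ht i j hij h1 h2 with k | k
    · exact ⟨c, d, h, k.1, k.2, rfl, fun i hi => (hS i hi).2.2.2⟩
    · exact ⟨d, c, h.swap, k.1, k.2, by rw [Finset.pair_comm d c],
        fun i hi => (hS i hi).2.2.2.symm⟩
  -- In the necklaces used below every non-edge has an end of degree three, so `emb_full` makes the
  -- copy induced.
  have fin : ∀ {m : ℕ} (P' : SimpleGraph (Fin m)) [DecidableRel P'.Adj] (g : Fin m → V), Neck P' →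
      (∀ i j, i ≠ j → ¬ P'.Adj i j → pdeg P' i = 3 ∨ pdeg P' j = 3) → Function.Injective g →
      (∀ i, g i ∈ S) → (∀ i j, P'.Adj i j → G.Adj (g i) (g j)) → {a, b, c, d} ⊆ img g →
      ∃ (m : ℕ) (P' : SimpleGraph (Fin m)), Neck P' ∧ ∃ g : P' ↪g G, (∀ i, g i ∈ S) ∧
        {a, b, c, d} ⊆ img g := by
    intro m P' _ g hN h1 h2 h3 h4 h5
    obtain ⟨g', hg⟩ := emb_full P' ok h1 g h2 h3 h4
    refine ⟨m, P', hN, g', fun i => hg i ▸ h3 i, ?_⟩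
    rwa [show (g' : Fin m → V) = g from funext hg]
  have e' : ∀ i j, f i = f j ↔ i = j := fun i j => hi.eq_iff
  have hne := fun i hi => (hS i hi).2
  have hna : ∀ i, i ≠ i₀ → a ≠ f i := fun i hi => (hne i hi).1.symm
  have hnb : ∀ i, i ≠ i₀ → b ≠ f i := fun i hi => (hne i hi).2.1.symm
  cases hP with
  -- The three patterns on twelve vertices are cubic, so they have no vertex of degree at most two
  -- to expand.
  | td => exact absurd hd (by clear * -; revert i₀; decide)
  | neck hN =>
    cases hN with
    | d12 => exact absurd hd (by clear * -; revert i₀; decide)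
    | h12 => exact absurd hd (by clear * -; revert i₀; decide)
    | d6 =>
      have hi₀ : i₀ = 4 ∨ i₀ = 5 :=
        (by decide : ∀ i, pdeg diamondNecklace6 i ≤ 2 → i = 4 ∨ i = 5) i₀ hd
      rcases hi₀ with rfl | rfl
      · obtain ⟨c', d', h', k1, k2, k3, k4⟩ := tipd 3 5 (by decide) (by decide) (by decide)
        refine fin diamondNecklace9 ![f 0, f 1, f 2, f 3, a, b, c', d', f 5] .d9 (by decide) ?_ ?_ (hom_of_edges ?_) ?_
        · rw [← List.nodup_ofFn]
          simp [e', h'.ab.ne, h'.ac.ne, h'.ad.ne, h'.bc.ne, h'.bd.ne, h'.ne, hne, k4, hna, hnb,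
            fun i hi => (k4 i hi).1.symm, fun i hi => (k4 i hi).2.symm]
        · intro i; fin_cases i
          exacts [(hS 0 (by decide)).1, (hS 1 (by decide)).1, (hS 2 (by decide)).1, (hS 3 (by decide)).1, h'.ha, h'.hb, h'.hc, h'.hd, (hS 5 (by decide)).1]
        · simp only [List.mem_cons, List.not_mem_nil, or_false, forall_eq_or_imp, forall_eq]
          exact ⟨hadj 0 1 (by decide) (by decide) (by decide), hadj 0 2 (by decide) (by decide) (by decide), hadj 0 3 (by decide) (by decide) (by decide), hadj 1 2 (by decide) (by decide) (by decide), hadj 1 3 (by decide) (by decide) (by decide), h'.ab, h'.ac, h'.ad, h'.bc, h'.bd, k1.symm, k2, hadj 5 2 (by decide) (by decide) (by decide)⟩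
        · rw [← k3]
          intro x
          simp only [Finset.mem_insert, Finset.mem_singleton, mem_img]
          rintro (rfl | rfl | rfl | rfl)
          exacts [⟨4, rfl⟩, ⟨5, rfl⟩, ⟨6, rfl⟩, ⟨7, rfl⟩]
      · obtain ⟨c', d', h', k1, k2, k3, k4⟩ := tipd 2 4 (by decide) (by decide) (by decide)
        refine fin diamondNecklace9 ![f 0, f 1, f 3, f 2, a, b, c', d', f 4] .d9 (by decide) ?_ ?_ (hom_of_edges ?_) ?_
        · rw [← List.nodup_ofFn]
          simp [e', h'.ab.ne, h'.ac.ne, h'.ad.ne, h'.bc.ne, h'.bd.ne, h'.ne, hne, k4, hna, hnb,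
            fun i hi => (k4 i hi).1.symm, fun i hi => (k4 i hi).2.symm]
        · intro i; fin_cases i
          exacts [(hS 0 (by decide)).1, (hS 1 (by decide)).1, (hS 3 (by decide)).1, (hS 2 (by decide)).1, h'.ha, h'.hb, h'.hc, h'.hd, (hS 4 (by decide)).1]
        · simp only [List.mem_cons, List.not_mem_nil, or_false, forall_eq_or_imp, forall_eq]
          exact ⟨hadj 0 1 (by decide) (by decide) (by decide), hadj 0 3 (by decide) (by decide) (by decide), hadj 0 2 (by decide) (by decide) (by decide), hadj 1 3 (by decide) (by decide) (by decide), hadj 1 2 (by decide) (by decide) (by decide), h'.ab, h'.ac, h'.ad, h'.bc, h'.bd, k1.symm, k2, hadj 4 3 (by decide) (by decide) (by decide)⟩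
        · rw [← k3]
          intro x
          simp only [Finset.mem_insert, Finset.mem_singleton, mem_img]
          rintro (rfl | rfl | rfl | rfl)
          exacts [⟨4, rfl⟩, ⟨5, rfl⟩, ⟨6, rfl⟩, ⟨7, rfl⟩]
    | d9 =>
        obtain rfl : i₀ = 8 := (by decide : ∀ i, pdeg diamondNecklace9 i ≤ 2 → i = 8) i₀ hd
        obtain ⟨c', d', h', k1, k2, k3, k4⟩ := tipd 7 2 (by decide) (by decide) (by decide)
        refine fin diamondNecklace12 ![f 0, f 1, f 2, f 3, f 4, f 5, f 6, f 7, a, b, c', d'] .d12 (by decide) ?_ ?_ (hom_of_edges ?_) ?_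
        · rw [← List.nodup_ofFn]
          simp [e', h'.ab.ne, h'.ac.ne, h'.ad.ne, h'.bc.ne, h'.bd.ne, h'.ne, hne, k4]
        · intro i; fin_cases i
          exacts [(hS 0 (by decide)).1, (hS 1 (by decide)).1, (hS 2 (by decide)).1, (hS 3 (by decide)).1, (hS 4 (by decide)).1, (hS 5 (by decide)).1, (hS 6 (by decide)).1, (hS 7 (by decide)).1, h'.ha, h'.hb, h'.hc, h'.hd]
        · simp only [List.mem_cons, List.not_mem_nil, or_false, forall_eq_or_imp, forall_eq]
          exact ⟨hadj 0 1 (by decide) (by decide) (by decide), hadj 0 2 (by decide) (by decide) (by decide), hadj 0 3 (by decide) (by decide) (by decide), hadj 1 2 (by decide) (by decide) (by decide), hadj 1 3 (by decide) (by decide) (by decide), hadj 4 5 (by decide) (by decide) (by decide), hadj 4 6 (by decide) (by decide) (by decide), hadj 4 7 (by decide) (by decide) (by decide), hadj 5 6 (by decide) (by decide) (by decide), hadj 5 7 (by decide) (by decide) (by decide), h'.ab, h'.ac, h'.ad, h'.bc, h'.bd, hadj 3 6 (by decide) (by decide) (by decide), k1.symm, k2⟩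
        · rw [← k3]
          intro x
          simp only [Finset.mem_insert, Finset.mem_singleton, mem_img]
          rintro (rfl | rfl | rfl | rfl)
          exacts [⟨8, rfl⟩, ⟨9, rfl⟩, ⟨10, rfl⟩, ⟨11, rfl⟩]
    | h9 =>
        obtain rfl : i₀ = 8 := (by decide : ∀ i, pdeg havelNecklace9 i ≤ 2 → i = 8) i₀ hd
        obtain ⟨c', d', h', k1, k2, k3, k4⟩ := tipd 6 7 (by decide) (by decide) (by decide)
        refine fin havelNecklace12 ![f 0, f 1, f 2, f 3, f 4, f 5, f 6, f 7, a, b, c', d'] .h12 (by decide) ?_ ?_ (hom_of_edges ?_) ?_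
        · rw [← List.nodup_ofFn]
          simp [e', h'.ab.ne, h'.ac.ne, h'.ad.ne, h'.bc.ne, h'.bd.ne, h'.ne, hne, k4]
        · intro i; fin_cases i
          exacts [(hS 0 (by decide)).1, (hS 1 (by decide)).1, (hS 2 (by decide)).1, (hS 3 (by decide)).1, (hS 4 (by decide)).1, (hS 5 (by decide)).1, (hS 6 (by decide)).1, (hS 7 (by decide)).1, h'.ha, h'.hb, h'.hc, h'.hd]
        · simp only [List.mem_cons, List.not_mem_nil, or_false, forall_eq_or_imp, forall_eq]
          exact ⟨hadj 0 1 (by decide) (by decide) (by decide), hadj 0 2 (by decide) (by decide) (by decide), hadj 1 2 (by decide) (by decide) (by decide), hadj 3 4 (by decide) (by decide) (by decide), hadj 3 5 (by decide) (by decide) (by decide), hadj 4 5 (by decide) (by decide) (by decide), hadj 0 3 (by decide) (by decide) (by decide), hadj 1 6 (by decide) (by decide) (by decide), hadj 6 4 (by decide) (by decide) (by decide), hadj 2 7 (by decide) (by decide) (by decide), hadj 7 5 (by decide) (by decide) (by decide), h'.ab, h'.ac, h'.ad, h'.bc, h'.bd, k1.symm, k2.symm⟩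
        · rw [← k3]
          intro x
          simp only [Finset.mem_insert, Finset.mem_singleton, mem_img]
          rintro (rfl | rfl | rfl | rfl)
          exacts [⟨8, rfl⟩, ⟨9, rfl⟩, ⟨10, rfl⟩, ⟨11, rfl⟩]

/-- Expanding a vertex of a triangle into a diamond gives a necklace. -/
lemma expand_tri (ok : Brooks G S) (h : Dia G S a b c d) (hy : y ∈ S \ {a, b, c})
    (hz : z ∈ S \ {a, b, c}) (hyd : y ≠ d) (hzd : z ≠ d) (hyz : G.Adj y z) (hcy : G.Adj c y)
    (hdz : G.Adj d z) : ∃ g : diamondNecklace6 ↪g G, (∀ i, g i ∈ S) ∧ {a, b, c, d} ⊆ img g := by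
  simp only [Finset.mem_sdiff, Finset.mem_insert, Finset.mem_singleton, not_or] at hy hz
  have hS : ∀ i, ![a, b, c, d, z, y] i ∈ S := by
    intro i; fin_cases i
    exacts [h.ha, h.hb, h.hc, h.hd, hz.1, hy.1]
  obtain ⟨g, hg⟩ := emb_full diamondNecklace6 ok (by decide) ![a, b, c, d, z, y]
    (by
      rw [← List.nodup_ofFn]
      simp [h.ab.ne, h.ac.ne, h.ad.ne, h.bc.ne, h.bd.ne, h.ne, Ne.symm hz.2.1, Ne.symm hz.2.2.1,
        Ne.symm hz.2.2.2, hzd.symm, Ne.symm hy.2.1, Ne.symm hy.2.2.1, Ne.symm hy.2.2.2, hyd.symm, hyz.ne.symm])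
    hS
    (hom_of_edges (by
      simp only [List.mem_cons, List.not_mem_nil, or_false, forall_eq_or_imp, forall_eq]
      exact ⟨h.ab, h.ac, h.ad, h.bc, h.bd, hdz, hyz.symm, hcy.symm⟩))
  refine ⟨g, fun i => hg i ▸ hS i, ?_⟩
  intro x
  simp only [Finset.mem_insert, Finset.mem_singleton, mem_img, hg]
  rintro (rfl | rfl | rfl | rfl)
  exacts [⟨0, rfl⟩, ⟨1, rfl⟩, ⟨2, rfl⟩, ⟨3, rfl⟩]

end Dia
end ThreeTight

/-! ### A minimal counterexample has no free diamond -/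

namespace ThreeTight
open scoped Classical

variable {V : Type*} {G : SimpleGraph V} {A B C D S S' T X I J R Q : Finset V}
  {a b c d u v w x y z p q : V}

namespace MinG

/-- Contract a free diamond into its tip `d`. By freeness no 3-tight subgraph of the new graph
contains `d`, as it would expand to a necklace through the diamond. So `d` is a new 3-free vertex,
which replaces the lost diamond in the count, while three vertices are exchanged for one independent
vertex. -/
lemma no_fdiam (h : MinG G S) : fdiams G S = ∅ := by
  rw [Finset.eq_empty_iff_forall_notMem]
  intro D hD
  have hDmem := hD
  rw [fdiams, Finset.mem_filter, Finset.mem_powerset] at hD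
  obtain ⟨hDS, ⟨f₀, rfl⟩, hfree⟩ := hD
  have dia := dia_of_emb f₀ hDS
  have himg : img f₀ = {f₀ 0, f₀ 1, f₀ 2, f₀ 3} := by
    ext x
    simp only [mem_img, Fin.exists_fin_succ, Finset.mem_insert, Finset.mem_singleton]
    simp [eq_comm]
  obtain ⟨a, ha⟩ : ∃ a, f₀ 0 = a := ⟨_, rfl⟩
  obtain ⟨b, hb⟩ : ∃ a, f₀ 1 = a := ⟨_, rfl⟩
  obtain ⟨c, hc⟩ : ∃ a, f₀ 2 = a := ⟨_, rfl⟩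
  obtain ⟨d, hd⟩ : ∃ a, f₀ 3 = a := ⟨_, rfl⟩
  rw [ha, hb, hc, hd] at dia himg
  rw [himg] at hfree hDmem
  have ok := h.ok
  have hsub : S \ {a, b, c} ⊆ S := Finset.sdiff_subset
  have habc : ({a, b, c} : Finset V) ⊆ S := by
    intro x; simp only [Finset.mem_insert, Finset.mem_singleton]
    rintro (rfl | rfl | rfl)
    exacts [dia.ha, dia.hb, dia.hc]
  have hdS : d ∈ S \ {a, b, c} := by
    simp [dia.hd, dia.ad.ne.symm, dia.bd.ne.symm, dia.ne.symm]
  have hcard : (S \ {a, b, c}).card + 3 = S.card := by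
    rw [← Finset.card_sdiff_add_card_eq_card habc,
      Finset.card_insert_of_notMem (by simp [dia.ab.ne, dia.ac.ne]), Finset.card_pair dia.bc.ne]
  have hnb2 := dia.ctr_nb ok
  have hok : Brooks (Dia.ctr G S a b c d) (S \ {a, b, c}) := by
    refine ok_addStar ok hsub (le_trans hnb2 (by norm_num)) ?_ ?_
    · intro q hq _
      exact ⟨c, by simp [dia.hc], (mem_nb.1 hq).2⟩
    · intro u hu v hv w hw pu pv pw uv vw uw
      have hs : ({u, v, w} : Finset V) ⊆ nb (Dia.ctr G S a b c d) (S \ {a, b, c}) d := by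
        intro x; simp only [Finset.mem_insert, Finset.mem_singleton]
        rintro (rfl | rfl | rfl)
        exacts [mem_nb.2 ⟨hu, pu⟩, mem_nb.2 ⟨hv, pv⟩, mem_nb.2 ⟨hw, pw⟩]
      have := Finset.card_le_card hs
      rw [Finset.card_insert_of_notMem (by simp [uv.ne, uw.ne]), Finset.card_pair vw.ne] at this
      omega
  have ntri : ¬ InTri (Dia.ctr G S a b c d) (S \ {a, b, c}) d := by
    rintro ⟨s, hs, t, ht, ds, dt, st⟩
    have st' := (addStar_adj_off ds.ne.symm dt.ne.symm).1 st
    rcases dia.tips ok hs ht ds.ne.symm dt.ne.symm st.ne ds dt with k | k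
    · obtain ⟨g, hg, hg'⟩ := dia.expand_tri ok hs ht ds.ne.symm dt.ne.symm st' k.1 k.2
      exact hfree _ _ .d6 g hg hg'
    · obtain ⟨g, hg, hg'⟩ := dia.expand_tri ok ht hs dt.ne.symm ds.ne.symm st'.symm k.2 k.1
      exact hfree _ _ .d6 g hg hg'
  have nbig : ¬ InBig (Dia.ctr G S a b c d) (S \ {a, b, c}) d := by
    rintro ⟨n, P, hP, f, hf, i₀, hi₀⟩
    have fd : ∀ i, i ≠ i₀ → f i ≠ d := fun i hi e => hi (f.injective (e.trans hi₀.symm))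
    obtain ⟨m, P', hP', g, hg, hg'⟩ := Dia.expand ok dia f hP i₀ f.injective
      (by
        intro i hi
        have := hf i
        simp only [Finset.mem_sdiff, Finset.mem_insert, Finset.mem_singleton, not_or] at this
        exact ⟨this.1, this.2.1, this.2.2.1, this.2.2.2, fd i hi⟩)
      (fun i j hi hj hij => (addStar_adj_off (fd i hi) (fd j hj)).1 (f.map_adj_iff.2 hij))
      (by
        intro i j hij h1 h2
        have e1 := f.map_adj_iff.2 h1
        have e2 := f.map_adj_iff.2 h2
        rw [hi₀] at e1 e2
        exact dia.tips ok (hf i) (hf j) e1.ne.symm e2.ne.symm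
          (fun e => hij (f.injective e)) e1 e2)
      (by
        intro _
        rw [← card_nb_img P f, hi₀]
        exact (nb_card_mono (img_subset.2 hf)).trans hnb2)
    exact hfree m P' hP' g hg hg'
  have hdf : d ∉ frees G S := fun k =>
    (mem_frees.1 k).2.1 ⟨a, dia.ha, b, dia.hb, dia.ad.symm, dia.bd.symm, dia.ab⟩
  have hdf' : d ∈ frees (Dia.ctr G S a b c d) (S \ {a, b, c}) := mem_frees.2 ⟨hdS, ntri, nbig⟩
  -- A 3-tight subgraph of the new graph that is not one of `G` contains `d`, and no such subgraph
  -- exists.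
  have hfr : frees G S ⊆ (frees (Dia.ctr G S a b c d) (S \ {a, b, c})).erase d := by
    intro u hu
    have hud : u ≠ d := fun e => hdf (e ▸ hu)
    obtain ⟨huS, hut, hub⟩ := mem_frees.1 hu
    have huS' : u ∈ S \ {a, b, c} := by
      simp only [Finset.mem_sdiff, Finset.mem_insert, Finset.mem_singleton, not_or]
      refine ⟨huS, ?_, ?_, ?_⟩
      · rintro rfl; exact hut ⟨b, dia.hb, c, dia.hc, dia.ab, dia.ac, dia.bc⟩
      · rintro rfl; exact hut ⟨a, dia.ha, c, dia.hc, dia.ab.symm, dia.bc, dia.ac⟩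
      · rintro rfl; exact hut ⟨a, dia.ha, b, dia.hb, dia.ac.symm, dia.bc.symm, dia.ab⟩
    rw [Finset.mem_erase, mem_frees]
    refine ⟨hud, huS', ?_, ?_⟩
    · rintro ⟨s, hs, t, ht, us, ut, st⟩
      by_cases hsd : s = d
      · subst hsd; exact ntri ⟨u, huS',
          t, ht, us.symm, st, ut⟩
      by_cases htd : t = d
      · subst htd; exact ntri ⟨u, huS',
          s, hs, ut.symm, st.symm, us⟩
      exact hut ⟨s, hsub hs, t, hsub ht, (addStar_adj_off hud hsd).1 us,
        (addStar_adj_off hud htd).1 ut, (addStar_adj_off hsd htd).1 st⟩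
    · rintro ⟨n, P, hP, f, hf, i, hi⟩
      by_cases hd' : ∃ j, f j = d
      · exact nbig ⟨n, P, hP, f, hf, hd'⟩
      · push Not at hd'
        obtain ⟨g, hg⟩ := emb_off f hd'
        exact hub ⟨n, P, hP, g, fun i => hg i ▸ hsub (hf i), i, (hg i).trans hi⟩
  have hfd : (fdiams G S).erase {a, b, c, d} ⊆
      fdiams (Dia.ctr G S a b c d) (S \ {a, b, c}) := by
    intro D' hD'
    rw [Finset.mem_erase, fdiams, Finset.mem_filter, Finset.mem_powerset] at hD'
    obtain ⟨hne, hD'S, ⟨f, rfl⟩, hfree'⟩ := hD'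
    have dia' := dia_of_emb f hD'S
    have himg' : img f = {f 0, f 1, f 2, f 3} := by
      ext x
      simp only [mem_img, Fin.exists_fin_succ, Finset.mem_insert, Finset.mem_singleton]
      simp [eq_comm]
    -- If the two diamonds met, `f 0` and then all of the second diamond would lie in `{a, b, c,
    -- d}`, since triangles cannot leave a diamond.
    have hin : ∀ x ∈ img f, x ∉ ({a, b, c, d} : Finset V) := by
      have t := fun {u v w} => @Dia.tri_mem V G S a b c d u v w dia ok
      have t' : ∀ {u v w}, v ∈ S → w ∈ S → G.Adj u v → G.Adj u w → G.Adj v w →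
          u = a ∨ u = b ∨ u = c ∨ u = d → (v = a ∨ v = b ∨ v = c ∨ v = d) ∧
            (w = a ∨ w = b ∨ w = c ∨ w = d) := fun h1 h2 h3 h4 h5 h6 =>
        ⟨t h6 h1 h2 h3 h4 h5, t h6 h2 h1 h4 h3 h5.symm⟩
      have all : ∀ x ∈ img f, x ∈ ({a, b, c, d} : Finset V) →
          (f 0 = a ∨ f 0 = b ∨ f 0 = c ∨ f 0 = d) := by
        intro x hx
        rw [himg'] at hx
        simp only [Finset.mem_insert, Finset.mem_singleton] at hx ⊢
        rcases hx with rfl | rfl | rfl | rfl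
        · exact id
        · exact fun k => (t' dia'.ha dia'.hc dia'.ab.symm dia'.bc dia'.ac k).1
        · exact fun k => (t' dia'.ha dia'.hb dia'.ac.symm dia'.bc.symm dia'.ab k).1
        · exact fun k => (t' dia'.ha dia'.hb dia'.ad.symm dia'.bd.symm dia'.ab k).1
      intro x hx hx'
      have h0 := all x hx hx'
      have h12 := t' dia'.hb dia'.hc dia'.ab dia'.ac dia'.bc h0
      have h13 := t' dia'.hb dia'.hd dia'.ab dia'.ad dia'.bd h0
      refine hne (Finset.eq_of_subset_of_card_le ?_ ?_)
      · rw [himg']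
        intro y
        simp only [Finset.mem_insert, Finset.mem_singleton]
        rintro (rfl | rfl | rfl | rfl)
        exacts [h0, h12.1, h12.2, h13.2]
      · rw [img_card f.injective]
        exact Finset.card_le_four
    have hin' : ∀ i, f i ∉ ({a, b, c, d} : Finset V) := fun i => hin _ (by simp)
    simp only [Finset.mem_insert, Finset.mem_singleton, not_or] at hin'
    rw [fdiams, Finset.mem_filter, Finset.mem_powerset]
    refine ⟨?_, ?_, ?_⟩
    · rw [img_subset] at hD'S ⊢
      intro i
      simp only [Finset.mem_sdiff, Finset.mem_insert, Finset.mem_singleton, not_or]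
      exact ⟨hD'S i, (hin' i).1, (hin' i).2.1, (hin' i).2.2.1⟩
    · obtain ⟨g, hg⟩ := emb_off' (Q := nb G (S \ {a, b, c}) c) f fun i => (hin' i).2.2.2
      exact ⟨g, congrArg img (funext hg)⟩
    · intro n P hP g hg hsubg
      by_cases hd' : ∃ j, g j = d
      · exact nbig ⟨n, P, .neck hP, g, hg, hd'⟩
      · push Not at hd'
        obtain ⟨g', hg'⟩ := emb_off g hd'
        refine hfree' n P hP g' (fun i => hg' i ▸ hsub (hg i)) ?_
        rwa [show (g' : Fin n → V) = g from funext hg']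
  obtain ⟨I, hI, hi, hc'⟩ := h.ih _ _ (by omega) hok
  have c1 := Finset.card_le_card hfr
  have c2 := Finset.card_le_card hfd
  rw [Finset.card_erase_of_mem hdf'] at c1
  rw [Finset.card_erase_of_mem hDmem] at c2
  have hpos := Finset.card_pos.2 ⟨d, hdf'⟩
  have hiG : Indep G I := fun u hu v hv huv => hi u hu v hv (le_addStar huv)
  have fin : ∀ t ∈ S, t ∉ I → (∀ s ∈ I, ¬ G.Adj t s) → False := by
    intro t ht htI hta
    refine h.fail ⟨insert t I, Finset.insert_subset ht (hI.trans hsub), ?_, ?_⟩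
    · intro u hu v hv huv
      rcases Finset.mem_insert.1 hu with h1 | h1 <;> rcases Finset.mem_insert.1 hv with h2 | h2
      · subst h1 h2; exact G.irrefl huv
      · subst h1; exact hta _ h2 huv
      · subst h2; exact hta _ h1 huv.symm
      · exact hiG u h1 v h2 huv
    · rw [Finset.card_insert_of_notMem htI]; omega
  have hIabc : ∀ s ∈ I, s ≠ a ∧ s ≠ b ∧ s ≠ c := by
    intro s hs
    have := hI hs
    simp only [Finset.mem_sdiff, Finset.mem_insert, Finset.mem_singleton, not_or] at this
    exact this.2
  -- If `d` is chosen, the other tip can be added, because its outside neighbour is adjacent to `d`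
  -- in the contracted graph. If not, `a` can be added.
  by_cases hdI : d ∈ I
  · refine fin c dia.hc (fun k => (hIabc c k).2.2 rfl) fun s hs hcs => ?_
    by_cases hsd : s = d
    · subst hsd; exact dia.cd hcs
    · exact hi d hdI s hs (addStar_adj.2 (Or.inr ⟨fun e => hsd e.symm,
        Or.inl ⟨rfl, mem_nb.2 ⟨hI hs, hcs⟩⟩⟩))
  · refine fin a dia.ha (fun k => (hIabc a k).1 rfl) fun s hs has => ?_
    rcases dia.mem_a ok (hsub (hI hs)) has with rfl | rfl | rfl
    · exact (hIabc s hs).2.1 rfl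
    · exact (hIabc s hs).2.2 rfl
    · exact hdI hs

end MinG
end ThreeTight

/-! ### Reductions by deletion and by added edges -/

namespace ThreeTight
open scoped Classical

variable {V : Type*} {G : SimpleGraph V} {A B C D S S' T X I J R Q : Finset V}
  {a b c d u v w x y z p q : V} {n k : ℕ} {P : SimpleGraph (Fin n)}

lemma pdeg_congr {h h' : DecidableRel P.Adj} {i : Fin n} {m : ℕ} (e : @pdeg n P h i = m) :
    @pdeg n P h' i = m := by
  rwa [Subsingleton.elim h' h]

/-- Each of the larger 3-tight graphs has an independent set of a third of its vertices, all of
degree three. -/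
lemma Big.exists_indep (h : Big P) : 0 < n ∧ ∃ J : Finset (Fin n), 3 * J.card = n ∧
    (∀ i ∈ J, ∀ j ∈ J, ¬ P.Adj i j) ∧ ∀ i ∈ J, pdeg P i = 3 := by
  cases h with
  | td => exact ⟨by norm_num, {0, 2, 4, 9}, by decide, by decide, fun i hi => pdeg_congr
      ((by decide : ∀ i ∈ ({0, 2, 4, 9} : Finset (Fin 12)), pdeg _ i = 3) i hi)⟩
  | neck h =>
    cases h with
    | d6 => exact ⟨by norm_num, {2, 3}, by decide, by decide, fun i hi => pdeg_congr
      ((by decide : ∀ i ∈ ({2, 3} : Finset (Fin 6)), pdeg _ i = 3) i hi)⟩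
    | d9 => exact ⟨by norm_num, {2, 3, 7}, by decide, by decide, fun i hi => pdeg_congr
      ((by decide : ∀ i ∈ ({2, 3, 7} : Finset (Fin 9)), pdeg _ i = 3) i hi)⟩
    | d12 => exact ⟨by norm_num, {2, 3, 7, 8}, by decide, by decide, fun i hi => pdeg_congr
      ((by decide : ∀ i ∈ ({2, 3, 7, 8} : Finset (Fin 12)), pdeg _ i = 3) i hi)⟩
    | h9 => exact ⟨by norm_num, {0, 5, 6}, by decide, by decide, fun i hi => pdeg_congr
      ((by decide : ∀ i ∈ ({0, 5, 6} : Finset (Fin 9)), pdeg _ i = 3) i hi)⟩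
    | h12 => exact ⟨by norm_num, {0, 5, 6, 8}, by decide, by decide, fun i hi => pdeg_congr
      ((by decide : ∀ i ∈ ({0, 5, 6, 8} : Finset (Fin 12)), pdeg _ i = 3) i hi)⟩

/-- Each of the larger 3-tight graphs has at most nine vertices, or has twelve vertices and
a triangle avoiding any given vertex. -/
lemma Big.exists_tri (h : Big P) : n ≤ 9 ∨ n = 12 ∧ ∀ i₀, ∃ i j l, i ≠ i₀ ∧ j ≠ i₀ ∧ l ≠ i₀ ∧
    P.Adj i j ∧ P.Adj i l ∧ P.Adj j l := by
  have key : ∀ {n : ℕ} {P : SimpleGraph (Fin n)} (i j l i' j' l' : Fin n), P.Adj i j → P.Adj i l →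
      P.Adj j l → P.Adj i' j' → P.Adj i' l' → P.Adj j' l' →
      (i ≠ i' ∧ i ≠ j' ∧ i ≠ l') → (j ≠ i' ∧ j ≠ j' ∧ j ≠ l') → (l ≠ i' ∧ l ≠ j' ∧ l ≠ l') →
      ∀ i₀, ∃ i j l, i ≠ i₀ ∧ j ≠ i₀ ∧ l ≠ i₀ ∧ P.Adj i j ∧ P.Adj i l ∧ P.Adj j l := by
    intro n P i j l i' j' l' h1 h2 h3 h4 h5 h6 h7 h8 h9 i₀
    by_cases h : i ≠ i₀ ∧ j ≠ i₀ ∧ l ≠ i₀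
    · exact ⟨i, j, l, h.1, h.2.1, h.2.2, h1, h2, h3⟩
    · refine ⟨i', j', l', ?_, ?_, ?_, h4, h5, h6⟩ <;> rintro rfl <;> tauto
  cases h with
  | td =>
    right
    exact ⟨rfl, key 6 7 8 9 10 11 (by decide) (by decide) (by decide) (by decide) (by decide)
      (by decide) (by decide) (by decide) (by decide)⟩
  | neck h =>
    cases h with
    | d6 => left; norm_num
    | d9 => left; norm_num
    | h9 => left; norm_num
    | d12 =>
      right
      exact ⟨rfl, key 0 1 2 4 5 6 (by decide) (by decide) (by decide) (by decide) (by decide)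
        (by decide) (by decide) (by decide) (by decide)⟩
    | h12 =>
      right
      exact ⟨rfl, key 0 1 2 3 4 5 (by decide) (by decide) (by decide) (by decide) (by decide)
        (by decide) (by decide) (by decide) (by decide)⟩

lemma frees_inter_subset (h : T ⊆ S) : frees G S ∩ T ⊆ frees G T := by
  intro v hv
  rw [Finset.mem_inter, mem_frees] at hv
  exact mem_frees.2 ⟨hv.2, fun k => hv.1.2.1 (k.mono h), fun k => hv.1.2.2 (k.mono h)⟩

lemma card_frees_split :
    (frees G S).card = (frees G S ∩ X).card + (frees G S ∩ (S \ X)).card := by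
  rw [← Finset.card_union_of_disjoint]
  · congr 1
    ext v
    have : v ∈ frees G S → v ∈ S := fun k => (mem_frees.1 k).1
    simp only [Finset.mem_union, Finset.mem_inter, Finset.mem_sdiff]
    tauto
  · rw [Finset.disjoint_left]
    intro v hv hv'
    rw [Finset.mem_inter] at hv hv'
    exact (Finset.mem_sdiff.1 hv'.2).2 hv.2

namespace MinG

lemma not_good (h : MinG G S) (hI : I ⊆ S) (hi : Indep G I) :
    42 * I.card < 14 * S.card + (frees G S).card := by
  by_contra hlt
  refine h.fail ⟨I, hI, hi, ?_⟩
  rw [h.no_fdiam, Finset.card_empty]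
  omega

/-- Minimality of `G[S]`, for a smaller graph whose independent sets extend by `k` vertices. -/
lemma reduce (h : MinG G S) (hX : X ⊆ S) (hne : X.Nonempty) (G' : SimpleGraph V)
    (hG' : Brooks G' (S \ X)) (ext : ∀ I ⊆ S \ X, Indep G' I → ∃ I' ⊆ S, Indep G I' ∧
      I.card + k ≤ I'.card) :
    42 * k + (frees G' (S \ X)).card < 14 * X.card + (frees G S).card := by
  have hpos := hne.card_pos
  have hc := Finset.card_sdiff_add_card_eq_card hX
  obtain ⟨I, hI, hi, hle⟩ := h.ih G' (S \ X) (by omega) hG'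
  obtain ⟨I', hI', hi', hle'⟩ := ext I hI hi
  have := h.not_good hI' hi'
  omega

lemma extend (hX : X ⊆ S) (hJ : J ⊆ S \ X) (hj : Indep G J) (hI : I ⊆ X) (hi : Indep G I)
    (hn : ∀ u ∈ I, ∀ v ∈ J, ¬ G.Adj u v) :
    ∃ I' ⊆ S, Indep G I' ∧ J.card + I.card ≤ I'.card := by
  refine ⟨J ∪ I, Finset.union_subset (hJ.trans Finset.sdiff_subset) (hI.trans hX),
    hj.union hi fun u hu v hv huv => hn v hv u hu huv.symm, ?_⟩
  rw [Finset.card_union_of_disjoint]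
  exact Finset.disjoint_of_subset_left hJ
    (Finset.disjoint_of_subset_right hI Finset.sdiff_disjoint)

lemma deletion (h : MinG G S) (hX : X ⊆ S) (hne : X.Nonempty) (hI : I ⊆ X) (hi : Indep G I)
    (hn : ∀ u ∈ I, nb G S u ⊆ X) : 42 * I.card < 14 * X.card + (frees G S ∩ X).card := by
  have h1 := h.reduce (k := I.card) hX hne G (h.ok.mono Finset.sdiff_subset)
    fun J hJ hj => extend hX hJ hj hI hi fun u hu v hv huv => by
      have hvS := Finset.mem_sdiff.1 (hJ hv)
      exact hvS.2 (hn u hu (mem_nb.2 ⟨hvS.1, huv⟩))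
  have h2 := card_frees_split (G := G) (S := S) (X := X)
  have h3 := Finset.card_le_card (frees_inter_subset (G := G) (Finset.sdiff_subset (s := S) (t := X)))
  omega

/-- The copy contains no 3-free vertex, and an independent third of it already has full degree
inside the copy, so deletion loses nothing. -/
lemma no_big (h : MinG G S) (hP : Big P) (f : P ↪g G) (hf : ∀ i, f i ∈ S) : False := by
  obtain ⟨hn, J, hJ, hJi, hJd⟩ := hP.exists_indep
  have h1 := h.deletion (X := img f) (I := J.image f) (img_subset.2 hf) ⟨f ⟨0, hn⟩, by simp⟩
    (by
      intro x hx
      obtain ⟨i, -, rfl⟩ := Finset.mem_image.1 hx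
      simp)
    (by
      intro a ha b hb
      obtain ⟨i, hi, rfl⟩ := Finset.mem_image.1 ha
      obtain ⟨j, hj, rfl⟩ := Finset.mem_image.1 hb
      rw [f.map_adj_iff]; exact hJi i hi j hj)
    (by
      intro a ha
      obtain ⟨i, hi, rfl⟩ := Finset.mem_image.1 ha
      rw [nb_img_of_full P f hf i (by rw [hJd i hi]; exact h.ok.deg _ (hf i))]
      exact nb_subset)
  have h2 : frees G S ∩ img f = ∅ := by
    rw [Finset.eq_empty_iff_forall_notMem]
    intro v hv
    rw [Finset.mem_inter, mem_frees, mem_img] at hv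
    exact hv.1.2.2 ⟨n, P, hP, f, hf, hv.2⟩
  rw [h2, Finset.card_image_of_injective _ f.injective, img_card f.injective] at h1
  simp at h1
  omega

/-- Without necklaces every diamond is free, and there are no free diamonds. -/
lemma no_dia (h : MinG G S) (ha : a ∈ S) (hb : b ∈ S) (hc : c ∈ S) (hd : d ∈ S)
    (ab : G.Adj a b) (ac : G.Adj a c) (ad : G.Adj a d) (bc : G.Adj b c) (bd : G.Adj b d)
    (hne : c ≠ d) : False := by
  have dia : Dia G S a b c d :=
    ⟨ha, hb, hc, hd, ab, ac, ad, bc, bd, h.ok.k4 a ha b hb c hc d hd ab ac ad bc bd, hne⟩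
  obtain ⟨f, hf⟩ := dia.exists_emb
  have h1 : img f ∉ fdiams G S := by simp [h.no_fdiam]
  refine h1 ?_
  rw [fdiams, Finset.mem_filter, Finset.mem_powerset]
  refine ⟨?_, ⟨f, rfl⟩, fun n P hP g hg _ => h.no_big (.neck hP) g hg⟩
  rw [hf]
  intro x; simp only [Finset.mem_insert, Finset.mem_singleton]
  rintro (rfl | rfl | rfl | rfl)
  exacts [ha, hb, hc, hd]

lemma not_inTri_of_frees (hv : v ∈ frees G S) (ha : a ∈ S) (hb : b ∈ S) (va : G.Adj v a)
    (vb : G.Adj v b) (ab : G.Adj a b) : False :=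
  (mem_frees.1 hv).2.1 ⟨a, ha, b, hb, va, vb, ab⟩

/-- A 3-free vertex that is no longer 3-free after adding edges at `p` lies in a triangle or in
a larger 3-tight subgraph through `p`. -/
lemma lost (hv : v ∈ frees G S) (hT : T ⊆ S) (hvT : v ∈ T)
    (hv' : v ∉ frees (addStar G p Q) T) :
    (∃ n, ∃ P : SimpleGraph (Fin n), Big P ∧ ∃ f : P ↪g addStar G p Q, (∀ i, f i ∈ T) ∧
      ∃ i, f i = p) ∨
    ∃ s ∈ T, ∃ t ∈ T, (addStar G p Q).Adj p s ∧ (addStar G p Q).Adj p t ∧ G.Adj s t ∧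
      (v = p ∨ v = s) ∧ ¬ (G.Adj p s ∧ G.Adj p t) := by
  rw [mem_frees] at hv hv'
  obtain ⟨hvS, hvt, hvb⟩ := hv
  by_cases hb : InBig (addStar G p Q) T v
  · obtain ⟨n, P, hP, f, hf, i, hi⟩ := hb
    left
    by_cases hd' : ∃ j, f j = p
    · exact ⟨n, P, hP, f, hf, hd'⟩
    · push Not at hd'
      obtain ⟨g, hg⟩ := emb_off f hd'
      exact absurd ⟨n, P, hP, g, fun i => hg i ▸ hT (hf i), i, (hg i).trans hi⟩ hvb
  · right
    have ht : InTri (addStar G p Q) T v := by tauto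
    obtain ⟨s, hs, t, ht, vs, vt, st⟩ := ht
    by_cases hvp : v = p
    · subst hvp
      have st' := (addStar_adj_off vs.ne.symm vt.ne.symm).1 st
      exact ⟨s, hs, t, ht, vs, vt, st', Or.inl rfl, fun k => hvt ⟨s, hT hs, t, hT ht, k.1, k.2, st'⟩⟩
    by_cases hsp : s = p
    · subst hsp
      have vt' := (addStar_adj_off hvp st.ne.symm).1 vt
      exact ⟨v, hvT, t, ht, vs.symm, st, vt', Or.inr rfl,
        fun k => hvt ⟨s, hT hs, t, hT ht, k.1.symm, vt', k.2⟩⟩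
    by_cases htp : t = p
    · subst htp
      have vs' := (addStar_adj_off hvp hsp).1 vs
      exact ⟨v, hvT, s, hs, vt.symm, st.symm, vs', Or.inr rfl,
        fun k => hvt ⟨s, hT hs, t, hT ht, vs', k.1.symm, k.2.symm⟩⟩
    exact absurd ⟨s, hT hs, t, hT ht, (addStar_adj_off hvp hsp).1 vs, (addStar_adj_off hvp htp).1 vt,
      (addStar_adj_off hsp htp).1 st⟩ hvt

lemma reduce_star_tight (h : MinG G S) (hX : X ⊆ S) (hne : X.Nonempty)
    (hG' : Brooks (addStar G p Q) (S \ X))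
    (ext : ∀ I ⊆ S \ X, Indep (addStar G p Q) I → ∃ I' ⊆ S, Indep G I' ∧ I.card + k ≤ I'.card)
    (hb : ¬ ∃ n, ∃ P : SimpleGraph (Fin n), Big P ∧ ∃ f : P ↪g addStar G p Q,
      (∀ i, f i ∈ S \ X) ∧ ∃ i, f i = p)
    (ht : ∀ s ∈ S \ X, ∀ t ∈ S \ X, (addStar G p Q).Adj p s → (addStar G p Q).Adj p t →
      G.Adj s t → G.Adj p s ∧ G.Adj p t) :
    42 * k < 14 * X.card + (frees G S ∩ X).card := by
  have h1 := h.reduce hX hne _ hG' ext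
  have h2 := card_frees_split (G := G) (S := S) (X := X)
  have h3 : frees G S ∩ (S \ X) ⊆ frees (addStar G p Q) (S \ X) := by
    intro v hv
    rw [Finset.mem_inter] at hv
    by_contra hv'
    rcases lost hv.1 Finset.sdiff_subset hv.2 hv' with k | ⟨s, hs, t, ht', ps, pt, st, -, k⟩
    · exact hb k
    · exact k (ht s hs t ht' ps pt st)
  have h4 := Finset.card_le_card h3
  omega

/-- Adding a star at `p` costs at most 9 in the count of 3-free vertices. If no large 3-tight
subgraph through `p` appears, only `p` and its at most three neighbours can cease to be free. If one
appears, it is deleted as well, and at most nine of its vertices were free in `G`. -/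
lemma reduce_star (h : MinG G S) (hX : X ⊆ S) (hne : X.Nonempty)
    (hG' : Brooks (addStar G p Q) (S \ X)) (hp : p ∈ S \ X)
    (ext : ∀ I ⊆ S \ X, Indep (addStar G p Q) I → ∃ I' ⊆ S, Indep G I' ∧ I.card + k ≤ I'.card) :
    42 * k < 14 * X.card + (frees G S ∩ X).card + 9 := by
  by_cases hb : ∃ n, ∃ P : SimpleGraph (Fin n), Big P ∧ ∃ f : P ↪g addStar G p Q,
      (∀ i, f i ∈ S \ X) ∧ ∃ i, f i = p
  · obtain ⟨n, P, hP, f, hf, i₀, hi₀⟩ := hb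
    obtain ⟨hn, J, hJ, hJi, hJd⟩ := hP.exists_indep
    have hfs : img f ⊆ S \ X := img_subset.2 hf
    have hTS : (S \ X) \ img f ⊆ S := Finset.sdiff_subset.trans Finset.sdiff_subset
    have hpos := hne.card_pos
    have hc := Finset.card_sdiff_add_card_eq_card hX
    have hc' := Finset.card_sdiff_add_card_eq_card hfs
    rw [img_card f.injective] at hc'
    -- The deleted subgraph contains `p`, so what remains has no added edges and the original graph
    -- can be used.
    obtain ⟨I, hI, hi, hle⟩ := h.ih G ((S \ X) \ img f) (by omega) (h.ok.mono hTS)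
    have hpI : ∀ s ∈ I, s ≠ p := by
      rintro s hs rfl
      exact (Finset.mem_sdiff.1 (hI hs)).2 (by simpa using ⟨i₀, hi₀⟩)
    obtain ⟨I₂, hI₂, hi₂, hle₂⟩ := extend (G := addStar G p Q) (S := S \ X) (X := img f)
      (J := I) (I := J.image f) hfs hI
      (fun u hu v hv huv => hi u hu v hv ((addStar_adj_off (hpI u hu) (hpI v hv)).1 huv))
      (by
        intro x hx
        obtain ⟨i, -, rfl⟩ := Finset.mem_image.1 hx
        simp)
      (by
        intro a ha b hb
        obtain ⟨i, hi, rfl⟩ := Finset.mem_image.1 ha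
        obtain ⟨j, hj, rfl⟩ := Finset.mem_image.1 hb
        rw [f.map_adj_iff]; exact hJi i hi j hj)
      (by
        intro a ha v hv hav
        obtain ⟨i, hi, rfl⟩ := Finset.mem_image.1 ha
        have hv' := Finset.mem_sdiff.1 (hI hv)
        have : v ∈ nb (addStar G p Q) (S \ X) (f i) := mem_nb.2 ⟨hv'.1, hav⟩
        rw [nb_img_of_full P f hf i (by rw [hJd i hi]; exact hG'.deg _ (hf i))] at this
        exact hv'.2 (nb_subset this))
    rw [Finset.card_image_of_injective _ f.injective] at hle₂
    obtain ⟨I₃, hI₃, hi₃, hle₃⟩ := ext I₂ hI₂ hi₂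
    have hng := h.not_good hI₃ hi₃
    have s1 := card_frees_split (G := G) (S := S) (X := X)
    have s2 : (frees G S ∩ (S \ X)).card ≤
        (frees G S ∩ img f).card + (frees G ((S \ X) \ img f)).card := by
      refine le_trans (Finset.card_le_card ?_) (Finset.card_union_le _ _)
      intro v hv
      rw [Finset.mem_inter] at hv
      by_cases hvf : v ∈ img f
      · exact Finset.mem_union_left _ (Finset.mem_inter.2 ⟨hv.1, hvf⟩)
      · exact Finset.mem_union_right _ (frees_inter_subset hTS
          (Finset.mem_inter.2 ⟨hv.1, Finset.mem_sdiff.2 ⟨hv.2, hvf⟩⟩))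
    -- On twelve vertices, a triangle avoiding `p` consists of edges of `G`, so three of the
    -- vertices were not free.
    have s3 : (frees G S ∩ img f).card ≤ 9 := by
      rcases hP.exists_tri with h9 | ⟨h12, htri⟩
      · refine (Finset.card_le_card Finset.inter_subset_right).trans ?_
        rw [img_card f.injective]; exact h9
      · obtain ⟨i, j, l, hi, hj, hl, ij, il, jl⟩ := htri i₀
        have ne : ∀ i, i ≠ i₀ → f i ≠ p := fun i hi e => hi (f.injective (e.trans hi₀.symm))
        have ad : ∀ i j, i ≠ i₀ → j ≠ i₀ → P.Adj i j → G.Adj (f i) (f j) := fun i j hi hj hij =>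
          (addStar_adj_off (ne i hi) (ne j hj)).1 (f.map_adj_iff.2 hij)
        have fS : ∀ i, f i ∈ S := fun i => Finset.sdiff_subset (hf i)
        have hsub : frees G S ∩ img f ⊆ img f \ {f i, f j, f l} := by
          intro v hv
          rw [Finset.mem_inter] at hv
          rw [Finset.mem_sdiff]
          refine ⟨hv.2, ?_⟩
          simp only [Finset.mem_insert, Finset.mem_singleton]
          rintro (rfl | rfl | rfl)
          · exact not_inTri_of_frees hv.1 (fS j) (fS l) (ad _ _ hi hj ij) (ad _ _ hi hl il)
              (ad _ _ hj hl jl)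
          · exact not_inTri_of_frees hv.1 (fS i) (fS l) (ad _ _ hj hi ij.symm) (ad _ _ hj hl jl)
              (ad _ _ hi hl il)
          · exact not_inTri_of_frees hv.1 (fS i) (fS j) (ad _ _ hl hi il.symm)
              (ad _ _ hl hj jl.symm) (ad _ _ hi hj ij)
        have e := Finset.card_le_card hsub
        have e2 : ({f i, f j, f l} : Finset V) ⊆ img f := by
          intro v; simp only [Finset.mem_insert, Finset.mem_singleton]
          rintro (rfl | rfl | rfl) <;> simp
        have e3 := Finset.card_sdiff_add_card_eq_card e2
        rw [Finset.card_insert_of_notMem (by simp [f.injective.eq_iff, ij.ne, il.ne]),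
          Finset.card_pair (by simp [f.injective.eq_iff, jl.ne]), img_card f.injective] at e3
        omega
    omega
  · have h1 := h.reduce hX hne _ hG' ext
    have h2 := card_frees_split (G := G) (S := S) (X := X)
    have h3 : frees G S ∩ (S \ X) ⊆
        frees (addStar G p Q) (S \ X) ∪ insert p (nb (addStar G p Q) (S \ X) p) := by
      intro v hv
      rw [Finset.mem_inter] at hv
      by_cases hv' : v ∈ frees (addStar G p Q) (S \ X)
      · exact Finset.mem_union_left _ hv'
      · rcases lost hv.1 Finset.sdiff_subset hv.2 hv' with k | ⟨s, hs, t, ht', ps, pt, st, k, -⟩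
        · exact absurd k hb
        · refine Finset.mem_union_right _ ?_
          rcases k with rfl | rfl
          · simp
          · exact Finset.mem_insert_of_mem (mem_nb.2 ⟨hs, ps⟩)
    have h4 := (Finset.card_le_card h3).trans (Finset.card_union_le _ _)
    have h5 := Finset.card_insert_le p (nb (addStar G p Q) (S \ X) p)
    have h6 := hG'.deg p hp
    omega

end MinG
end ThreeTight

/-! ### Two linked triangles -/

namespace ThreeTight
open scoped Classical

variable {V : Type*} {G : SimpleGraph V} {A B C D S S' T X I J R Q : Finset V}
  {a b c d u v w x y z p q a' b' c' : V} {n k : ℕ} {P : SimpleGraph (Fin n)}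

lemma full_nb [DecidableRel P.Adj] (ok : Brooks G S) {t : Fin n → V} (hi : Function.Injective t)
    (hS : ∀ i, t i ∈ S) (hom : ∀ i j, P.Adj i j → G.Adj (t i) (t j)) {i : Fin n}
    (hd : pdeg P i = 3) (hx : x ∈ S) (hix : G.Adj (t i) x) : ∃ j, P.Adj i j ∧ t j = x := by
  have h1 : nb G S (t i) = (Finset.univ.filter (P.Adj i)).image t := by
    refine eq_of_card_nb_le (ok.deg _ (hS i)) ?_ ?_
    · intro y hy
      obtain ⟨j, hj, rfl⟩ := Finset.mem_image.1 hy
      exact mem_nb.2 ⟨hS j, hom _ _ (Finset.mem_filter.1 hj).2⟩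
    · rw [Finset.card_image_of_injective _ hi]
      exact hd.ge
  have h2 : x ∈ nb G S (t i) := mem_nb.2 ⟨hx, hix⟩
  rw [h1] at h2
  obtain ⟨j, hj, rfl⟩ := Finset.mem_image.1 h2
  exact ⟨j, (Finset.mem_filter.1 hj).2, rfl⟩

namespace MinG

/-- Both ends of the new edge have lost an edge to the deleted part, and a `K₄` through the new edge
would come from a diamond of `G`. -/
lemma edge_ok (h : MinG G S) (hS' : S' ⊆ S) (hp : p ∈ S') (hq : q ∈ S') (hpq : p ≠ q)
    (ep : ∃ x ∈ S \ S', G.Adj x p) (eq : ∃ x ∈ S \ S', G.Adj x q) :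
    Brooks (addStar G p {q}) S' := by
  refine ok_addStar h.ok hS' ?_ ?_ ?_
  · obtain ⟨x, hx, hxp⟩ := ep
    rw [Finset.mem_sdiff] at hx
    have h1 : insert x (nb G S' p) ⊆ nb G S p :=
      Finset.insert_subset (mem_nb.2 ⟨hx.1, hxp.symm⟩) (nb_mono hS')
    have h2 := Finset.card_le_card h1
    rw [Finset.card_insert_of_notMem (fun k => hx.2 (nb_subset k))] at h2
    have h3 := h.ok.deg p (hS' hp)
    have h4 := (Finset.card_le_card (nb_addStar_self (G := G) (S := S') (p := p) (Q := {q}))).trans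
      (Finset.card_union_le _ _)
    have h5 := Finset.card_le_card (Finset.inter_subset_left (s₁ := {q}) (s₂ := S'))
    rw [Finset.card_singleton] at h5
    omega
  · intro q' hq' _
    rw [Finset.mem_singleton] at hq'
    rwa [hq']
  · have key : ∀ u, (addStar G p {q}).Adj p u → G.Adj p u ∨ u = q := by
      intro u hu
      rw [addStar_adj, Finset.mem_singleton] at hu
      rcases hu with h1 | ⟨h1, h2 | h2⟩
      exacts [Or.inl h1, Or.inr h2.2, absurd h2.1.symm h1]
    have dia : ∀ v ∈ S', ∀ w ∈ S', (addStar G p {q}).Adj p v → (addStar G p {q}).Adj p w →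
        G.Adj v w → G.Adj v q → G.Adj w q → False := by
      intro v hv w hw pv pw vw vq wq
      have e1 := (key v pv).resolve_right vq.ne
      have e2 := (key w pw).resolve_right wq.ne
      exact h.no_dia (hS' hv) (hS' hw) (hS' hp) (hS' hq) vw e1.symm vq e2.symm wq hpq
    intro u hu v hv w hw pu pv pw uv vw uw
    rcases key u pu with e1 | rfl
    · rcases key v pv with e2 | rfl
      · rcases key w pw with e3 | rfl
        · exact h.ok.k4 p (hS' hp) u (hS' hu) v (hS' hv) w (hS' hw) e1 e2 e3 uv uw vw
        · exact dia u hu v hv pu pv uv uw vw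
      · exact dia u hu w hw pu pw uw uv vw.symm
    · exact dia v hv w hw pv pw vw uv.symm uw.symm

end MinG

/-- Two adjacent triangles, with two vertices each adjacent to both triangles. -/
def twoTri : SimpleGraph (Fin 8) :=
  graphOfEdges 8 [(0, 1), (0, 2), (1, 2), (3, 4), (3, 5), (4, 5), (0, 3), (1, 6), (6, 4), (2, 7),
    (7, 5)]

instance : DecidableRel twoTri.Adj := graphOfEdgesDec _ _

namespace MinG

/-- This is the 9-vertex Havel necklace without its vertex of degree two. Only `t 6` and `t 7` can
have outside neighbours, at most one each. If these coincide they complete a Havel necklace; if they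
are distinct, they are joined by an edge after deletion. -/
lemma no_twoTri (h : MinG G S) (t : Fin 8 → V) (hi : Function.Injective t) (hS : ∀ i, t i ∈ S)
    (hom : ∀ i j, twoTri.Adj i j → G.Adj (t i) (t j)) : False := by
  have hX : img t ⊆ S := img_subset.2 hS
  have cX : (img t).card = 8 := img_card hi
  have tX : ∀ i, t i ∈ img t := by simp
  have full : ∀ i x, pdeg twoTri i = 3 → x ∈ S → G.Adj (t i) x → ∃ j, twoTri.Adj i j ∧ t j = x :=
    fun i x hd hx hix => full_nb h.ok hi hS hom hd hx hix
  have nadj : ∀ i j, pdeg twoTri i = 3 → ¬ twoTri.Adj i j → ¬ G.Adj (t i) (t j) := by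
    intro i j hd hn hij
    obtain ⟨l, hl, e⟩ := full i _ hd (hS j) hij
    exact hn (hi e ▸ hl)
  have hF : (frees G S ∩ img t).card ≤ 2 := by
    refine (Finset.card_le_card (t := {t 6, t 7}) ?_).trans Finset.card_le_two
    intro v hv
    rw [Finset.mem_inter, mem_img] at hv
    obtain ⟨hv, i, rfl⟩ := hv
    have key : ∀ i, i = 6 ∨ i = 7 ∨ ∃ j l, twoTri.Adj i j ∧ twoTri.Adj i l ∧ twoTri.Adj j l := by
      decide
    rcases key i with rfl | rfl | ⟨j, l, ij, il, jl⟩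
    · simp
    · simp
    · exact (not_inTri_of_frees hv (hS j) (hS l) (hom _ _ ij) (hom _ _ il) (hom _ _ jl)).elim
  have ind : ∀ i j l, pdeg twoTri j = 3 → pdeg twoTri l = 3 → ¬ twoTri.Adj j i →
      ¬ twoTri.Adj l i → ¬ twoTri.Adj j l → Indep G {t i, t j, t l} := by
    intro i j l hj hl ji li jl u hu v hv huv
    simp only [Finset.mem_insert, Finset.mem_singleton] at hu hv
    rcases hu with rfl | rfl | rfl <;> rcases hv with rfl | rfl | rfl
    · exact G.irrefl huv
    · exact nadj _ _ hj ji huv.symm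
    · exact nadj _ _ hl li huv.symm
    · exact nadj _ _ hj ji huv
    · exact G.irrefl huv
    · exact nadj _ _ hj jl huv
    · exact nadj _ _ hl li huv
    · exact nadj _ _ hj jl huv.symm
    · exact G.irrefl huv
  have nbF : ∀ i, pdeg twoTri i = 3 → nb G S (t i) ⊆ img t := by
    intro i hd x hx
    rw [mem_nb] at hx
    obtain ⟨j, -, rfl⟩ := full i x hd hx.1 hx.2
    exact tX j
  have i605 := ind 6 0 5 (by decide) (by decide) (by decide) (by decide) (by decide)
  have i704 := ind 7 0 4 (by decide) (by decide) (by decide) (by decide) (by decide)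
  have c605 : ({t 6, t 0, t 5} : Finset V).card = 3 := by
    rw [Finset.card_insert_of_notMem (by simp [hi.eq_iff]), Finset.card_pair (by simp [hi.eq_iff])]
  have c704 : ({t 7, t 0, t 4} : Finset V).card = 3 := by
    rw [Finset.card_insert_of_notMem (by simp [hi.eq_iff]), Finset.card_pair (by simp [hi.eq_iff])]
  have s3 : ∀ i j l, ({t i, t j, t l} : Finset V) ⊆ img t := by
    intro i j l x
    simp only [Finset.mem_insert, Finset.mem_singleton]
    rintro (rfl | rfl | rfl) <;> exact tX _
  have exit : ∀ i j l, j ≠ l → twoTri.Adj i j → twoTri.Adj i l →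
      (nb G (S \ img t) (t i)).card ≤ 1 := by
    intro i j l hjl ij il
    have h1 : ({t j, t l} : Finset V) ⊆ nb G (img t) (t i) := by
      intro x
      simp only [Finset.mem_insert, Finset.mem_singleton]
      rintro (rfl | rfl)
      exacts [mem_nb.2 ⟨tX _, hom _ _ ij⟩, mem_nb.2 ⟨tX _, hom _ _ il⟩]
    have h2 := Finset.card_le_card h1
    rw [Finset.card_pair (fun e => hjl (hi e))] at h2
    have h3 := nb_union_card (G := G) (v := t i) (Finset.sdiff_disjoint (s := img t) (t := S))
    rw [Finset.sdiff_union_of_subset hX] at h3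
    have := h.ok.deg _ (hS i)
    omega
  -- Three independent vertices for eight deleted ones: 42·3 exceeds 14·8 + 2.
  have closed : ∀ i j l, pdeg twoTri j = 3 → pdeg twoTri l = 3 → Indep G {t i, t j, t l} →
      ({t i, t j, t l} : Finset V).card = 3 → nb G (S \ img t) (t i) = ∅ → False := by
    intro i j l hj hl hind hc he
    have := h.deletion hX ⟨t 0, tX 0⟩ (s3 i j l) hind (by
      intro u hu
      simp only [Finset.mem_insert, Finset.mem_singleton] at hu
      rcases hu with rfl | rfl | rfl
      · intro x hx
        by_contra hxX
        rw [mem_nb] at hx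
        have : x ∈ nb G (S \ img t) (t i) := mem_nb.2 ⟨Finset.mem_sdiff.2 ⟨hx.1, hxX⟩, hx.2⟩
        rw [he] at this
        simp at this
      · exact nbF _ hj
      · exact nbF _ hl)
    omega
  rcases (nb G (S \ img t) (t 6)).eq_empty_or_nonempty with h6 | ⟨p, hp⟩
  · exact closed 6 0 5 (by decide) (by decide) i605 c605 h6
  rcases (nb G (S \ img t) (t 7)).eq_empty_or_nonempty with h7 | ⟨r, hr⟩
  · exact closed 7 0 4 (by decide) (by decide) i704 c704 h7
  have e6 := Finset.card_le_one.1 (exit 6 1 4 (by decide) (by decide) (by decide))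
  have e7 := Finset.card_le_one.1 (exit 7 2 5 (by decide) (by decide) (by decide))
  have hp' := mem_nb.1 hp
  have hr' := mem_nb.1 hr
  have pS := Finset.mem_sdiff.1 hp'.1
  have pX : ∀ i, t i ≠ p := fun i e => pS.2 (e ▸ tX i)
  by_cases hpr : p = r
  · subst hpr
    have hgS : ∀ i, ![t 0, t 1, t 2, t 3, t 4, t 5, t 6, t 7, p] i ∈ S := by
      intro i; fin_cases i
      exacts [hS 0, hS 1, hS 2, hS 3, hS 4, hS 5, hS 6, hS 7, pS.1]
    obtain ⟨g, hg⟩ := emb_full havelNecklace9 h.ok (by decide)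
      ![t 0, t 1, t 2, t 3, t 4, t 5, t 6, t 7, p]
      (by rw [← List.nodup_ofFn]; simp [hi.eq_iff, pX]) hgS
      (hom_of_edges (by
        simp only [List.mem_cons, List.not_mem_nil, or_false, forall_eq_or_imp, forall_eq]
        exact ⟨hom 0 1 (by decide), hom 0 2 (by decide), hom 1 2 (by decide), hom 3 4 (by decide),
          hom 3 5 (by decide), hom 4 5 (by decide), hom 0 3 (by decide), hom 1 6 (by decide),
          hom 6 4 (by decide), hom 2 7 (by decide), hom 7 5 (by decide), hp'.2, hr'.2.symm⟩))
    exact h.no_big (.neck .h9) g fun i => hg i ▸ hgS i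
  · have hok : Brooks (addStar G p {r}) (S \ img t) := by
      refine h.edge_ok Finset.sdiff_subset hp'.1 hr'.1 hpr ⟨t 6, ?_, hp'.2⟩ ⟨t 7, ?_, hr'.2⟩
      · simp [hS]
      · simp [hS]
    -- The added edge keeps one of `p`, `r` out of the independent set, freeing `t 6` or `t 7`. The
    -- count is 126 against 112 + 2 + 9.
    have := h.reduce_star (k := 3) hX ⟨t 0, tX 0⟩ hok hp'.1 (by
      intro J hJ hj
      have hjG : Indep G J := fun u hu v hv huv => hj u hu v hv (le_addStar huv)
      have nF : ∀ i, pdeg twoTri i = 3 → ∀ v ∈ J, ¬ G.Adj (t i) v := by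
        intro i hd v hv hiv
        have := Finset.mem_sdiff.1 (hJ hv)
        exact this.2 (nbF i hd (mem_nb.2 ⟨this.1, hiv⟩))
      by_cases hpJ : p ∈ J
      · have hrJ : r ∉ J := fun hrJ => hj p hpJ r hrJ
          (addStar_adj.2 (Or.inr ⟨hpr, Or.inl ⟨rfl, by simp⟩⟩))
        rw [← c704]
        refine extend hX hJ hjG (s3 7 0 4) i704 ?_
        intro u hu
        simp only [Finset.mem_insert, Finset.mem_singleton] at hu
        rcases hu with rfl | rfl | rfl
        · intro v hv hiv
          exact hrJ (e7 v (mem_nb.2 ⟨hJ hv, hiv⟩) r hr ▸ hv)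
        · exact nF 0 (by decide)
        · exact nF 4 (by decide)
      · rw [← c605]
        refine extend hX hJ hjG (s3 6 0 5) i605 ?_
        intro u hu
        simp only [Finset.mem_insert, Finset.mem_singleton] at hu
        rcases hu with rfl | rfl | rfl
        · intro v hv hiv
          exact hpJ (e6 v (mem_nb.2 ⟨hJ hv, hiv⟩) p hp ▸ hv)
        · exact nF 0 (by decide)
        · exact nF 5 (by decide))
    omega

end MinG
end ThreeTight

/-! ### Outside neighbours of a triangle -/

namespace ThreeTight
open scoped Classical

variable {V : Type*} {G : SimpleGraph V} {A B C D S S' T X I J R Q : Finset V}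
  {a b c d u v w x y z p q a' b' c' : V} {n k : ℕ} {P : SimpleGraph (Fin n)}

/-- A triangle `a, b, c` of `G[S]` with outside neighbours `a'`, `b'`, `c'`. -/
structure TriX (G : SimpleGraph V) (S : Finset V) (a b c a' b' c' : V) : Prop where
  ha : a ∈ S
  hb : b ∈ S
  hc : c ∈ S
  ha' : a' ∈ S
  hb' : b' ∈ S
  hc' : c' ∈ S
  ab : G.Adj a b
  ac : G.Adj a c
  bc : G.Adj b c
  aa : G.Adj a a'
  bb : G.Adj b b'
  cc : G.Adj c c'
  nab : a' ≠ b
  nac : a' ≠ c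
  nba : b' ≠ a
  nbc : b' ≠ c
  nca : c' ≠ a
  ncb : c' ≠ b

namespace TriX

lemma rot (t : TriX G S a b c a' b' c') : TriX G S b c a b' c' a' :=
  ⟨t.hb, t.hc, t.ha, t.hb', t.hc', t.ha', t.bc, t.ab.symm, t.ac.symm, t.bb, t.cc, t.aa, t.nbc,
    t.nba, t.ncb, t.nca, t.nab, t.nac⟩

lemma swap (t : TriX G S a b c a' b' c') : TriX G S b a c b' a' c' :=
  ⟨t.hb, t.ha, t.hc, t.hb', t.ha', t.hc', t.ab.symm, t.bc, t.ac, t.bb, t.aa, t.cc, t.nba, t.nbc,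
    t.nab, t.nac, t.ncb, t.nca⟩

lemma adj_a (t : TriX G S a b c a' b' c') (h : MinG G S) (hy : y ∈ S) (hay : G.Adj a y) :
    y = b ∨ y = c ∨ y = a' := by
  have : nb G S a = {b, c, a'} := by
    refine eq_of_card_nb_le (h.ok.deg a t.ha) ?_ ?_
    · intro x
      simp only [Finset.mem_insert, Finset.mem_singleton, mem_nb]
      rintro (rfl | rfl | rfl)
      exacts [⟨t.hb, t.ab⟩, ⟨t.hc, t.ac⟩, ⟨t.ha', t.aa⟩]
    · rw [Finset.card_insert_of_notMem (by simp [t.bc.ne, t.nab.symm]), Finset.card_pair t.nac.symm]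
  have h2 : y ∈ nb G S a := mem_nb.2 ⟨hy, hay⟩
  rw [this] at h2
  simpa using h2

lemma ne (t : TriX G S a b c a' b' c') (h : MinG G S) : a' ≠ b' := by
  rintro rfl
  exact h.no_dia t.ha t.hb t.hc t.ha' t.ab t.ac t.aa t.bc t.bb t.nac.symm

lemma subset (t : TriX G S a b c a' b' c') : ({a, b, c} : Finset V) ⊆ S := by
  intro x; simp only [Finset.mem_insert, Finset.mem_singleton]
  rintro (rfl | rfl | rfl)
  exacts [t.ha, t.hb, t.hc]

lemma card (t : TriX G S a b c a' b' c') : ({a, b, c} : Finset V).card = 3 := by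
  rw [Finset.card_insert_of_notMem (by simp [t.ab.ne, t.ac.ne]), Finset.card_pair t.bc.ne]

lemma not_frees (t : TriX G S a b c a' b' c') : a ∉ frees G S := fun k =>
  MinG.not_inTri_of_frees k t.hb t.hc t.ab t.ac t.bc

lemma frees_inter (t : TriX G S a b c a' b' c') : frees G S ∩ {a, b, c} = ∅ := by
  rw [Finset.eq_empty_iff_forall_notMem]
  intro v hv
  simp only [Finset.mem_insert, Finset.mem_singleton, Finset.mem_inter] at hv
  rcases hv with ⟨hv, rfl | rfl | rfl⟩
  exacts [t.not_frees hv, t.rot.not_frees hv, t.rot.rot.not_frees hv]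

lemma mem_sdiff (t : TriX G S a b c a' b' c') : a' ∈ S \ {a, b, c} := by
  simp [t.ha', t.nab, t.nac, t.aa.ne.symm]

/-- A set missing one of the two outside neighbours extends by a vertex of the triangle. -/
lemma extend_one (t : TriX G S a b c a' b' c') (h : MinG G S) (hJ : J ⊆ S \ {a, b, c})
    (hj : Indep G J) (hab : a' ∈ J → b' ∉ J) :
    ∃ I' ⊆ S, Indep G I' ∧ J.card + 1 ≤ I'.card := by
  have key : ∀ {a b c a' b' c'}, TriX G S a b c a' b' c' → J ⊆ S \ {a, b, c} → a' ∉ J →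
      ∃ I' ⊆ S, Indep G I' ∧ J.card + 1 ≤ I'.card := by
    intro a b c a' b' c' t hJ ha
    rw [← Finset.card_singleton a]
    refine MinG.extend t.subset hJ hj (by simp) ?_ ?_
    · intro u hu v hv
      rw [Finset.mem_singleton] at hu hv
      subst hu hv
      exact G.irrefl
    · intro u hu v hv huv
      rw [Finset.mem_singleton] at hu
      subst hu
      have hv' := hJ hv
      simp only [Finset.mem_sdiff, Finset.mem_insert, Finset.mem_singleton, not_or] at hv'
      rcases t.adj_a h hv'.1 huv with rfl | rfl | rfl
      exacts [hv'.2.2.1 rfl, hv'.2.2.2 rfl, ha hv]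
  by_cases ha : a' ∈ J
  · exact key t.swap (by rwa [Finset.insert_comm b a]) (hab ha)
  · exact key t hJ ha

/-- Otherwise every independent set avoiding the triangle misses `a'` or `b'` and extends by a
triangle vertex; deleting the triangle costs exactly 42 and no 3-free vertex. -/
lemma nadj (t : TriX G S a b c a' b' c') (h : MinG G S) : ¬ G.Adj a' b' := by
  intro hab
  have h1 := h.reduce (k := 1) t.subset ⟨a, by simp⟩ G (h.ok.mono Finset.sdiff_subset)
    fun J hJ hj => t.extend_one h hJ hj fun k k' => hj _ k _ k' hab
  have h2 := card_frees_split (G := G) (S := S) (X := {a, b, c})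
  have h3 := Finset.card_le_card
    (frees_inter_subset (G := G) (Finset.sdiff_subset (s := S) (t := {a, b, c})))
  rw [t.frees_inter, Finset.card_empty] at h2
  rw [t.card] at h1
  omega

end TriX

namespace MinG

lemma exists_exit (h : MinG G S) (ha : a ∈ S) (hb : b ∈ S) (hc : c ∈ S) (ab : G.Adj a b)
    (ac : G.Adj a c) (bc : G.Adj b c) : ∃ a' ∈ S, G.Adj a a' ∧ a' ≠ b ∧ a' ≠ c := by
  by_contra hno
  push Not at hno
  have hX : ({a, b, c} : Finset V) ⊆ S := by
    intro x; simp only [Finset.mem_insert, Finset.mem_singleton]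
    rintro (rfl | rfl | rfl)
    exacts [ha, hb, hc]
  have h1 := h.deletion (I := {a}) hX ⟨a, by simp⟩ (by simp)
    (by
      intro u hu v hv
      rw [Finset.mem_singleton] at hu hv
      subst hu hv
      exact G.irrefl)
    (by
      intro u hu x hx
      rw [Finset.mem_singleton] at hu
      subst hu
      rw [mem_nb] at hx
      have := hno x hx.1 hx.2
      simp only [Finset.mem_insert, Finset.mem_singleton]
      tauto)
  have h2 : frees G S ∩ {a, b, c} = ∅ := by
    rw [Finset.eq_empty_iff_forall_notMem]
    intro v hv
    simp only [Finset.mem_insert, Finset.mem_singleton, Finset.mem_inter] at hv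
    rcases hv with ⟨hv, rfl | rfl | rfl⟩
    · exact not_inTri_of_frees hv hb hc ab ac bc
    · exact not_inTri_of_frees hv ha hc ab.symm bc ac
    · exact not_inTri_of_frees hv ha hb ac.symm bc.symm ab
  have := Finset.card_le_three (a := a) (b := b) (c := c)
  rw [h2, Finset.card_singleton, Finset.card_empty] at h1
  omega

lemma exists_triX (h : MinG G S) (ha : a ∈ S) (hb : b ∈ S) (hc : c ∈ S) (ab : G.Adj a b)
    (ac : G.Adj a c) (bc : G.Adj b c) : ∃ a' b' c', TriX G S a b c a' b' c' := by
  obtain ⟨a', h1, h2, h3, h4⟩ := h.exists_exit ha hb hc ab ac bc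
  obtain ⟨b', k1, k2, k3, k4⟩ := h.exists_exit hb ha hc ab.symm bc ac
  obtain ⟨c', l1, l2, l3, l4⟩ := h.exists_exit hc ha hb ac.symm bc.symm ab
  exact ⟨a', b', c', ha, hb, hc, h1, k1, l1, ab, ac, bc, h2, k2, l2, h3, h4, k3, k4, l3, l4⟩

end MinG

namespace TriX

/-- Deleting a large 3-tight subgraph that uses the new edge `a'b'`. -/
lemma delete_big (t : TriX G S a b c a' b' c') (h : MinG G S)
    (hok : Brooks (addStar G a' {b'}) (S \ {a, b, c})) (f : P ↪g addStar G a' {b'})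
    (hf : ∀ i, f i ∈ S \ {a, b, c}) {i₀ j₀ : Fin n} (hi₀ : f i₀ = a') (hj₀ : f j₀ = b')
    (htri : ∀ i j l, P.Adj i j → P.Adj i l → P.Adj j l → G.Adj (f i) (f j))
    (J Z : Finset (Fin n)) (hJd : ∀ i ∈ J, pdeg P i = 3) (hiJ : i₀ ∈ J) (hjJ : j₀ ∈ J)
    (hJ : ∀ i ∈ J, ∀ j ∈ J, P.Adj i j → (i = i₀ ∧ j = j₀) ∨ (i = j₀ ∧ j = i₀))
    (hZ : ∀ i, i ∉ Z → ∃ j l, P.Adj i j ∧ P.Adj i l ∧ P.Adj j l) :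
    42 * J.card < 14 * (n + 2) + Z.card := by
  have fS : ∀ i, f i ∈ S := fun i => (Finset.mem_sdiff.1 (hf i)).1
  have hX : img f ∪ {a, b} ⊆ S := by
    refine Finset.union_subset (img_subset.2 fS) ?_
    intro x; simp only [Finset.mem_insert, Finset.mem_singleton]
    rintro (rfl | rfl)
    exacts [t.ha, t.hb]
  have nadj := t.nadj h
  have h1 := h.deletion (I := J.image f) hX ⟨a, by simp⟩
    (by
      intro x hx
      obtain ⟨i, -, rfl⟩ := Finset.mem_image.1 hx
      exact Finset.mem_union_left _ (by simp))
    (by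
      intro u hu v hv huv
      obtain ⟨i, hi, rfl⟩ := Finset.mem_image.1 hu
      obtain ⟨j, hj, rfl⟩ := Finset.mem_image.1 hv
      rcases hJ i hi j hj (f.map_adj_iff.1 (le_addStar huv)) with ⟨rfl, rfl⟩ | ⟨rfl, rfl⟩
      · rw [hi₀, hj₀] at huv; exact nadj huv
      · rw [hi₀, hj₀] at huv; exact nadj huv.symm)
    (by
      intro u hu x hx
      obtain ⟨i, hi, rfl⟩ := Finset.mem_image.1 hu
      rw [mem_nb] at hx
      -- The chosen vertices have full degree in the copy. Outside it only `a` and `b` occur as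
      -- neighbours, attached to `a'` and `b'`; a neighbour `c` would give a diamond or a vertex of
      -- degree four.
      have hnb := nb_img_of_full P f hf i (by rw [hJd i hi]; exact hok.deg _ (hf i))
      rw [Finset.mem_union]
      by_cases hxT : x ∈ ({a, b, c} : Finset V)
      · right
        simp only [Finset.mem_insert, Finset.mem_singleton] at hxT ⊢
        rcases hxT with rfl | rfl | rfl
        · simp
        · simp
        · exfalso
          by_cases e1 : f i = a'
          · rw [e1] at hx
            exact h.no_dia t.ha t.hc t.hb t.ha' t.ac t.ab t.aa t.bc.symm hx.2.symm t.nab.symm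
          by_cases e2 : f i = b'
          · rw [e2] at hx
            exact h.no_dia t.hb t.hc t.ha t.hb' t.bc t.ab.symm t.bb t.ac.symm hx.2.symm t.nba.symm
          have hc3 := card_nb_img P f i
          rw [← hnb, nb_addStar_notMem e1 (by simpa using e2), hJd i hi] at hc3
          have hs : insert x (nb G (S \ {a, b, x}) (f i)) ⊆ nb G S (f i) :=
            Finset.insert_subset (mem_nb.2 hx) (nb_mono Finset.sdiff_subset)
          have := Finset.card_le_card hs
          rw [Finset.card_insert_of_notMem (by simp), hc3] at this
          have := h.ok.deg _ (fS i)
          omega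
      · left
        have : x ∈ nb (addStar G a' {b'}) (S \ {a, b, c}) (f i) :=
          mem_nb.2 ⟨Finset.mem_sdiff.2 ⟨hx.1, hxT⟩, le_addStar hx.2⟩
        rw [hnb] at this
        exact nb_subset this)
  have h2 : frees G S ∩ (img f ∪ {a, b}) ⊆ Z.image f := by
    intro v hv
    simp only [Finset.mem_insert, Finset.mem_singleton, Finset.mem_inter, Finset.mem_union,
      mem_img] at hv
    obtain ⟨hv, ⟨i, rfl⟩ | rfl | rfl⟩ := hv
    · by_contra hvZ
      obtain ⟨j, l, ij, il, jl⟩ := hZ i fun k => hvZ (Finset.mem_image_of_mem _ k)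
      exact MinG.not_inTri_of_frees hv (fS j) (fS l) (htri _ _ _ ij il jl) (htri _ _ _ il ij jl.symm)
        (htri _ _ _ jl ij.symm il.symm)
    · exact absurd hv t.not_frees
    · exact absurd hv t.rot.not_frees
  have h3 := (Finset.card_le_card h2).trans Finset.card_image_le
  have h4 := Finset.card_union_le (img f) {a, b}
  rw [img_card f.injective, Finset.card_pair t.ab.ne] at h4
  rw [Finset.card_image_of_injective _ f.injective] at h1
  omega

/-- Two outside neighbours of a triangle of a minimal counterexample have a common neighbour. -/
lemma common (t : TriX G S a b c a' b' c') (h : MinG G S) :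
    ∃ x ∈ S, G.Adj a' x ∧ G.Adj b' x := by
  by_contra hno
  push Not at hno
  have hne := t.ne h
  have nadj := t.nadj h
  have hb'm : b' ∈ S \ {a, b, c} := by
    simp [t.hb', t.nba, t.nbc, t.bb.ne.symm]
  have adjp : ∀ x, (addStar G a' {b'}).Adj a' x → x ≠ b' → G.Adj a' x := by
    intro x hx hxb
    rw [addStar_adj, Finset.mem_singleton] at hx
    rcases hx with h1 | ⟨h1, h2 | h2⟩
    exacts [h1, absurd h2.2 hxb, absurd h2.1.symm h1]
  have hok : Brooks (addStar G a' {b'}) (S \ {a, b, c}) :=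
    h.edge_ok Finset.sdiff_subset t.mem_sdiff hb'm hne ⟨a, by simp [t.ha], t.aa⟩
      ⟨b, by simp [t.hb], t.bb⟩
  -- Suppose there is no common neighbour and replace the triangle by the edge `a'b'`. No new
  -- triangle arises, so it remains to exclude new large 3-tight subgraphs. They must use the new
  -- edge, which lies in no triangle of the pattern.
  have h1 := h.reduce_star_tight (k := 1) t.subset ⟨a, by simp⟩ hok
    (fun J hJ hj => t.extend_one h hJ (fun u hu v hv huv => hj u hu v hv (le_addStar huv))
      fun k k' => hj _ k _ k' (addStar_adj.2 (Or.inr ⟨hne, Or.inl ⟨rfl, by simp⟩⟩)))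
    (by
      rintro ⟨n, P, hP, f, hf, i₀, hi₀⟩
      have fS : ∀ i, f i ∈ S := fun i => (Finset.mem_sdiff.1 (hf i)).1
      obtain ⟨j₀, hj₀⟩ : ∃ j, f j = b' := by
        by_contra hb
        push Not at hb
        refine h.no_big hP (⟨f.toEmbedding, fun {i j} => ?_⟩ : P ↪g G) fS
        rw [← f.map_adj_iff]
        refine ⟨le_addStar, fun hij => ?_⟩
        rw [addStar_adj, Finset.mem_singleton, Finset.mem_singleton] at hij
        rcases hij with h1 | ⟨h1, h2 | h2⟩
        exacts [h1, absurd h2.2 (hb j), absurd h2.2 (hb i)]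
      have hadj : ∀ i j, P.Adj i j → ¬ (i = i₀ ∧ j = j₀) → ¬ (i = j₀ ∧ j = i₀) →
          G.Adj (f i) (f j) := by
        intro i j hij n1 n2
        have := f.map_adj_iff.2 hij
        rw [addStar_adj, Finset.mem_singleton, Finset.mem_singleton] at this
        rcases this with h1 | ⟨h1, h2 | h2⟩
        · exact h1
        · exact absurd ⟨f.injective (h2.1.trans hi₀.symm), f.injective (h2.2.trans hj₀.symm)⟩ n1
        · exact absurd ⟨f.injective (h2.2.trans hj₀.symm), f.injective (h2.1.trans hi₀.symm)⟩ n2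
      have hcom : ∀ l, P.Adj i₀ l → ¬ P.Adj j₀ l := by
        intro l h1 h2
        have e1 := hadj i₀ l h1 (fun k => h2.ne k.2.symm) (fun k => h1.ne k.2.symm)
        have e2 := hadj j₀ l h2 (fun k => h2.ne k.2.symm) (fun k => h1.ne k.2.symm)
        rw [hi₀] at e1
        rw [hj₀] at e2
        exact hno _ (fS l) e1 e2
      have h00 : P.Adj i₀ j₀ := by
        rw [← f.map_adj_iff, hi₀, hj₀]
        exact addStar_adj.2 (Or.inr ⟨hne, Or.inl ⟨rfl, by simp⟩⟩)
      have htri : ∀ i j l, P.Adj i j → P.Adj i l → P.Adj j l → G.Adj (f i) (f j) := by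
        intro i j l ij il jl
        refine hadj i j ij ?_ ?_
        · rintro ⟨rfl, rfl⟩; exact hcom l il jl
        · rintro ⟨rfl, rfl⟩; exact hcom l jl il
      have hdia : ∀ i j l m, P.Adj i j → P.Adj i l → P.Adj i m → P.Adj j l → P.Adj j m →
          l ≠ m → False := by
        intro i j l m ij il im jl jm lm
        exact h.no_dia (fS i) (fS j) (fS l) (fS m) (htri _ _ _ ij il jl) (htri _ _ _ il ij jl.symm)
          (htri _ _ _ im ij jm.symm) (htri _ _ _ jl ij.symm il.symm)
          (htri _ _ _ jm ij.symm im.symm) fun e => lm (f.injective e)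
      cases hP with
      | td =>
        -- For each of the twelve edges outside the triangles, five vertices that are independent
        -- once that edge is absent, as it is in `G`. Then `delete_big` would need 210 < 14·14 + 6.
        have key : ∀ i j, triangleDominatedSixCycle.Adj i j →
            (∃ l, triangleDominatedSixCycle.Adj i l ∧ triangleDominatedSixCycle.Adj j l) ∨
            ∃ J ∈ ([{0, 1, 3, 7, 11}, {1, 2, 4, 6, 10}, {0, 2, 3, 8, 9}, {0, 3, 4, 7, 9},
              {1, 4, 5, 6, 10}, {0, 2, 5, 8, 9}, {0, 2, 4, 6, 9}, {0, 2, 4, 7, 9}, {0, 2, 4, 8, 9},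
              {1, 3, 5, 6, 9}, {1, 3, 5, 6, 10}, {1, 3, 5, 6, 11}] : List (Finset (Fin 12))),
              J.card = 5 ∧ i ∈ J ∧ j ∈ J ∧ ∀ x ∈ J, ∀ y ∈ J, triangleDominatedSixCycle.Adj x y →
                (x = i ∧ y = j) ∨ (x = j ∧ y = i) := by decide +kernel
        rcases key i₀ j₀ h00 with ⟨l, k1, k2⟩ | ⟨J, -, hJc, hiJ, hjJ, hJ⟩
        · exact hcom l k1 k2
        · have := t.delete_big h hok f hf hi₀ hj₀ htri J {0, 1, 2, 3, 4, 5}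
            (fun i _ => pdeg_congr ((by decide : ∀ i, pdeg triangleDominatedSixCycle i = 3) i))
            hiJ hjJ hJ (by decide)
          rw [hJc] at this
          have e : ({0, 1, 2, 3, 4, 5} : Finset (Fin 12)).card = 6 := by decide
          omega
      | neck hN =>
        cases hN with
        | d6 => refine hdia 0 1 2 3 ?_ ?_ ?_ ?_ ?_ ?_ <;> decide
        | d9 => refine hdia 0 1 2 3 ?_ ?_ ?_ ?_ ?_ ?_ <;> decide
        | d12 => refine hdia 0 1 2 3 ?_ ?_ ?_ ?_ ?_ ?_ <;> decide
        | h12 => refine hdia 8 9 10 11 ?_ ?_ ?_ ?_ ?_ ?_ <;> decide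
        | h9 =>
          have key : ∀ i j, havelNecklace9.Adj i j →
              (∃ l, havelNecklace9.Adj i l ∧ havelNecklace9.Adj j l) ∨ (i = 8 ∨ j = 8) ∨
              ∃ J ∈ ([{0, 3, 6, 7}, {1, 3, 6, 7}, {0, 4, 6, 7}, {2, 3, 6, 7}, {0, 5, 6, 7}] :
                List (Finset (Fin 9))),
                J.card = 4 ∧ (∀ i ∈ J, pdeg havelNecklace9 i = 3) ∧
                i ∈ J ∧ j ∈ J ∧ ∀ x ∈ J, ∀ y ∈ J, havelNecklace9.Adj x y →
                (x = i ∧ y = j) ∨ (x = j ∧ y = i) := by decide +kernel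
          rcases key i₀ j₀ h00 with ⟨l, k1, k2⟩ | k8 | ⟨J, -, hJc, hJd, hiJ, hjJ, hJ⟩
          · exact hcom l k1 k2
          · refine h.no_twoTri (fun i => f (Fin.castLE (by norm_num) i))
              (fun i j hij => Fin.castLE_injective _ (f.injective hij)) (fun i => fS _) ?_
            intro i j hij
            have h8 : ∀ i : Fin 8, (Fin.castLE (by norm_num) i : Fin 9) ≠ 8 := by decide
            refine hadj _ _ ?_ ?_ ?_
            · clear * - hij
              revert i j; decide
            · rintro ⟨e1, e2⟩
              rcases k8 with k | k
              · exact h8 i (e1.trans k)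
              · exact h8 j (e2.trans k)
            · rintro ⟨e1, e2⟩
              rcases k8 with k | k
              · exact h8 j (e2.trans k)
              · exact h8 i (e1.trans k)
          · have := t.delete_big h hok f hf hi₀ hj₀ htri J {6, 7, 8}
              (fun i hi => pdeg_congr (hJd i hi)) hiJ hjJ hJ (by decide)
            rw [hJc] at this
            have e : ({6, 7, 8} : Finset (Fin 9)).card = 3 := by decide
            omega)
    (by
      intro s hs u hu ps pu su
      have hsS := (Finset.mem_sdiff.1 hs).1
      have huS := (Finset.mem_sdiff.1 hu).1
      by_cases hsb : s = b'
      · subst hsb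
        exact absurd su (hno u huS (adjp u pu su.ne.symm))
      by_cases hub : u = b'
      · subst hub
        exact absurd su.symm (hno s hsS (adjp s ps hsb))
      exact ⟨adjp s ps hsb, adjp u pu hub⟩)
  rw [t.frees_inter, t.card] at h1
  simp at h1

end TriX
end ThreeTight

/-! ### The two configurations around a triangle -/

namespace ThreeTight
open scoped Classical

variable {V : Type*} {G : SimpleGraph V} {A B C D S S' T X I J R Q : Finset V}
  {a b c d u v w x y z p q a' b' c' : V} {n k : ℕ} {P : SimpleGraph (Fin n)}

lemma indep_three (h1 : ¬ G.Adj u v) (h2 : ¬ G.Adj u w) (h3 : ¬ G.Adj v w) :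
    Indep G {u, v, w} := by
  intro x hx y hy hxy
  simp only [Finset.mem_insert, Finset.mem_singleton] at hx hy
  rcases hx with rfl | rfl | rfl <;> rcases hy with rfl | rfl | rfl
  exacts [G.irrefl hxy, h1 hxy, h2 hxy, h1 hxy.symm, G.irrefl hxy, h3 hxy, h2 hxy.symm, h3 hxy.symm,
    G.irrefl hxy]

lemma exit_le_one (ok : Brooks G S) (hX : X ⊆ S) (hy : y ∈ S) (hu : u ∈ X) (hv : v ∈ X)
    (huv : u ≠ v) (yu : G.Adj y u) (yv : G.Adj y v) : (nb G (S \ X) y).card ≤ 1 := by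
  have h1 : ({u, v} : Finset V) ⊆ nb G X y := by
    intro x
    simp only [Finset.mem_insert, Finset.mem_singleton]
    rintro (rfl | rfl)
    exacts [mem_nb.2 ⟨hu, yu⟩, mem_nb.2 ⟨hv, yv⟩]
  have h2 := Finset.card_le_card h1
  rw [Finset.card_pair huv] at h2
  have h3 := nb_union_card (G := G) (v := y) (Finset.sdiff_disjoint (s := X) (t := S))
  rw [Finset.sdiff_union_of_subset hX] at h3
  have := ok.deg _ hy
  omega

/-- A triangle whose three outside neighbours have a common neighbour. -/
def triClaw : SimpleGraph (Fin 7) :=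
  graphOfEdges 7 [(0, 1), (0, 2), (1, 2), (0, 3), (1, 4), (2, 5), (3, 6), (4, 6), (5, 6)]

instance : DecidableRel triClaw.Adj := graphOfEdgesDec _ _

/-- A triangle whose outside neighbours lie on a 6-cycle. -/
def triHex : SimpleGraph (Fin 9) :=
  graphOfEdges 9 [(0, 1), (0, 2), (1, 2), (0, 3), (1, 4), (2, 5), (3, 6), (4, 6), (4, 7), (5, 7),
    (3, 8), (5, 8)]

instance : DecidableRel triHex.Adj := graphOfEdgesDec _ _

namespace TriX

lemma nadj_ab (t : TriX G S a b c a' b' c') (h : MinG G S) : ¬ G.Adj a b' := by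
  intro k
  rcases t.adj_a h t.hb' k with e | e | e
  exacts [t.bb.ne e.symm, t.nbc e, t.ne h e.symm]

lemma out (t : TriX G S a b c a' b' c') (h : MinG G S) (hx : G.Adj a' x) (hx' : G.Adj b' x) :
    x ≠ a ∧ x ≠ b ∧ x ≠ c ∧ x ≠ a' ∧ x ≠ b' ∧ x ≠ c' := by
  refine ⟨?_, ?_, ?_, hx.ne.symm, hx'.ne.symm, ?_⟩ <;> rintro rfl
  · exact t.nadj_ab h hx'.symm
  · exact t.swap.nadj_ab h hx.symm
  · exact t.rot.rot.nadj_ab h hx.symm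
  · exact t.rot.nadj h hx'

/-- Each of `a'`, `b'`, `c'` must have a further neighbour, and these are distinct. Delete the
configuration with the further neighbour of `c'`, and join the other two by an edge: whichever is
not chosen frees `a'` or `b'`, to be taken with `c'` and a triangle vertex. -/
lemma no_claw (t : TriX G S a b c a' b' c') (h : MinG G S) (hx : x ∈ S) (ax : G.Adj a' x)
    (bx : G.Adj b' x) (cx : G.Adj c' x) : False := by
  obtain ⟨o1, o2, o3, o4, o5, o6⟩ := t.out h ax bx
  obtain ⟨f, hf⟩ : ∃ f : Fin 7 → V, f = ![a, b, c, a', b', c', x] := ⟨_, rfl⟩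
  have hi : Function.Injective f := by
    rw [hf, ← List.nodup_ofFn]
    simp [t.ab.ne, t.ac.ne, t.bc.ne, t.aa.ne, t.bb.ne, t.cc.ne, t.nab.symm, t.nac.symm,
      t.nba.symm, t.nbc.symm, t.nca.symm, t.ncb.symm, t.ne h, t.rot.ne h, (t.rot.rot.ne h).symm,
      o1.symm, o2.symm, o3.symm, o4.symm, o5.symm, o6.symm]
  have hS : ∀ i, f i ∈ S := by
    intro i; subst hf; fin_cases i
    exacts [t.ha, t.hb, t.hc, t.ha', t.hb', t.hc', hx]
  have hom : ∀ i j, triClaw.Adj i j → G.Adj (f i) (f j) := by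
    subst hf
    exact hom_of_edges (by
      simp only [List.mem_cons, List.not_mem_nil, or_false, forall_eq_or_imp, forall_eq]
      exact ⟨t.ab, t.ac, t.bc, t.aa, t.bb, t.cc, ax, bx, cx⟩)
  have n34 : ¬ G.Adj (f 3) (f 4) := by subst hf; exact t.nadj h
  have n45 : ¬ G.Adj (f 4) (f 5) := by subst hf; exact t.rot.nadj h
  have n35 : ¬ G.Adj (f 3) (f 5) := by subst hf; exact fun k => t.rot.rot.nadj h k.symm
  clear hf
  have hX : img f ⊆ S := img_subset.2 hS
  have fX : ∀ i, f i ∈ img f := by simp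
  have full : ∀ i x, pdeg triClaw i = 3 → x ∈ S → G.Adj (f i) x → x ∈ img f := by
    intro i x hd hx hix
    obtain ⟨j, -, rfl⟩ := full_nb h.ok hi hS hom hd hx hix
    exact fX j
  have nadj : ∀ i j, pdeg triClaw j = 3 → ¬ triClaw.Adj j i → ¬ G.Adj (f i) (f j) := by
    intro i j hd hn hij
    obtain ⟨l, hl, e⟩ := full_nb h.ok hi hS hom hd (hS i) hij.symm
    exact hn (hi e ▸ hl)
  have hF : frees G S ∩ img f ⊆ {f 3, f 4, f 5, f 6} := by
    intro v hv
    rw [Finset.mem_inter, mem_img] at hv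
    obtain ⟨hv, i, rfl⟩ := hv
    have key : ∀ i, (i = 3 ∨ i = 4 ∨ i = 5 ∨ i = 6) ∨
        ∃ j l, triClaw.Adj i j ∧ triClaw.Adj i l ∧ triClaw.Adj j l := by decide
    rcases key i with (rfl | rfl | rfl | rfl) | ⟨j, l, ij, il, jl⟩
    · simp
    · simp
    · simp
    · simp
    · exact (MinG.not_inTri_of_frees hv (hS j) (hS l) (hom _ _ ij) (hom _ _ il) (hom _ _ jl)).elim
  have hFc : ∀ U, (frees G S ∩ (img f ∪ U)).card ≤ 4 + U.card := by
    intro U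
    rw [Finset.inter_union_distrib_left]
    exact (Finset.card_union_le _ _).trans (add_le_add ((Finset.card_le_card hF).trans
      Finset.card_le_four) (Finset.card_le_card Finset.inter_subset_right))
  have hXc : ∀ U, (img f ∪ U).card ≤ 7 + U.card := fun U =>
    (Finset.card_union_le _ _).trans (by rw [img_card hi])
  have s3 : ∀ i j l, ({f i, f j, f l} : Finset V) ⊆ img f := by
    intro i j l x
    simp only [Finset.mem_insert, Finset.mem_singleton]
    rintro (rfl | rfl | rfl) <;> exact fX _
  have c3 : ∀ i j l, i ≠ j → i ≠ l → j ≠ l → ({f i, f j, f l} : Finset V).card = 3 := by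
    intro i j l ij il jl
    rw [Finset.card_insert_of_notMem (by simp [hi.eq_iff, ij, il]),
      Finset.card_pair (by simp [hi.eq_iff, jl])]
  -- If two of them had at most one further neighbour altogether, deleting at most eight vertices
  -- would gain three independent ones: 126 against 112 + 5.
  have small : ∀ i j l, i ≠ j → i ≠ l → j ≠ l → ¬ G.Adj (f i) (f j) → pdeg triClaw l = 3 →
      ¬ triClaw.Adj l i → ¬ triClaw.Adj l j →
      1 < (nb G (S \ img f) (f i) ∪ nb G (S \ img f) (f j)).card := by
    intro i j l ij il jl hij hl li lj
    by_contra hle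
    obtain ⟨U, hU⟩ : ∃ U, U = nb G (S \ img f) (f i) ∪ nb G (S \ img f) (f j) := ⟨_, rfl⟩
    rw [← hU] at hle
    have hUS : U ⊆ S := hU ▸ Finset.union_subset (nb_subset.trans Finset.sdiff_subset)
      (nb_subset.trans Finset.sdiff_subset)
    have hd := h.deletion (X := img f ∪ U) (I := {f i, f j, f l}) (Finset.union_subset hX hUS)
      ⟨f 0, Finset.mem_union_left _ (fX 0)⟩ ((s3 i j l).trans Finset.subset_union_left)
      (indep_three hij (nadj _ _ hl li) (nadj _ _ hl lj)) (by
        intro u hu x hx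
        rw [mem_nb] at hx
        by_cases hxX : x ∈ img f
        · exact Finset.mem_union_left _ hxX
        simp only [Finset.mem_insert, Finset.mem_singleton] at hu
        rcases hu with rfl | rfl | rfl
        · exact Finset.mem_union_right _ (hU ▸ Finset.mem_union_left _
            (mem_nb.2 ⟨Finset.mem_sdiff.2 ⟨hx.1, hxX⟩, hx.2⟩))
        · exact Finset.mem_union_right _ (hU ▸ Finset.mem_union_right _
            (mem_nb.2 ⟨Finset.mem_sdiff.2 ⟨hx.1, hxX⟩, hx.2⟩))
        · exact absurd (full l x hl hx.1 hx.2) hxX)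
    have := hFc U
    have := hXc U
    rw [c3 i j l ij il jl] at hd
    omega
  have exit : ∀ i j l, j ≠ l → triClaw.Adj i j → triClaw.Adj i l →
      (nb G (S \ img f) (f i)).card ≤ 1 := fun i j l hjl ij il =>
    exit_le_one h.ok hX (hS i) (fX j) (fX l) (fun e => hjl (hi e)) (hom _ _ ij) (hom _ _ il)
  have e3 := exit 3 0 6 (by decide) (by decide) (by decide)
  have e4 := exit 4 1 6 (by decide) (by decide) (by decide)
  have e5 := exit 5 2 6 (by decide) (by decide) (by decide)
  have m34 := small 3 4 2 (by decide) (by decide) (by decide) n34 (by decide) (by decide)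
    (by decide)
  have m35 := small 3 5 1 (by decide) (by decide) (by decide) n35 (by decide) (by decide)
    (by decide)
  have m45 := small 4 5 0 (by decide) (by decide) (by decide) n45 (by decide) (by decide)
    (by decide)
  have sep : ∀ {A B : Finset V}, A.card ≤ 1 → B.card ≤ 1 → 1 < (A ∪ B).card →
      Disjoint A B ∧ A.Nonempty ∧ B.Nonempty := by
    intro A B hA hB hAB
    have hc := Finset.card_union_add_card_inter A B
    refine ⟨?_, ?_, ?_⟩
    · rw [Finset.disjoint_iff_inter_eq_empty, ← Finset.card_eq_zero]; omega
    · rw [← Finset.card_pos]; omega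
    · rw [← Finset.card_pos]; omega
  obtain ⟨d34, ⟨p, hp⟩, ⟨q, hq⟩⟩ := sep e3 e4 m34
  have d35 := (sep e3 e5 m35).1
  have d45 := (sep e4 e5 m45).1
  have hp' := mem_nb.1 hp
  have hq' := mem_nb.1 hq
  have hpq : p ≠ q := fun e => Finset.disjoint_left.1 d34 hp (e ▸ hq)
  have hY : img f ∪ nb G (S \ img f) (f 5) ⊆ S :=
    Finset.union_subset hX (nb_subset.trans Finset.sdiff_subset)
  have out : ∀ {v}, v ∈ S \ img f → v ∉ nb G (S \ img f) (f 5) →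
      v ∈ S \ (img f ∪ nb G (S \ img f) (f 5)) := by
    intro v h1 h2
    rw [Finset.mem_sdiff] at h1
    rw [Finset.mem_sdiff, Finset.mem_union]
    exact ⟨h1.1, fun k => k.elim h1.2 h2⟩
  have hpY := out hp'.1 (Finset.disjoint_left.1 d35 hp)
  have hqY := out hq'.1 (Finset.disjoint_left.1 d45 hq)
  have back : ∀ i, f i ∈ S \ (S \ (img f ∪ nb G (S \ img f) (f 5))) := by
    intro i
    simp [hS i]
  -- This is tight: 42·3 = 14·8 + 5 + 9, against a strict inequality.
  have hr := h.reduce_star (k := 3) hY ⟨f 0, Finset.mem_union_left _ (fX 0)⟩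
    (h.edge_ok Finset.sdiff_subset hpY hqY hpq ⟨f 3, back 3, hp'.2⟩ ⟨f 4, back 4, hq'.2⟩) hpY (by
    intro J hJ hj
    have hjG : Indep G J := fun u hu v hv huv => hj u hu v hv (le_addStar huv)
    have hJ' : ∀ v ∈ J, v ∈ S ∧ v ∉ img f ∧ v ∉ nb G (S \ img f) (f 5) := by
      intro v hv
      have := hJ hv
      rwa [Finset.mem_sdiff, Finset.mem_union, not_or] at this
    have nF : ∀ i, pdeg triClaw i = 3 → ∀ v ∈ J, ¬ G.Adj (f i) v := fun i hd v hv hiv =>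
      (hJ' v hv).2.1 (full i v hd (hJ' v hv).1 hiv)
    have n5 : ∀ v ∈ J, ¬ G.Adj (f 5) v := fun v hv hiv =>
      (hJ' v hv).2.2 (mem_nb.2 ⟨Finset.mem_sdiff.2 ⟨(hJ' v hv).1, (hJ' v hv).2.1⟩, hiv⟩)
    have ext : ∀ i l r, i ≠ 5 → i ≠ l → 5 ≠ l → ¬ G.Adj (f i) (f 5) → pdeg triClaw l = 3 →
        ¬ triClaw.Adj l i → ¬ triClaw.Adj l 5 → (nb G (S \ img f) (f i)).card ≤ 1 →
        r ∈ nb G (S \ img f) (f i) → r ∉ J → ∃ I' ⊆ S, Indep G I' ∧ J.card + 3 ≤ I'.card := by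
      intro i l r i5 il l5 hi5 hl li l5' hc hr hrJ
      rw [← c3 i 5 l i5 il l5]
      refine MinG.extend hY hJ hjG ((s3 i 5 l).trans Finset.subset_union_left)
        (indep_three hi5 (nadj _ _ hl li) (nadj _ _ hl l5')) ?_
      intro u hu v hv huv
      simp only [Finset.mem_insert, Finset.mem_singleton] at hu
      rcases hu with rfl | rfl | rfl
      · have := Finset.card_le_one.1 hc v
          (mem_nb.2 ⟨Finset.mem_sdiff.2 ⟨(hJ' v hv).1, (hJ' v hv).2.1⟩, huv⟩) r hr
        exact hrJ (this ▸ hv)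
      · exact n5 v hv huv
      · exact nF l hl v hv huv
    by_cases hpJ : p ∈ J
    · refine ext 4 0 q (by decide) (by decide) (by decide) n45 (by decide) (by decide) (by decide)
        e4 hq fun hqJ => hj p hpJ q hqJ (addStar_adj.2 (Or.inr ⟨hpq, Or.inl ⟨rfl, by simp⟩⟩))
    · exact ext 3 1 p (by decide) (by decide) (by decide) n35 (by decide) (by decide) (by decide)
        e3 hp hpJ)
  have := hFc (nb G (S \ img f) (f 5))
  have := hXc (nb G (S \ img f) (f 5))
  omega

/-- With `xy` an edge, `b', x, y` is a second triangle linked to the first through `bb'`, `a'` and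
`c'`, and `z` completes the 9-vertex Havel necklace. -/
lemma hex_chord (t : TriX G S a b c a' b' c') (h : MinG G S) (hx : x ∈ S) (hy : y ∈ S) (hz : z ∈ S)
    (ax : G.Adj a' x) (bx : G.Adj b' x) (by' : G.Adj b' y) (cy : G.Adj c' y) (az : G.Adj a' z)
    (cz : G.Adj c' z) : ¬ G.Adj x y := by
  intro xy
  obtain ⟨o1, o2, o3, o4, o5, o6⟩ := t.out h ax bx
  obtain ⟨q1, q2, q3, q4, q5, q6⟩ := t.rot.out h by' cy
  obtain ⟨r1, r2, r3, r4, r5, r6⟩ := t.rot.rot.out h cz az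
  have xz : x ≠ z := by rintro rfl; exact t.no_claw h hx ax bx cz
  have yz : y ≠ z := by rintro rfl; exact t.no_claw h hy az by' cz
  have hgS : ∀ i, ![b, a, c, b', x, y, a', c', z] i ∈ S := by
    intro i; fin_cases i
    exacts [t.hb, t.ha, t.hc, t.hb', hx, hy, t.ha', t.hc', hz]
  obtain ⟨g, hg⟩ := emb_full havelNecklace9 h.ok (by decide)
    ![b, a, c, b', x, y, a', c', z]
    (by
      rw [← List.nodup_ofFn]
      simp [t.ab.ne.symm, t.ac.ne, t.bc.ne, t.aa.ne, t.bb.ne, t.cc.ne, t.nab.symm, t.nac.symm,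
        t.nba.symm, t.nbc.symm, t.nca.symm, t.ncb.symm, (t.ne h).symm, t.rot.ne h,
        (t.rot.rot.ne h).symm, xy.ne, *, o1.symm, o2.symm, o3.symm, o5.symm,
        q1.symm, q2.symm, q3.symm, q4.symm, r1.symm, r2.symm, r3.symm, r4.symm,
        r5.symm, r6.symm]) hgS
    (hom_of_edges (by
      simp only [List.mem_cons, List.not_mem_nil, or_false, forall_eq_or_imp, forall_eq]
      exact ⟨t.ab.symm, t.bc, t.ac, bx, by', xy, t.bb, t.aa, ax, t.cc, cy, az, cz.symm⟩))
  exact h.no_big (.neck .h9) g fun i => hg i ▸ hgS i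

/-- Identify the pairwise non-adjacent `x, y, z`: keep `z`, give it the further neighbours of `x`
and `y`, and delete the other eight vertices. A `K₄` can arise only if the further neighbours of `x,
y, z` form a triangle, and then `G` contains a triangle-dominated 6-cycle. The count 126 against 112
+ 5 + 9 is again tight. -/
lemma no_hex (t : TriX G S a b c a' b' c') (h : MinG G S) (hx : x ∈ S) (hy : y ∈ S) (hz : z ∈ S)
    (ax : G.Adj a' x) (bx : G.Adj b' x) (by' : G.Adj b' y) (cy : G.Adj c' y) (az : G.Adj a' z)
    (cz : G.Adj c' z) : False := by
  have nxy := t.hex_chord h hx hy hz ax bx by' cy az cz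
  have nxz := t.swap.hex_chord h hx hz hy bx ax az cz by' cy
  have nyz := t.rot.hex_chord h hy hz hx by' cy cz az bx ax
  obtain ⟨o1, o2, o3, o4, o5, o6⟩ := t.out h ax bx
  obtain ⟨q1, q2, q3, q4, q5, q6⟩ := t.rot.out h by' cy
  obtain ⟨r1, r2, r3, r4, r5, r6⟩ := t.rot.rot.out h cz az
  have xy : x ≠ y := by rintro rfl; exact t.no_claw h hx ax bx cy
  have xz : x ≠ z := by rintro rfl; exact t.no_claw h hx ax bx cz
  have yz : y ≠ z := by rintro rfl; exact t.no_claw h hy az by' cz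
  obtain ⟨f, hf⟩ : ∃ f : Fin 9 → V, f = ![a, b, c, a', b', c', x, y, z] := ⟨_, rfl⟩
  have hi : Function.Injective f := by
    rw [hf, ← List.nodup_ofFn]
    simp [t.ab.ne, t.ac.ne, t.bc.ne, t.aa.ne, t.bb.ne, t.cc.ne, t.nab.symm, t.nac.symm,
      t.nba.symm, t.nbc.symm, t.nca.symm, t.ncb.symm, t.ne h, t.rot.ne h, (t.rot.rot.ne h).symm,
      xy, xz, yz, o1.symm, o2.symm, o3.symm, o4.symm, o5.symm, o6.symm, q1.symm, q2.symm, q3.symm,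
      q4.symm, q5.symm, q6.symm, r1.symm, r2.symm, r3.symm, r4.symm, r5.symm, r6.symm]
  have hS : ∀ i, f i ∈ S := by
    intro i; subst hf; fin_cases i
    exacts [t.ha, t.hb, t.hc, t.ha', t.hb', t.hc', hx, hy, hz]
  have hom : ∀ i j, triHex.Adj i j → G.Adj (f i) (f j) := by
    subst hf
    exact hom_of_edges (by
      simp only [List.mem_cons, List.not_mem_nil, or_false, forall_eq_or_imp, forall_eq]
      exact ⟨t.ab, t.ac, t.bc, t.aa, t.bb, t.cc, ax, bx, by', cy, az, cz⟩)
  have n67 : ¬ G.Adj (f 6) (f 7) := by subst hf; exact nxy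
  have n68 : ¬ G.Adj (f 6) (f 8) := by subst hf; exact nxz
  have n78 : ¬ G.Adj (f 7) (f 8) := by subst hf; exact nyz
  clear hf
  obtain ⟨X, hXd⟩ : ∃ X, X = (img f).erase (f 8) := ⟨_, rfl⟩
  have hX : X ⊆ S := hXd ▸ (Finset.erase_subset _ _).trans (img_subset.2 hS)
  have fX : ∀ i, i ≠ 8 → f i ∈ X := by
    intro i hi8
    rw [hXd, Finset.mem_erase]
    exact ⟨fun e => hi8 (hi e), by simp⟩
  have cX : X.card = 8 := by
    rw [hXd, Finset.card_erase_of_mem (by simp), img_card hi]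
  have h8 : f 8 ∈ S \ X := by
    rw [Finset.mem_sdiff, hXd]
    exact ⟨hS 8, Finset.notMem_erase _ _⟩
  have full : ∀ i x, pdeg triHex i = 3 → x ∈ S → G.Adj (f i) x → ∃ j, triHex.Adj i j ∧ f j = x :=
    fun i x hd hx hix => full_nb h.ok hi hS hom hd hx hix
  have nadj : ∀ i j, pdeg triHex j = 3 → ¬ triHex.Adj j i → ¬ G.Adj (f i) (f j) := by
    intro i j hd hn hij
    obtain ⟨l, hl, e⟩ := full j _ hd (hS i) hij.symm
    exact hn (hi e ▸ hl)
  have hF : (frees G S ∩ X).card ≤ 5 := by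
    refine (Finset.card_le_card (t := {f 3, f 4, f 5, f 6, f 7}) ?_).trans Finset.card_le_five
    intro v hv
    rw [Finset.mem_inter, hXd, Finset.mem_erase, mem_img] at hv
    obtain ⟨hv, h8, i, rfl⟩ := hv
    have key : ∀ i, (i = 3 ∨ i = 4 ∨ i = 5 ∨ i = 6 ∨ i = 7) ∨ i = 8 ∨
        ∃ j l, triHex.Adj i j ∧ triHex.Adj i l ∧ triHex.Adj j l := by decide
    rcases key i with (rfl | rfl | rfl | rfl | rfl) | rfl | ⟨j, l, ij, il, jl⟩
    · simp
    · simp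
    · simp
    · simp
    · simp
    · exact absurd rfl h8
    · exact (MinG.not_inTri_of_frees hv (hS j) (hS l) (hom _ _ ij) (hom _ _ il) (hom _ _ jl)).elim
  have exit : ∀ i j l, j ≠ l → j ≠ 8 → l ≠ 8 → triHex.Adj i j → triHex.Adj i l →
      (nb G (S \ X) (f i)).card ≤ 1 := fun i j l hjl hj hl ij il =>
    exit_le_one h.ok hX (hS i) (fX j hj) (fX l hl) (fun e => hjl (hi e)) (hom _ _ ij) (hom _ _ il)
  have e6 := exit 6 3 4 (by decide) (by decide) (by decide) (by decide) (by decide)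
  have e7 := exit 7 4 5 (by decide) (by decide) (by decide) (by decide) (by decide)
  have e8 := exit 8 3 5 (by decide) (by decide) (by decide) (by decide) (by decide)
  have td : ∀ u ∈ nb G (S \ X) (f 6), ∀ v ∈ nb G (S \ X) (f 7), ∀ w ∈ nb G (S \ X) (f 8),
      G.Adj u v → G.Adj v w → G.Adj u w → False := by
    intro u hu v hv w hw uv vw uw
    rw [mem_nb] at hu hv hw
    have new : ∀ u ∈ S \ X, u ≠ f 8 → ∀ i, f i ≠ u := by
      rintro u hu hu8 i rfl
      exact (Finset.mem_sdiff.1 hu).2 (fX i fun e => hu8 (e ▸ rfl))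
    have u' := new u hu.1 fun e => n68 (e ▸ hu.2)
    have v' := new v hv.1 fun e => n78 (e ▸ hv.2)
    have w' := new w hw.1 hw.2.ne.symm
    have hgS : ∀ i, ![f 3, f 6, f 4, f 7, f 5, f 8, f 0, f 1, f 2, u, v, w] i ∈ S := by
      intro i; fin_cases i
      exacts [hS 3, hS 6, hS 4, hS 7, hS 5, hS 8, hS 0, hS 1, hS 2, Finset.sdiff_subset hu.1,
        Finset.sdiff_subset hv.1, Finset.sdiff_subset hw.1]
    obtain ⟨g, hg⟩ := emb_full triangleDominatedSixCycle h.ok (by decide)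
      ![f 3, f 6, f 4, f 7, f 5, f 8, f 0, f 1, f 2, u, v, w]
      (by rw [← List.nodup_ofFn]; simp [hi.eq_iff, u', v', w', uv.ne, uw.ne, vw.ne]) hgS
      (hom_of_edges (by
        simp only [List.mem_cons, List.not_mem_nil, or_false, forall_eq_or_imp, forall_eq]
        exact ⟨hom 3 6 (by decide), hom 6 4 (by decide), hom 4 7 (by decide), hom 7 5 (by decide),
          hom 5 8 (by decide), hom 8 3 (by decide), hom 0 1 (by decide), hom 1 2 (by decide),
          hom 2 0 (by decide), hom 3 0 (by decide), hom 4 1 (by decide), hom 5 2 (by decide),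
          uv, vw, uw.symm, hu.2, hv.2, hw.2⟩))
    exact h.no_big .td g fun i => hg i ▸ hgS i
  obtain ⟨Q, hQ⟩ : ∃ Q, Q = nb G (S \ X) (f 6) ∪ nb G (S \ X) (f 7) := ⟨_, rfl⟩
  have hQS : Q ⊆ S \ X := hQ ▸ Finset.union_subset nb_subset nb_subset
  have h8Q : f 8 ∉ Q := by
    rw [hQ, Finset.mem_union, mem_nb, mem_nb]
    tauto
  have back : ∀ i, i ≠ 8 → f i ∈ S \ (S \ X) := by
    intro i hi8
    simp [hS i, fX i hi8]
  have nbp : ∀ u ∈ S \ X, (addStar G (f 8) Q).Adj (f 8) u → u ∈ nb G (S \ X) (f 6) ∨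
      u ∈ nb G (S \ X) (f 7) ∨ u ∈ nb G (S \ X) (f 8) := by
    intro u hu hadj
    have := nb_addStar_self (mem_nb.2 ⟨hu, hadj⟩)
    rw [Finset.mem_union, Finset.mem_inter, hQ, Finset.mem_union] at this
    tauto
  have hok : Brooks (addStar G (f 8) Q) (S \ X) := by
    refine ok_addStar h.ok Finset.sdiff_subset ?_ ?_ ?_
    · have k1 := (Finset.card_le_card
        (nb_addStar_self (G := G) (S := S \ X) (p := f 8) (Q := Q))).trans
        (Finset.card_union_le _ _)
      have k2 := Finset.card_le_card (Finset.inter_subset_left (s₁ := Q) (s₂ := S \ X))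
      have k3 := Finset.card_union_le (nb G (S \ X) (f 6)) (nb G (S \ X) (f 7))
      rw [← hQ] at k3
      omega
    · intro q hq _
      rw [hQ, Finset.mem_union, mem_nb, mem_nb] at hq
      rcases hq with hq | hq
      · exact ⟨f 6, back 6 (by decide), hq.2⟩
      · exact ⟨f 7, back 7 (by decide), hq.2⟩
    · intro u hu v hv w hw pu pv pw uv vw uw
      have one : ∀ {A : Finset V} {r s}, A.card ≤ 1 → r ∈ A → s ∈ A → G.Adj r s → False :=
        fun hA hr hs hrs => hrs.ne (Finset.card_le_one.1 hA _ hr _ hs)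
      rcases nbp u hu pu with ku | ku | ku <;> rcases nbp v hv pv with kv | kv | kv
      · exact one e6 ku kv uv
      · rcases nbp w hw pw with kw | kw | kw
        · exact one e6 ku kw uw
        · exact one e7 kv kw vw
        · exact td u ku v kv w kw uv vw uw
      · rcases nbp w hw pw with kw | kw | kw
        · exact one e6 ku kw uw
        · exact td u ku w kw v kv uw vw.symm uv
        · exact one e8 kv kw vw
      · rcases nbp w hw pw with kw | kw | kw
        · exact one e6 kv kw vw
        · exact one e7 ku kw uw
        · exact td v kv u ku w kw uv.symm uw vw
      · exact one e7 ku kv uv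
      · rcases nbp w hw pw with kw | kw | kw
        · exact td w kw u ku v kv uw.symm uv vw.symm
        · exact one e7 ku kw uw
        · exact one e8 kv kw vw
      · rcases nbp w hw pw with kw | kw | kw
        · exact one e6 kv kw vw
        · exact td v kv w kw u ku vw uw.symm uv.symm
        · exact one e8 ku kw uw
      · rcases nbp w hw pw with kw | kw | kw
        · exact td w kw v kv u ku vw.symm uv.symm uw.symm
        · exact one e7 kv kw vw
        · exact one e8 ku kw uw
      · exact one e8 ku kv uv
  have c3 : ∀ i j l, i ≠ j → i ≠ l → j ≠ l → ({f i, f j, f l} : Finset V).card = 3 := by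
    intro i j l ij il jl
    rw [Finset.card_insert_of_notMem (by simp [hi.eq_iff, ij, il]),
      Finset.card_pair (by simp [hi.eq_iff, jl])]
  have s3 : ∀ i j l, i ≠ 8 → j ≠ 8 → l ≠ 8 → ({f i, f j, f l} : Finset V) ⊆ X := by
    intro i j l hi8 hj8 hl8 x
    simp only [Finset.mem_insert, Finset.mem_singleton]
    rintro (rfl | rfl | rfl)
    exacts [fX _ hi8, fX _ hj8, fX _ hl8]
  have hr := h.reduce_star (k := 3) hX ⟨f 0, fX 0 (by decide)⟩ hok h8 (by
    intro J hJ hj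
    have hjG : Indep G J := fun u hu v hv huv => hj u hu v hv (le_addStar huv)
    have nF : ∀ i, pdeg triHex i = 3 → (triHex.Adj i 8 → f 8 ∉ J) → ∀ v ∈ J, ¬ G.Adj (f i) v := by
      intro i hd h8J v hv hiv
      have hvS := Finset.mem_sdiff.1 (hJ hv)
      obtain ⟨j, hij, rfl⟩ := full i v hd hvS.1 hiv
      by_cases hj8 : j = 8
      · subst hj8; exact h8J hij hv
      · exact hvS.2 (fX j hj8)
    -- If `z` is chosen, add `x`, `y` and `a`; otherwise add `a'`, `b'` and `c`.
    by_cases h8J : f 8 ∈ J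
    · have nQ : ∀ v ∈ J, v ∉ Q := fun v hv hvQ =>
        hj _ h8J v hv (addStar_adj.2 (Or.inr ⟨fun e => h8Q (e ▸ hvQ), Or.inl ⟨rfl, hvQ⟩⟩))
      rw [← c3 6 7 0 (by decide) (by decide) (by decide)]
      refine MinG.extend hX hJ hjG (s3 6 7 0 (by decide) (by decide) (by decide))
        (indep_three n67 (nadj _ _ (by decide) (by decide)) (nadj _ _ (by decide) (by decide))) ?_
      intro u hu v hv huv
      simp only [Finset.mem_insert, Finset.mem_singleton] at hu
      rcases hu with rfl | rfl | rfl
      · exact nQ v hv (hQ ▸ Finset.mem_union_left _ (mem_nb.2 ⟨hJ hv, huv⟩))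
      · exact nQ v hv (hQ ▸ Finset.mem_union_right _ (mem_nb.2 ⟨hJ hv, huv⟩))
      · exact nF 0 (by decide) (fun k => absurd k (by decide)) v hv huv
    · rw [← c3 3 4 2 (by decide) (by decide) (by decide)]
      refine MinG.extend hX hJ hjG (s3 3 4 2 (by decide) (by decide) (by decide))
        (indep_three (nadj _ _ (by decide) (by decide)) (nadj _ _ (by decide) (by decide))
          (nadj _ _ (by decide) (by decide))) ?_
      intro u hu v hv huv
      simp only [Finset.mem_insert, Finset.mem_singleton] at hu
      rcases hu with rfl | rfl | rfl
      · exact nF 3 (by decide) (fun _ => h8J) v hv huv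
      · exact nF 4 (by decide) (fun _ => h8J) v hv huv
      · exact nF 2 (by decide) (fun _ => h8J) v hv huv)
  omega

end TriX

namespace MinG

lemma no_tri (h : MinG G S) (ha : a ∈ S) (hb : b ∈ S) (hc : c ∈ S) (ab : G.Adj a b)
    (ac : G.Adj a c) (bc : G.Adj b c) : False := by
  obtain ⟨a', b', c', t⟩ := h.exists_triX ha hb hc ab ac bc
  obtain ⟨x, hx, ax, bx⟩ := t.common h
  obtain ⟨y, hy, by', cy⟩ := t.rot.common h
  obtain ⟨z, hz, cz, az⟩ := t.rot.rot.common h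
  exact t.no_hex h hx hy hz ax bx by' cy az cz

/-- Without triangles Staton's bound applies, and `14 n + f ≤ 15 n` as there are no free diamonds.
-/
lemma false (h : MinG G S) : False := by
  obtain ⟨I, hI, hi, hle⟩ := staton (G := G) (S := S)
    ⟨h.ok.deg, fun u hu v hv w hw uv vw uw => h.no_tri hu hv hw uv uw vw⟩
  have h1 := h.not_good hI hi
  have h2 : (frees G S).card ≤ S.card := Finset.card_filter_le _ _
  omega

end MinG

theorem good_of_brooks (h : Brooks G S) : Good G S := by
  suffices ∀ (m : ℕ) (G : SimpleGraph V) (S : Finset V), S.card = m → Brooks G S → Good G S from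
    this _ G S rfl h
  intro m
  induction m using Nat.strong_induction_on with
  | _ m ih =>
    intro G S hm h
    by_contra hf
    exact MinG.false ⟨h, hf, fun G' S' hlt h' => ih _ (hm ▸ hlt) G' S' rfl h'⟩

end ThreeTight

/-! ### Back to the original definitions -/

namespace ThreeTight
open scoped Classical

variable {V : Type*} {G : SimpleGraph V} {n : ℕ} {P : SimpleGraph (Fin n)}

lemma Neck.isNecklace (h : Neck P) (f : P ↪g G) : IsNecklace (G.induce (Set.range f)) := by
  have e := f.isoInduceRange.symm
  cases h with
  | d6 => exact Or.inl (Or.inl ⟨e⟩)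
  | d9 => exact Or.inl (Or.inr (Or.inl ⟨e⟩))
  | d12 => exact Or.inl (Or.inr (Or.inr ⟨e⟩))
  | h9 => exact Or.inr (Or.inl ⟨e⟩)
  | h12 => exact Or.inr (Or.inr ⟨e⟩)

lemma Big.isThreeTight (h : Big P) (f : P ↪g G) : IsThreeTight (G.induce (Set.range f)) := by
  cases h with
  | neck h => exact Or.inr (Or.inl (h.isNecklace f))
  | td => exact Or.inr (Or.inr ⟨f.isoInduceRange.symm⟩)

lemma mem_fdiams {S D : Finset V} : D ∈ fdiams G S ↔ D ⊆ S ∧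
    (∃ f : diamondGraph ↪g G, img f = D) ∧
    ∀ (n : ℕ) (P : SimpleGraph (Fin n)), Neck P → ∀ f : P ↪g G, (∀ i, f i ∈ S) → ¬ D ⊆ img f := by
  simp [fdiams]

variable [Fintype V]

lemma IsThreeFree.mem_frees {v : V} (h : IsThreeFree G v) : v ∈ frees G Finset.univ := by
  refine ThreeTight.mem_frees.2 ⟨Finset.mem_univ v, ?_, ?_⟩
  · rintro ⟨a, -, b, -, va, vb, ab⟩
    have hi : Function.Injective ![v, a, b] := by
      rw [← List.nodup_ofFn]
      simp [va.ne, vb.ne, ab.ne]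
    let f : (⊤ : SimpleGraph (Fin 3)) ↪g G := ⟨⟨![v, a, b], hi⟩, by
      intro i j
      fin_cases i <;> fin_cases j <;> simp [va, vb, ab, va.symm, vb.symm, ab.symm]⟩
    exact h (Set.range f) ⟨(0 : Fin 3), rfl⟩ (Or.inl ⟨f.isoInduceRange.symm⟩)
  · rintro ⟨n, P, hP, f, -, i, rfl⟩
    exact h (Set.range f) ⟨i, rfl⟩ (hP.isThreeTight f)

lemma IsFreeDiamond.mem_fdiams {D : Set V} (h : IsFreeDiamond G D) :
    D.toFinset ∈ fdiams G Finset.univ := by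
  obtain ⟨⟨e⟩, hn⟩ := h
  refine ThreeTight.mem_fdiams.2 ⟨Finset.subset_univ _, ?_, ?_⟩
  · refine ⟨(SimpleGraph.Embedding.induce D).comp e.symm.toEmbedding, ?_⟩
    ext x
    simp only [mem_img, Set.mem_toFinset]
    constructor
    · rintro ⟨i, rfl⟩
      exact (e.symm i).2
    · intro hx
      refine ⟨e ⟨x, hx⟩, ?_⟩
      change ((e.symm (e ⟨x, hx⟩) : D) : V) = x
      rw [e.symm_apply_apply]
  · intro n P hP f _ hD
    refine hn (Set.range f) (fun x hx => ?_) (hP.isNecklace f)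
    simpa using hD (Set.mem_toFinset.2 hx)

/-- Only this inequality is needed, so it suffices that a copy of a pattern yields a 3-tight induced
subgraph or an induced necklace on its range. -/
lemma freeCount_le (G : SimpleGraph V) :
    freeCount G ≤ (frees G Finset.univ).card + (fdiams G Finset.univ).card := by
  refine add_le_add ?_ ?_
  · rw [← Set.ncard_coe_finset]
    exact Set.ncard_le_ncard fun v hv => IsThreeFree.mem_frees hv
  · rw [← Set.ncard_coe_finset,
      ← Set.ncard_image_of_injective _ (Finset.coe_injective (α := V))]
    refine Set.ncard_le_ncard fun D hD => ⟨D.toFinset, hD.mem_fdiams, by simp⟩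

lemma brooks_of_max_le [DecidableRel G.Adj] (hG : max G.maxDegree G.cliqueNum ≤ 3) :
    Brooks G Finset.univ := by
  constructor
  · intro v _
    refine le_trans (le_of_eq ?_) ((G.degree_le_maxDegree v).trans ((le_max_left _ _).trans hG))
    rw [← G.card_neighborFinset_eq_degree]
    congr 1
    ext x
    simp
  · intro a _ b _ c _ d _ ab ac ad bc bd cd
    have hc : G.IsClique (({a, b, c, d} : Finset V) : Set V) := by
      simp [SimpleGraph.isClique_iff, ab, ac, ad, bc, bd,
        cd]
    have h1 := (SimpleGraph.IsClique.card_le_cliqueNum (tc := hc)).trans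
      ((le_max_right _ _).trans hG)
    rw [Finset.card_insert_of_notMem (by simp [ab.ne, ac.ne, ad.ne]),
      Finset.card_insert_of_notMem (by simp [bc.ne, bd.ne]), Finset.card_pair cd.ne] at h1
    omega

end ThreeTight
theorem mainTheorem6 {V : Type*} [Fintype V] (G : SimpleGraph V) [DecidableRel G.Adj]
    (hG : max G.maxDegree G.cliqueNum ≤ 3) :
    (Fintype.card V : ℝ) / 3 + (ThreeTight.freeCount G : ℝ) / 42 ≤ (G.indepNum : ℝ) := by
  obtain ⟨I, -, hi, hle⟩ := ThreeTight.good_of_brooks (ThreeTight.brooks_of_max_le hG)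
  have h1 : I.card ≤ G.indepNum := SimpleGraph.IsIndepSet.card_le_indepNum
    fun u hu v hv _ => hi u hu v hv
  have h2 := ThreeTight.freeCount_le G
  rw [Finset.card_univ] at hle
  have h3 : 14 * Fintype.card V + ThreeTight.freeCount G ≤ 42 * G.indepNum := by omega
  have h4 : (14 * Fintype.card V + ThreeTight.freeCount G : ℝ) ≤ 42 * G.indepNum := by
    exact_mod_cast h3
  linarith
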